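/- **Theorem (Revised BCJ relation).** Let $K$ be a field of characteristic $0$ (e.g. $\mathbb R$ or $\mathbb C$) and $V$ a $K$-vector space with a symmetric bilinear form $v\cdot w$ (e.g. Minkowski space of any dimension); write $v^2=v\cdot v$ and $s_{v,w}=2\,v\cdot w$. Let $F\in K$, $F\neq 0$. In the tree-level $U(N)$ nonlinear sigma model with Cayley parametrization the colour-ordered vertices are $V_{2n+1}=0$ and $$V_{2n+2}(p_1,\dots,p_{2n+2})=\Big(-\frac1{2F^2}\Big)^{n}\Big(\sum_{i=0}^{n}p_{2i+1}\Big)^2 .$$ For an ordered list $l$ of momenta with sum $P_l$, the off-shell Berends–Giele current $\mathcal J(l)$ is defined by $\mathcal J(l)=1$ if $l$ has one entry, and otherwise by $$\mathcal J(l)=\frac{\mathcal A(1,l)}{P_l^2},\qquad \mathcal A(1,l)=-\sum_{\substack{l=l_1\cdots l_{m-1}\\ m\ge4}}V_m(-P_l,P_{l_1},\dots,P_{l_{m-1}})\,\mathcal J(l_1)\cdots\mathcal J(l_{m-1}),$$ where the sum is over all divisions of $l$ into $m-1\ge 3$ consecutive nonempty blocks. Put $\mathcal A(1,l)=P_l^2$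 if $l$ has one entry. Thus $\mathcal A(1,l)=p_1^2\,\mathcal J(l)$ with $p_1=-P_l$ the momentum of the off-shell leg $1$, whenever $p_1^2\ne0$. Let $\alpha=(\alpha_1,\dots,\alpha_r)$ and $\beta=(\beta_1,\dots,\beta_s)$ be ordered lists of on-shell legs, all of whose momenta have square $0$, and let $p_1=-\sum_i p_{\alpha_i}-\sum_j p_{\beta_j}$. Let $OP(\alpha\cup\beta)$ be the set of permutations of all these legs that preserve the order inside $\alpha$ and inside $\beta$. Assume that $P_\tau^2\neq0$ for every list $\tau$ of an odd number $\ge3$ of consecutive legs of $\alpha$, or of $\beta$, or of some $\sigma\in OP(\alpha\cup\beta)$ (in this last case with $\tau\ne\sigma$). For an ordering $\sigma$ of the legs of $\alpha$ and $\beta$ put $$c(\sigma)=\sum_{i=1}^r\ \sum_{x\text{ before }\alpha_i}s_{\alpha_i,x},$$ where $x$ runs over all legs that stand before $\alpha_i$ in the sequence $(1,\sigma)$, the leg $1$ (of momentum $p_1$) included. Then $$\sum_{\sigma\in OP(\alpha\cup\beta)}c(\sigma)\,\mathcal A(1,\sigma)=\sum_{\substack{\{A_1,\dots,A_R,B_1,\dots,B_S\}\\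 |R-S|=1}}\Big(\frac1{2F^2}\Big)^{\frac{R+S-1}2}p_1^2\,S_{\rm div}\,\mathcal J(A_1)\cdots\mathcal J(A_R)\,\mathcal J(B_1)\cdots\mathcal J(B_S),$$ where the sum is over all divisions of $\alpha$ into consecutive nonempty blocks $A_1,\dots,A_R$ and of $\beta$ into consecutive nonempty blocks $B_1,\dots,B_S$ with $|R-S|=1$, and $$S_{\rm div}=\begin{cases}c(A_1B_1A_2B_2\cdots B_SA_R)&\text{if }R-S=1,\\ c(B_1A_1B_2A_2\cdots A_RB_S)&\text{if }R-S=-1.\end{cases}$$ Moreover, for each such division, $$S_{\rm div}=-\Big(P_\alpha^2+\sum_{I=1}^R\sum_{J=1}^S c^{IJ}\,s_{P_{A_I},P_{B_J}}\Big),$$ where $P_\alpha=\sum_i p_{\alpha_i}$ and $\mathbf C(R,S)=(c^{IJ})$ is the matrix with $c^{IJ}=1$ if $I<J$ and $0$ otherwise when $R-S=-1$, and $c^{IJ}=1$ if $I\le J$ and $0$ otherwise when $R-S=1$. -/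

import Mathlib

namespace NLSM

section Combinatorics

variable {X : Type*}

/-- All divisions of an ordered list `l` into consecutive nonempty blocks, in order: the first block
is the head of `l` together with the next `k` entries, and the remainder is divided again.
See `mem_divisions`. -/
def divisions : List X → List (List (List X))
  | [] => [[]]
  | x :: l => (List.range (l.length + 1)).flatMap fun k =>
      (divisions (l.drop k)).map fun d => (x :: l.take k) :: d
termination_by l => l.length
decreasing_by simp only [List.length_drop, List.length_cons]; omega

/-- `d` is a division of `l` iff its blocks are nonempty and concatenate to `l`. -/
theorem mem_divisions (l : List X) (d : List (List X)) :
    d ∈ divisions l ↔ d.flatten = l ∧ [] ∉ d := by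
  induction d generalizing l with
  | nil => cases l with
    | nil => simp [divisions]
    | cons x l => simp [divisions]
  | cons b d ih => cases l with
    | nil => cases b <;> simp [divisions]
    | cons x l =>
      rw [divisions]
      simp only [List.mem_flatMap, List.mem_range, List.mem_map, List.cons.injEq]
      constructor
      · rintro ⟨k, hk, d', hd', hb, rfl⟩
        obtain ⟨h1, h2⟩ := (ih _).1 hd'
        subst hb
        simp [h1, h2]
      · rintro ⟨h1, h2⟩
        cases b with
        | nil => simp at h2
        | cons y b =>
          simp only [List.flatten_cons, List.cons_append, List.cons.injEq] at h1
          obtain ⟨rfl, rfl⟩ := h1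
          refine ⟨b.length, by simp, d, (ih _).2 ⟨by simp, ?_⟩, by simp, rfl⟩
          simp only [List.mem_cons, not_or] at h2
          exact h2.2

theorem length_lt_of_mem_divisions {l : List X} {d : List (List X)} {b : List X}
    (hd : d ∈ divisions l) (h2 : 2 ≤ d.length) (hb : b ∈ d) : b.length < l.length := by
  obtain ⟨rfl, hne⟩ := (mem_divisions l d).1 hd
  obtain ⟨s, t, rfl⟩ := List.append_of_mem hb
  have pos : ∀ u : List (List X), [] ∉ u → u ≠ [] → 0 < u.flatten.length := by
    intro u hu hu'
    cases u with
    | nil => exact absurd rfl hu'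
    | cons c u => cases c with
      | nil => simp at hu
      | cons x c => simp
  simp only [List.mem_append, List.mem_cons, not_or] at hne
  simp only [List.length_append, List.length_cons] at h2
  simp only [List.flatten_append, List.flatten_cons, List.length_append]
  by_cases hs : s = []
  · have := pos t hne.2.2 (by rintro rfl; subst hs; simp at h2)
    omega
  · have := pos s hne.1 hs
    omega

/-- All ways of merging two ordered lists while keeping the order inside each of them. -/
def shuffles : List X → List X → List (List X)
  | [], b => [b]
  | x :: a, [] => [x :: a]
  | x :: a, y :: b =>
      (shuffles a (y :: b)).map (x :: ·) ++ (shuffles (x :: a) b).map (y :: ·)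
termination_by a b => a.length + b.length

/-- `U₁ W₁ U₂ W₂ ⋯`, concatenated (used when the first list has one block more than the second). -/
def alternate : List (List X) → List (List X) → List X
  | [], _ => []
  | u :: us, ws => u ++ alternate ws us
termination_by us ws => us.length + ws.length

/-- The entries at the positions `1, 3, 5, …` (counting from `1`). -/
def oddEntries : List X → List X
  | [] => []
  | [x] => [x]
  | x :: _ :: l => x :: oddEntries l

end Combinatorics

noncomputable section

variable {K V : Type*} [Field K] [AddCommGroup V] [Module K V]

/-- The square `v² = v · v` of a momentum; `η` is the metric of spacetime. -/
def sq (η : LinearMap.BilinForm K V) (v : V) : K := η v v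

/-- The Mandelstam-type invariant `s_{v w} = 2 v · w`. -/
def mandelstam (η : LinearMap.BilinForm K V) (v w : V) : K := 2 * η v w

/-- Colour-ordered vertices in the Cayley parametrization, for the list `q = p₁, …, p_m` of the
incoming momenta: `V_{2n+1} = 0` and `V_{2n+2} = (-1/(2F²))ⁿ (p₁ + p₃ + ⋯ + p_{2n+1})²`. -/
def vertex (η : LinearMap.BilinForm K V) (F : K) (q : List V) : K :=
  if Even q.length then
    (-(1 / (2 * F ^ 2))) ^ (q.length / 2 - 1) * sq η (oddEntries q).sum
  else 0

/-- Off-shell Berends–Giele current `J` of an ordered list of momenta: `J(p) = 1` for one leg, and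
`J(l) = (i / P²) ∑ i V_m(-P, P₁, …, P_{m-1}) J(l₁) ⋯ J(l_{m-1})` otherwise, the sum being over the
divisions of `l` into `m - 1 ≥ 3` blocks; here `i · i = -1` is inserted. -/
def current (η : LinearMap.BilinForm K V) (F : K) (l : List V) : K :=
  if l.length = 1 then 1
  else -(1 / sq η l.sum) *
    (((divisions l).filter fun d => 3 ≤ d.length).attach.map fun d =>
      vertex η F (-l.sum :: d.1.map List.sum) *
        (d.1.attach.map fun b => current η F b.1).prod).sum
termination_by l.length
decreasing_by
  obtain ⟨d, hd⟩ := d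
  obtain ⟨b, hb⟩ := b
  simp only [List.mem_filter, decide_eq_true_eq] at hd
  exact length_lt_of_mem_divisions hd.1 (by omega) hb

/-- `𝒜(1, l)`: the current with the propagator of the off-shell leg `1` removed
(so `𝒜 = p₁² J`, see `amplitude_eq`). -/
def amplitude (η : LinearMap.BilinForm K V) (F : K) (l : List V) : K :=
  if l.length = 1 then sq η l.sum
  else -(((divisions l).filter fun d => 3 ≤ d.length).map fun d =>
      vertex η F (-l.sum :: d.map List.sum) * (d.map (current η F)).prod).sum

theorem amplitude_eq (η : LinearMap.BilinForm K V) (F : K) (l : List V) (h : sq η l.sum ≠ 0) :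
    amplitude η F l = sq η l.sum * current η F l := by
  rw [amplitude, current]
  split_ifs with h1
  · simp
  · have e : ∀ (L : List (List (List V))) (f : List (List V) → K),
        (L.attach.map fun d => f d.1) = L.map f := fun L f => by simp
    rw [e _ fun d => vertex η F (-l.sum :: d.map List.sum) *
      (d.attach.map fun b => current η F b.1).prod]
    simp only [List.attach_map_val]
    field_simp

/-- A leg of an ordered word: `inl a` is an `α`-leg of momentum `a`, `inr b` is any other leg
(a `β`-leg, or the leg `1`) of momentum `b`. -/
abbrev Leg (V : Type*) := V ⊕ V

/-- The momentum of a leg. -/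
def mom : Leg V → V := Sum.elim id id

/-- The momenta of the `α`-legs of a word. -/
def alphaMomenta (w : List (Leg V)) : List V := w.filterMap Sum.getLeft?

/-- The ordered permutations `OP(α ∪ β)`. -/
def orderedPerms (α β : List V) : List (List (Leg V)) :=
  shuffles (α.map Sum.inl) (β.map Sum.inr)

/-- The rule for reading coefficients: the sum of `s_{a x}` over all `α`-legs `a` of the word and
all legs `x` of the word that stand before `a`. -/
def readCoeff (η : LinearMap.BilinForm K V) : List (Leg V) → K
  | [] => 0
  | x :: w => ((alphaMomenta w).map fun a => mandelstam η a (mom x)).sum + readCoeff η w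

/-- The BCJ coefficient of `1, σ`; the leg `1`, of momentum `p₁`, stands before all of `σ`. -/
def bcjCoeff (η : LinearMap.BilinForm K V) (p₁ : V) (σ : List (Leg V)) : K :=
  readCoeff η (Sum.inr p₁ :: σ)

/-- The off-shell momentum `p₁ = -(∑ α + ∑ β)`. -/
def offShell (α β : List V) : V := -(α.sum + β.sum)

/-- The permutation sum `𝒜_RBCJ(r, s)` of the revised BCJ relation. -/
def revisedBCJSum (η : LinearMap.BilinForm K V) (F : K) (α β : List V) : K :=
  ((orderedPerms α β).map fun σ =>
    bcjCoeff η (offShell α β) σ * amplitude η F (σ.map mom)).sum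

/-- The divisions `{A₁, …, A_R, B₁, …, B_S}` of `{α, β}` with `|R - S| = 1`. -/
def divPairs (α β : List V) : List (List (List V) × List (List V)) :=
  ((divisions α).product (divisions β)).filter fun d =>
    d.1.length = d.2.length + 1 ∨ d.2.length = d.1.length + 1

/-- The order of the legs in the diagram of a division: `A₁ B₁ A₂ ⋯ B_S A_R` if `R - S = 1` and
`B₁ A₁ B₂ ⋯ A_R B_S` if `R - S = -1`. -/
def diagramWord (A B : List (List V)) : List (Leg V) :=
  if A.length = B.length + 1 then alternate (A.map (List.map Sum.inl)) (B.map (List.map Sum.inr))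
  else alternate (B.map (List.map Sum.inr)) (A.map (List.map Sum.inl))

/-- The coefficient `S_div` of a division, read off its diagram by the BCJ rule. -/
def divCoeff (η : LinearMap.BilinForm K V) (p₁ : V) (A B : List (List V)) : K :=
  bcjCoeff η p₁ (diagramWord A B)

/-- The coefficient matrix `C(r, s)`. -/
def coeffMatrix (r s : ℕ) : Matrix (Fin r) (Fin s) ℤ := fun i j =>
  if s = r + 1 then (if (i : ℕ) < j then 1 else 0)
  else if r = s + 1 then (if (i : ℕ) ≤ j then 1 else 0)
  else 0

/-- No propagator that occurs in the relation is singular, except possibly that of the leg `1` (whose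
propagator is removed from `𝒜`): `P² ≠ 0` for every odd number `≥ 3` of consecutive legs of `α`, or
of `β`, or of an ordered permutation of both (but not for the whole of that permutation). An even
number of legs has zero current, hence no propagator. -/
def RegularKinematics (η : LinearMap.BilinForm K V) (α β : List V) : Prop :=
  ∀ τ : List V, 3 ≤ τ.length → Odd τ.length →
    (τ <:+: α ∨ τ <:+: β ∨
      ∃ σ ∈ orderedPerms α β, τ <:+: σ.map mom ∧ τ.length < α.length + β.length) →
    sq η τ.sum ≠ 0

end

end NLSM

/-! The Berends–Giele currents are the tree expansion of a classical solution. Rescale them by `lam`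
with `lam² = -1/(2F²)` and collect them in a series x = ∑ lam J(w) w over words in noncommuting
letters. The recursion becomes □x + ∂x ((1 - x)⁻¹ - (1 + x)⁻¹) ∂x = 0, which says that U⁻¹∂U is
conserved for the Cayley transform U = (1 + x)/(1 - x).

Let x contain only α-legs and y only β-legs. If the two kinds of letters commuted, the product of
the two Cayley transforms would again have a conserved current, namely the sum of the two currents,
and its Cayley variable would be Z = (x + y)/(1 + yx). Expanding Z gives exactly the alternating
products x y x ⋯ and y x y ⋯ with an odd number of factors, that is, the divisions with |R - S| = 1.
The series of the currents of all mixed words obeys the same equation with the same linear part, so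
below the top order it agrees with Z. At top order its truncation has the amplitudes as a source,
and comparison with Z gives ∑ 𝒜(1, σ) = p₁² ∑ (diagrams). No division by p₁² occurs.

The coefficients c(σ) come from the next order of a deformation. Let t² = 0 and let the letters
commute up to AB = BA + 2t ∂A·∂B. Moving all weights into the α-letters, the word σ acquires the
weight 1 + t ∑ s_{ab}, the sum being over the α-legs a that stand before β-legs b. Momentum
conservation and the on-shell conditions give c(σ) = -(P_α² + this sum), so the parts of order t⁰
and t¹ together give the relation. What must be checked is that a product solution persists at first
order: the right group element is the symmetrized product VU + t ∂U·∂V of U and V, and its Cayley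
variable is xD + Dy with D = (1 + yx)⁻¹.

The letters are realized as finite matrices indexed by the pairs of suffixes of α and β still to be
removed, and ∂ as the commutator with the diagonal matrix of the remaining momentum. The argument is
carried by `fieldEq_shMat` (recursion as field equation), `firstOrderCommuting_matrix`,
`FirstOrderCommuting.fieldEq_product`, `sum_orderedPerms_eq` (uniqueness), `alternatingMat_top`
(expansion of Z) and `bcjCoeff_eq`. -/

namespace NLSM

/-! ### Inner derivations of a ring -/

section Derivation

variable {R : Type*} [Ring R]

/-- The inner derivation `[q, ·]`. -/
def der (q T : R) : R := q * T - T * q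

theorem der_mul (q A B : R) : der q (A * B) = der q A * B + A * der q B := by
  simp only [der]; noncomm_ring

theorem der_add (q A B : R) : der q (A + B) = der q A + der q B := by
  simp only [der]; noncomm_ring

theorem der_sub (q A B : R) : der q (A - B) = der q A - der q B := by
  simp only [der]; noncomm_ring

@[simp] theorem der_one (q : R) : der q 1 = 0 := by simp [der]

@[simp] theorem der_zero (q : R) : der q 0 = 0 := by simp [der]

theorem der_smul {S : Type*} [CommRing S] [Algebra S R] (q : R) (s : S) (A : R) :
    der q (s • A) = s • der q A := by
  simp [der, smul_sub]

theorem der_sum {ι : Type*} (q : R) (s : Finset ι) (f : ι → R) :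
    der q (∑ i ∈ s, f i) = ∑ i ∈ s, der q (f i) := by
  simp [der, Finset.mul_sum, Finset.sum_mul]

/-- Jacobi identity: the difference of the two sides is the commutator of `A` with `[q, q'] = 0`. -/
theorem der_der_comm {q q' : R} (h : Commute q q') (A : R) :
    der q (der q' A) = der q' (der q A) := by
  have h' := h.eq
  simp only [der]
  have e : q * (q' * A - A * q') - (q' * A - A * q') * q -
      (q' * (q * A - A * q) - (q * A - A * q) * q') =
      (q * q' - q' * q) * A + A * (q' * q - q * q') := by noncomm_ring
  rw [← sub_eq_zero, e, h']; simp

theorem der_inv (q : R) {A B : R} (hBA : B * A = 1) (hAB : A * B = 1) :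
    der q B = -(B * der q A * B) := by
  have h : der q (A * B) = 0 := by rw [hAB]; simp
  rw [der_mul] at h
  calc der q B = B * A * der q B := by rw [hBA, one_mul]
    _ = B * (der q A * B + A * der q B) - B * der q A * B := by noncomm_ring
    _ = _ := by rw [h]; simp

end Derivation

/-! ### The Cayley transform and the field equation -/

section Cayley

variable {S R ι : Type*} [CommRing S] [Ring R] [Algebra S R] [Fintype ι]

/-- The field equation of the sigma model in the Cayley parametrization,
`□x + ∂x · ((1 - x)⁻¹ - (1 + x)⁻¹) ∂x`, the inverses being `u` and `v`. -/
def fieldEq (c : ι → S) (Q : ι → R) (x u v : R) : R :=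
  ∑ μ, c μ • der (Q μ) (der (Q μ) x) + ∑ μ, c μ • (der (Q μ) x * (u - v) * der (Q μ) x)

/-- Differentiating the inverses `v` and `u` on the two sides of ∂x produces `-v` and `u`, which is
the cubic term of the field equation. Since `u` and `v` are units, conservation of this current and
the field equation are equivalent. -/
theorem divergence_cayley (c : ι → S) (Q : ι → R) {x u v : R}
    (hu : u * (1 - x) = 1) (hu' : (1 - x) * u = 1) (hv : v * (1 + x) = 1)
    (hv' : (1 + x) * v = 1) :
    ∑ μ, c μ • der (Q μ) (v * der (Q μ) x * u) = v * fieldEq c Q x u v * u := by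
  have h1 : ∀ μ, der (Q μ) (v * der (Q μ) x * u) =
      v * der (Q μ) (der (Q μ) x) * u + v * (der (Q μ) x * (u - v) * der (Q μ) x) * u := by
    intro μ
    rw [der_mul, der_mul, der_inv _ hu hu', der_inv _ hv hv', der_add, der_sub, der_one]
    noncomm_ring
  simp only [h1, fieldEq, smul_add, Finset.sum_add_distrib, mul_add, add_mul, Finset.mul_sum,
    Finset.sum_mul, mul_smul_comm, smul_mul_assoc]

/-- This identifies twice the current of `divergence_cayley` with U⁻¹∂U for U = (1 + x)(1 - x)⁻¹.
The derivative of U is 2 u ∂x u, and (1 + x) v = 1 is inserted after the first u. -/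
theorem der_cayley (q : R) {x u v : R}
    (hu : u * (1 - x) = 1) (hu' : (1 - x) * u = 1) (hv' : (1 + x) * v = 1) :
    der q ((1 + x) * u) = (1 + x) * u * ((2 : R) * (v * der q x * u)) := by
  have hxu : x * u = u - 1 := by
    have : (1 - x) * u = u - x * u := by noncomm_ring
    rw [this] at hu'; rw [← hu']; noncomm_ring
  have hux : u * x = u - 1 := by
    have : u * (1 - x) = u - u * x := by noncomm_ring
    rw [this] at hu; rw [← hu]; noncomm_ring
  have e1 : (1 + x) * u = u * (1 + x) := by rw [add_mul, mul_add, hxu, hux]; simp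
  rw [e1, der_mul, der_inv q hu hu', der_sub, der_add, der_one]
  have e2 : u * (1 + x) * (2 * (v * der q x * u)) = 2 * (u * ((1 + x) * v) * der q x * u) := by
    noncomm_ring
  rw [e2, hv']
  have e3 : -(u * (0 - der q x) * u) * (1 + x) + u * (0 + der q x) =
      u * der q x * (u * x + u + 1) := by noncomm_ring
  rw [e3, hux]
  noncomm_ring

/-- The Maurer–Cartan equation for `j = U⁻¹ ∂U`. -/
theorem flat_of_der {p q U W j k : R} (hpq : Commute p q) (hW : W * U = 1)
    (hj : der p U = U * j) (hk : der q U = U * k) :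
    der p k = der q j - (j * k - k * j) := by
  have h := der_der_comm hpq U
  rw [hj, hk, der_mul, der_mul, hj, hk] at h
  have h2 : W * (U * j * k + U * der p k) = W * (U * k * j + U * der q j) := by rw [h]
  have e1 : W * (U * j * k + U * der p k) = W * U * (j * k + der p k) := by noncomm_ring
  have e2 : W * (U * k * j + U * der q j) = W * U * (k * j + der q j) := by noncomm_ring
  rw [e1, e2, hW, one_mul, one_mul] at h2
  have : der p k = (j * k + der p k) - j * k := by noncomm_ring
  rw [this, h2]; noncomm_ring

end Cayley

/-! ### Products of two fields that commute to first order -/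

section Product

variable {S R R₀ ι : Type*} [CommRing S] [Ring R] [Algebra S R] [Ring R₀] [Fintype ι]

/-- Two subalgebras of a ring that commute up to first order in a parameter `t` with `t² = 0`, the
commutator being `2 t ∂A · ∂B`; `π` is the reduction at `t = 0`. -/
structure FirstOrderCommuting (c : ι → S) (Q : ι → R) (t : S) (π : R →+* R₀)
    (𝔞 𝔟 : Subalgebra S R) : Prop where
  commute_Q : ∀ μ ν, Commute (Q μ) (Q ν)
  sq_zero : t * t = 0
  smul_eq : ∀ A B : R, π A = π B → t • A = t • B
  der_left : ∀ μ, ∀ A ∈ 𝔞, der (Q μ) A ∈ 𝔞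
  der_right : ∀ μ, ∀ B ∈ 𝔟, der (Q μ) B ∈ 𝔟
  commute_red : ∀ A ∈ 𝔞, ∀ B ∈ 𝔟, π A * π B = π B * π A
  commutator : ∀ A ∈ 𝔞, ∀ B ∈ 𝔟,
    A * B = B * A + (2 * t) • ∑ μ, c μ • (der (Q μ) A * der (Q μ) B)

variable {c : ι → S} {Q : ι → R} {t : S} {π : R →+* R₀} {𝔞 𝔟 : Subalgebra S R}

/-- Behind a factor `t` only the reductions at t = 0 count, so there elements of the two subalgebras
may be treated as commuting. -/
theorem FirstOrderCommuting.smul_sum_eq (H : FirstOrderCommuting c Q t π 𝔞 𝔟) (f g : ι → R)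
    (h : ∀ ν, π (f ν) = π (g ν)) : t • ∑ ν, c ν • f ν = t • ∑ ν, c ν • g ν := by
  simp only [Finset.smul_sum, smul_comm t]
  exact Finset.sum_congr rfl fun ν _ => by rw [H.smul_eq _ _ (h ν)]

theorem FirstOrderCommuting.smul_smul_eq_zero (H : FirstOrderCommuting c Q t π 𝔞 𝔟) (A : R) :
    t • t • A = 0 := by rw [smul_smul, H.sq_zero, zero_smul]

/-- The current of the product of two fields. -/
def productCurrent (c : ι → S) (Q : ι → R) (t : S) (j k : ι → R) (μ : ι) : R :=
  j μ + k μ + t • ∑ ν, c ν • (der (Q ν) (j μ) * k ν - j ν * der (Q ν) (k μ))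

/-- The order-t part of `der_product`. Factors from different subalgebras commute here, while
factors from the same one do not. -/
theorem commuting_identity {U V j j' dj k k' dk : R₀}
    (hUV : U * V = V * U) (hUk : U * k = k * U) (hUk' : U * k' = k' * U) (hUdk : U * dk = dk * U)
    (hjV : j * V = V * j) (hjk : j * k = k * j) (hjk' : j * k' = k' * j) (hjdk : j * dk = dk * j)
    (hj'V : j' * V = V * j') (hj'k : j' * k = k * j')
    (hdjV : dj * V = V * dj) (hdjk : dj * k = k * dj) :
    (U * j' * j + U * (dj - (j' * j - j * j'))) * (V * k) +
        U * j * (V * k' * k + V * (dk - (k' * k - k * k'))) -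
        (V * (U * j * dk) + V * (U * j * dk)) =
      V * U * (dj * k - j * dk) + U * j * (V * k) * (j' + k') := by
  have l : ∀ {a b : R₀}, a * b = b * a → ∀ z, a * (b * z) = b * (a * z) := fun h z => by
    rw [← mul_assoc, h, mul_assoc]
  simp only [mul_assoc, mul_add, add_mul, mul_sub, sub_mul, hjk, hjk', hjdk, hj'k, hdjk, l hUV,
    l hUk, l hUk', l hUdk, l hjV, l hjk, l hjk', l hj'V, l hj'k, l hdjV]
  abel

/-- By the commutator rule, VU + t ∂U·∂V is the average of UV and VU. Its logarithmic derivative is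
computed by moving every factor from 𝔟 to its place at the price of one term in t; the Maurer–Cartan
equation turns the second derivatives of U and V into derivatives of the currents. -/
theorem FirstOrderCommuting.der_product (H : FirstOrderCommuting c Q t π 𝔞 𝔟)
    {U V Ui Vi : R} {j k : ι → R} (hU : U ∈ 𝔞) (hV : V ∈ 𝔟) (hj : ∀ μ, j μ ∈ 𝔞)
    (hk : ∀ μ, k μ ∈ 𝔟) (hUi : Ui * U = 1) (hVi : Vi * V = 1)
    (dU : ∀ μ, der (Q μ) U = U * j μ) (dV : ∀ μ, der (Q μ) V = V * k μ) (μ : ι) :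
    der (Q μ) (V * U + t • ∑ ν, c ν • (der (Q ν) U * der (Q ν) V)) =
      (V * U + t • ∑ ν, c ν • (der (Q ν) U * der (Q ν) V)) * productCurrent c Q t j k μ := by
  have flatj : ∀ ν, der (Q μ) (j ν) = der (Q ν) (j μ) - (j μ * j ν - j ν * j μ) := fun ν =>
    flat_of_der (H.commute_Q μ ν) hUi (dU μ) (dU ν)
  have flatk : ∀ ν, der (Q μ) (k ν) = der (Q ν) (k μ) - (k μ * k ν - k ν * k μ) := fun ν =>
    flat_of_der (H.commute_Q μ ν) hVi (dV μ) (dV ν)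
  -- The only exchange needed at order t⁰; all other exchanges occur behind a factor `t` and cost
  -- nothing.
  have hkU : k μ * U = U * k μ -
      t • ∑ ν, c ν • (U * j ν * der (Q ν) (k μ) + U * j ν * der (Q ν) (k μ)) := by
    rw [H.commutator U hU (k μ) (hk μ)]
    simp only [dU, smul_add, Finset.sum_add_distrib, mul_smul, two_smul]
    abel
  have C := fun A hA B hB => H.commute_red A hA B hB
  have key : t • ∑ ν, c ν • ((U * j μ * j ν + U * (der (Q ν) (j μ) - (j μ * j ν - j ν * j μ))) *
        (V * k ν) +
        U * j ν * (V * k μ * k ν + V * (der (Q ν) (k μ) - (k μ * k ν - k ν * k μ))) -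
        (V * (U * j ν * der (Q ν) (k μ)) + V * (U * j ν * der (Q ν) (k μ)))) =
      t • ∑ ν, c ν • (V * U * (der (Q ν) (j μ) * k ν - j ν * der (Q ν) (k μ)) +
        U * j ν * (V * k ν) * (j μ + k μ)) := by
    refine H.smul_sum_eq _ _ fun ν => ?_
    have dj := H.der_left ν _ (hj μ)
    have dk := H.der_right ν _ (hk μ)
    simp only [map_add, map_mul, map_sub]
    exact commuting_identity (C _ hU _ hV) (C _ hU _ (hk ν)) (C _ hU _ (hk μ)) (C _ hU _ dk)
      (C _ (hj ν) _ hV) (C _ (hj ν) _ (hk ν)) (C _ (hj ν) _ (hk μ)) (C _ (hj ν) _ dk)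
      (C _ (hj μ) _ hV) (C _ (hj μ) _ (hk ν))
      (C _ dj _ hV) (C _ dj _ (hk ν))
  have e1 : der (Q μ) (V * U + t • ∑ ν, c ν • (der (Q ν) U * der (Q ν) V)) =
      V * U * (j μ + k μ) + t • ∑ ν, c ν • ((U * j μ * j ν +
        U * (der (Q ν) (j μ) - (j μ * j ν - j ν * j μ))) * (V * k ν) +
        U * j ν * (V * k μ * k ν + V * (der (Q ν) (k μ) - (k μ * k ν - k ν * k μ))) -
        (V * (U * j ν * der (Q ν) (k μ)) + V * (U * j ν * der (Q ν) (k μ)))) := by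
    rw [der_add, der_mul, der_smul, der_sum]
    simp only [dU, dV, der_smul, der_mul, flatj, flatk]
    rw [mul_assoc V (k μ) U, hkU]
    simp only [smul_sub (c _), Finset.sum_sub_distrib, smul_sub t, mul_sub V, mul_smul_comm,
      Finset.mul_sum, mul_add, ← mul_assoc]
    abel
  have e2 : (V * U + t • ∑ ν, c ν • (der (Q ν) U * der (Q ν) V)) * productCurrent c Q t j k μ =
      V * U * (j μ + k μ) + t • ∑ ν, c ν • (V * U * (der (Q ν) (j μ) * k ν -
        j ν * der (Q ν) (k μ)) + U * j ν * (V * k ν) * (j μ + k μ)) := by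
    have z : (t • ∑ ν, c ν • (der (Q ν) U * der (Q ν) V)) *
        (t • ∑ ν, c ν • (der (Q ν) (j μ) * k ν - j ν * der (Q ν) (k μ))) = 0 := by
      rw [smul_mul_assoc, mul_smul_comm, H.smul_smul_eq_zero]
    rw [productCurrent, add_mul, mul_add (V * U), mul_add (t • _), z]
    simp only [dU, dV, smul_add (c _), Finset.sum_add_distrib, smul_add t, mul_smul_comm,
      smul_mul_assoc, Finset.mul_sum, Finset.sum_mul]
    abel
  rw [e1, e2, key]

/-- In the divergence of the t-term, two of the four products contain the divergence of `j` or of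
`k`. The other two, ∂_ν j_μ ∂_μ k_ν and ∂_μ j_ν ∂_ν k_μ, cancel after exchanging the summation
indices. -/
theorem FirstOrderCommuting.divergence_productCurrent (H : FirstOrderCommuting c Q t π 𝔞 𝔟)
    {j k : ι → R} (hj : ∑ μ, c μ • der (Q μ) (j μ) = 0) (hk : ∑ μ, c μ • der (Q μ) (k μ) = 0) :
    ∑ μ, c μ • der (Q μ) (productCurrent c Q t j k μ) = 0 := by
  have e : ∀ μ, der (Q μ) (productCurrent c Q t j k μ) = der (Q μ) (j μ) + der (Q μ) (k μ) +
      t • ∑ ν, c ν • (der (Q ν) (der (Q μ) (j μ)) * k ν + der (Q ν) (j μ) * der (Q μ) (k ν) -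
        der (Q μ) (j ν) * der (Q ν) (k μ) - j ν * der (Q ν) (der (Q μ) (k μ))) := by
    intro μ
    simp only [productCurrent, der_add, der_smul, der_sum, der_sub, der_mul]
    congr 2
    refine Finset.sum_congr rfl fun ν _ => ?_
    rw [der_der_comm (H.commute_Q μ ν), der_der_comm (H.commute_Q μ ν)]
    congr 1
    abel
  simp only [e, smul_add, Finset.sum_add_distrib, hj, hk, zero_add, smul_comm _ t,
    ← Finset.smul_sum]
  have h1 : ∑ μ, c μ • ∑ ν, c ν • (der (Q ν) (der (Q μ) (j μ)) * k ν) = 0 := by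
    simp only [Finset.smul_sum]
    rw [Finset.sum_comm]
    refine Finset.sum_eq_zero fun ν _ => ?_
    have : der (Q ν) (∑ μ, c μ • der (Q μ) (j μ)) = 0 := by rw [hj, der_zero]
    simp only [der_sum, der_smul] at this
    simp only [smul_comm _ (c ν), ← Finset.smul_sum, ← smul_mul_assoc, ← Finset.sum_mul, this]
    simp
  have h2 : ∑ μ, c μ • ∑ ν, c ν • (j ν * der (Q ν) (der (Q μ) (k μ))) = 0 := by
    simp only [Finset.smul_sum]
    rw [Finset.sum_comm]
    refine Finset.sum_eq_zero fun ν _ => ?_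
    have : der (Q ν) (∑ μ, c μ • der (Q μ) (k μ)) = 0 := by rw [hk, der_zero]
    simp only [der_sum, der_smul] at this
    simp only [smul_comm _ (c ν), ← Finset.smul_sum, ← mul_smul_comm, ← Finset.mul_sum, this]
    simp
  have h3 : ∑ μ, c μ • ∑ ν, c ν • (der (Q ν) (j μ) * der (Q μ) (k ν)) =
      ∑ μ, c μ • ∑ ν, c ν • (der (Q μ) (j ν) * der (Q ν) (k μ)) := by
    simp only [Finset.smul_sum]
    rw [Finset.sum_comm]
    exact Finset.sum_congr rfl fun ν _ => Finset.sum_congr rfl fun μ _ => smul_comm _ _ _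
  simp only [smul_sub, smul_add, Finset.sum_sub_distrib, Finset.sum_add_distrib, h1, h2, h3]
  simp

end Product

/-! ### The Cayley variable of the product -/

section Product

theorem inv_mul_comm {R : Type*} [Ring R] {A B z : R} (hBA : B * A = 1) (hAB : A * B = 1)
    (h : A * z = z * A) : B * z = z * B := by
  calc B * z = B * z * (A * B) := by rw [hAB, mul_one]
    _ = B * (z * A) * B := by noncomm_ring
    _ = B * A * (z * B) := by rw [← h]; noncomm_ring
    _ = z * B := by rw [hBA, one_mul]

variable {S R R₀ ι : Type*} [CommRing S] [Ring R] [Algebra S R] [Ring R₀] [Fintype ι]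
  {c : ι → S} {Q : ι → R} {t : S} {π : R →+* R₀} {𝔞 𝔟 : Subalgebra S R}

theorem commuting_resolvent {x y u v D σ : R₀} (hxy : x * y = y * x)
    (hu : u * (1 - x) = 1) (hu' : (1 - x) * u = 1) (hv : v * (1 - y) = 1) (hv' : (1 - y) * v = 1)
    (hD : D * (1 + y * x) = 1) (hD' : (1 + y * x) * D = 1) :
    u * v * σ * (v * u) * ((1 - x) * D * (1 - y)) = v * (1 + y * x) * u * (D * σ * D) := by
  have hDy : D * (1 - y) = (1 - y) * D := by
    refine inv_mul_comm hD hD' ?_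
    simp only [mul_sub, sub_mul, add_mul, mul_add, mul_assoc, hxy]; noncomm_ring
  have hDx : D * (1 - x) = (1 - x) * D := by
    refine inv_mul_comm hD hD' ?_
    have e : x * (y * x) = y * x * x := by rw [← mul_assoc, hxy]
    simp only [mul_sub, sub_mul, add_mul, mul_add, mul_one, one_mul, e]
    abel
  have huD : u * D = D * u := inv_mul_comm hu hu' hDx.symm
  have huv : u * v = v * u := by
    refine inv_mul_comm hu hu' (inv_mul_comm hv hv' ?_).symm
    simp only [mul_sub, sub_mul, mul_one, one_mul, hxy]; abel
  calc u * v * σ * (v * u) * ((1 - x) * D * (1 - y))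
      = u * v * σ * v * (u * (1 - x)) * (D * (1 - y)) := by noncomm_ring
    _ = u * v * σ * (v * (1 - y)) * D := by rw [hu, hDy]; noncomm_ring
    _ = v * u * σ * D := by rw [hv, huv]; noncomm_ring
    _ = v * ((1 + y * x) * D) * u * σ * D := by rw [hD']; noncomm_ring
    _ = v * (1 + y * x) * (D * u) * σ * D := by noncomm_ring
    _ = v * (1 + y * x) * u * (D * σ * D) := by rw [← huD]; noncomm_ring

/-- For commuting x and y one has 1 - (x + y)/(1 + yx) = (1 - x)(1 - y)/(1 + yx), whose inverse is v
(1 + yx) u. At first order the commutator of `u` and `v` must be added. -/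
theorem FirstOrderCommuting.resolvent_mul (H : FirstOrderCommuting c Q t π 𝔞 𝔟)
    {x y u v D : R} (hx : x ∈ 𝔞) (hy : y ∈ 𝔟)
    (hu : u * (1 - x) = 1) (hu' : (1 - x) * u = 1) (hv : v * (1 - y) = 1) (hv' : (1 - y) * v = 1)
    (hD : D * (1 + y * x) = 1) (hD' : (1 + y * x) * D = 1) :
    (v * (1 + y * x) * u + (u * v - v * u)) * (1 - (x * D + D * y)) = 1 := by
  obtain ⟨σ, hσ⟩ : ∃ σ : R, x * y = y * x + t • σ := by
    refine ⟨(2 : S) • ∑ μ, c μ • (der (Q μ) x * der (Q μ) y), ?_⟩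
    rw [smul_smul, mul_comm t 2]; exact H.commutator x hx y hy
  have tt : ∀ A : R, t • σ * A * t • σ = 0 := fun A => by
    rw [smul_mul_assoc, smul_mul_assoc, mul_smul_comm, H.smul_smul_eq_zero]
  have hDyx : D * (y * x) = 1 - D := by rw [← hD]; noncomm_ring
  have hxD : x * D = D * x - D * (t • σ) * (x * D) := by
    have e : (1 + y * x) * x = x * (1 + y * x) - t • σ * x := by
      have : t • σ = x * y - y * x := by rw [hσ]; abel
      rw [this]; noncomm_ring
    calc x * D = D * (1 + y * x) * x * D := by rw [hD, one_mul]
      _ = D * ((1 + y * x) * x) * D := by noncomm_ring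
      _ = D * x * ((1 + y * x) * D) - D * (t • σ) * (x * D) := by rw [e]; noncomm_ring
      _ = _ := by rw [hD', mul_one]
  have hxDy₁ : x * D * y = 1 - D + D * (t • σ) - D * (t • σ) * (x * D * y) := by
    calc x * D * y = D * (x * y) - D * (t • σ) * (x * D * y) := by
          nth_rewrite 1 [hxD]; noncomm_ring
      _ = _ := by rw [hσ, mul_add, hDyx]
  have hσxDy : t • σ * (x * D * y) = t • σ * (1 - D) := by
    rw [hxDy₁]
    have : t • σ * (1 - D + D * (t • σ) - D * (t • σ) * (x * D * y)) =
      t • σ * (1 - D) + t • σ * D * (t • σ) - t • σ * D * (t • σ) * (x * D * y) := by noncomm_ring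
    rw [this, tt]; simp
  have hxDy : x * D * y = 1 - D + D * (t • σ) * D := by
    rw [hxDy₁, mul_assoc D (t • σ) (x * D * y), hσxDy]; noncomm_ring
  -- The factorization of the commuting case, with a single correction of order t.
  have h1Z : 1 - (x * D + D * y) = (1 - x) * D * (1 - y) - D * (t • σ) * D := by
    have : (1 - x) * D * (1 - y) = D - x * D - D * y + x * D * y := by noncomm_ring
    rw [this, hxDy]; abel
  have huv : u * v - v * u = u * v * (t • σ) * (v * u) := by
    have : t • σ = (1 - x) * (1 - y) - (1 - y) * (1 - x) := by
      rw [eq_sub_of_add_eq' hσ.symm]; noncomm_ring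
    rw [this]
    symm
    calc u * v * ((1 - x) * (1 - y) - (1 - y) * (1 - x)) * (v * u)
        = u * v * (1 - x) * ((1 - y) * v) * u - u * (v * (1 - y)) * (1 - x) * (v * u) := by
          noncomm_ring
      _ = u * v * ((1 - x) * u) - u * (1 - x) * (v * u) := by rw [hv, hv']; noncomm_ring
      _ = u * v - v * u := by rw [hu, hu']; noncomm_ring
  -- Both sides carry a factor `t`, so they may be compared at t = 0, where x and y commute. There
  -- the two first-order corrections cancel.
  have main : u * v * (t • σ) * (v * u) * ((1 - x) * D * (1 - y)) =
      v * (1 + y * x) * u * (D * (t • σ) * D) := by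
    simp only [mul_smul_comm, smul_mul_assoc]
    refine H.smul_eq _ _ ?_
    have m := fun {a b : R} (h : a * b = 1) => (map_mul π a b).symm.trans ((congrArg π h).trans π.map_one)
    simp only [map_mul, map_sub, map_add, map_one] at m ⊢
    refine commuting_resolvent (H.commute_red x hx y hy) ?_ ?_ ?_ ?_ ?_ ?_
    · simpa using m hu
    · simpa using m hu'
    · simpa using m hv
    · simpa using m hv'
    · simpa using m hD
    · simpa using m hD'
  have z : u * v * (t • σ) * (v * u) * (D * (t • σ) * D) = 0 := by
    have : u * v * (t • σ) * (v * u) * (D * (t • σ) * D) =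
      u * v * (t • σ * (v * u * D) * (t • σ)) * D := by noncomm_ring
    rw [this, tt]; simp
  rw [h1Z, huv, add_mul, mul_sub _ ((1 - x) * D * (1 - y)), mul_sub _ ((1 - x) * D * (1 - y)), main, z]
  have : v * (1 + y * x) * u * ((1 - x) * D * (1 - y)) = 1 := by
    calc _ = v * (1 + y * x) * (u * (1 - x)) * D * (1 - y) := by noncomm_ring
      _ = v * ((1 + y * x) * D) * (1 - y) := by rw [hu]; noncomm_ring
      _ = 1 := by rw [hD', mul_one, hv]
  rw [this]; simp

/-- The solution generated by two solutions in first-order commuting subalgebras. -/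
theorem FirstOrderCommuting.fieldEq_product (H : FirstOrderCommuting c Q t π 𝔞 𝔟)
    (h2 : ∀ A : R, (2 : R) * A = 0 → A = 0) {x y u u' v v' D w w' : R}
    (hx : x ∈ 𝔞) (hua : u ∈ 𝔞) (hua' : u' ∈ 𝔞) (hy : y ∈ 𝔟) (hvb : v ∈ 𝔟) (hvb' : v' ∈ 𝔟)
    (hu : u * (1 - x) = 1 ∧ (1 - x) * u = 1) (hu' : u' * (1 + x) = 1 ∧ (1 + x) * u' = 1)
    (hv : v * (1 - y) = 1 ∧ (1 - y) * v = 1) (hv' : v' * (1 + y) = 1 ∧ (1 + y) * v' = 1)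
    (hD : D * (1 + y * x) = 1 ∧ (1 + y * x) * D = 1)
    (hw : w * (1 - (x * D + D * y)) = 1 ∧ (1 - (x * D + D * y)) * w = 1)
    (hw' : w' * (1 + (x * D + D * y)) = 1 ∧ (1 + (x * D + D * y)) * w' = 1)
    (ex : fieldEq c Q x u u' = 0) (ey : fieldEq c Q y v v' = 0) :
    fieldEq c Q (x * D + D * y) w w' = 0 := by
  set Z := x * D + D * y with hZ
  have two_mem : ∀ (𝔠 : Subalgebra S R), (2 : R) ∈ 𝔠 := fun 𝔠 => by
    rw [← one_add_one_eq_two]; exact add_mem (one_mem _) (one_mem _)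
  have inv_cayley : ∀ {a b b' : R}, b * (1 - a) = 1 → (1 - a) * b = 1 → b' * (1 + a) = 1 →
      (1 - a) * b' * ((1 + a) * b) = 1 := fun {a b b'} h1 h2 h3 => by
    have : (1 - a) * b' * ((1 + a) * b) = (1 - a) * (b' * (1 + a)) * b := by noncomm_ring
    rw [this, h3, mul_one, h2]
  have cayley_eq : ∀ {a b : R}, (1 - a) * b = 1 → (1 + a) * b = 2 * b - 1 := fun {a b} h => by
    calc (1 + a) * b = 2 * b - (1 - a) * b := by noncomm_ring
      _ = 2 * b - 1 := by rw [h]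
  have d := H.der_product (U := (1 + x) * u) (V := (1 + y) * v)
    (j := fun μ => 2 * (u' * der (Q μ) x * u)) (k := fun μ => 2 * (v' * der (Q μ) y * v))
    (mul_mem (add_mem (one_mem _) hx) hua) (mul_mem (add_mem (one_mem _) hy) hvb)
    (fun μ => mul_mem (two_mem _) (mul_mem (mul_mem hua' (H.der_left μ x hx)) hua))
    (fun μ => mul_mem (two_mem _) (mul_mem (mul_mem hvb' (H.der_right μ y hy)) hvb))
    (inv_cayley hu.1 hu.2 hu'.1) (inv_cayley hv.1 hv.2 hv'.1)
    (fun μ => der_cayley _ hu.1 hu.2 hu'.2) (fun μ => der_cayley _ hv.1 hv.2 hv'.2)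
  have two_smul' : ∀ A : R, 2 * A = (2 : S) • A := fun A => by
    rw [two_smul, two_mul]
  have div2 : ∀ f : ι → R, ∑ μ, c μ • der (Q μ) (2 * f μ) = 2 * ∑ μ, c μ • der (Q μ) (f μ) := by
    intro f
    simp only [two_smul', der_smul, Finset.smul_sum, smul_comm (c _) (2 : S)]
  have div := H.divergence_productCurrent
    (j := fun μ => 2 * (u' * der (Q μ) x * u)) (k := fun μ => 2 * (v' * der (Q μ) y * v))
    (by rw [div2, divergence_cayley c Q hu.1 hu.2 hu'.1 hu'.2, ex]; simp)
    (by rw [div2, divergence_cayley c Q hv.1 hv.2 hv'.1 hv'.2, ey]; simp)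
  have hwv : w = v * (1 + y * x) * u + (u * v - v * u) := by
    have := H.resolvent_mul hx hy hu.1 hu.2 hv.1 hv.2 hD.1 hD.2
    exact (left_inv_eq_right_inv this hw.2).symm
  -- Since (1 + a)(1 - a)⁻¹ = 2(1 - a)⁻¹ - 1, this is an identity in `u`, `v` and `w`. The term `u *
  -- v - v * u` of `w` supplies t ∂U·∂V.
  have hW : (1 + y) * v * ((1 + x) * u) +
      t • ∑ ν, c ν • (der (Q ν) ((1 + x) * u) * der (Q ν) ((1 + y) * v)) = (1 + Z) * w := by
    have hyv : v * y = v - 1 := by rw [← hv.1]; noncomm_ring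
    have hxu : x * u = u - 1 := by rw [← hu.2]; noncomm_ring
    have e2 : ∀ (q A : R), der q (2 * A - 1) = (2 : S) • der q A := fun q A => by
      rw [der_sub, der_one, sub_zero, two_smul', der_smul]
    rw [cayley_eq hw.2, hwv, cayley_eq hu.2, cayley_eq hv.2, H.commutator u hua v hvb]
    simp only [e2, smul_mul_assoc, mul_smul_comm, smul_comm (c _) (2 : S), ← Finset.smul_sum]
    have e3 : v * (1 + y * x) * u = v * u + v * y * (x * u) := by noncomm_ring
    have e4 : t • (2 : S) • (2 : S) • ∑ ν, c ν • (der (Q ν) u * der (Q ν) v) =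
        2 * ((2 * t) • ∑ ν, c ν • (der (Q ν) u * der (Q ν) v)) := by
      rw [two_smul']; simp only [smul_smul]; congr 1; ring
    rw [e3, hyv, hxu, e4]
    noncomm_ring
  -- The same group element has two expressions for its logarithmic derivative; its inverse is
  -- cancelled on the left.
  have hJ : ∀ μ, productCurrent c Q t (fun μ => 2 * (u' * der (Q μ) x * u))
      (fun μ => 2 * (v' * der (Q μ) y * v)) μ = 2 * (w' * der (Q μ) Z * w) := fun μ => by
    have h := d μ
    rw [hW, der_cayley _ hw.1 hw.2 hw'.2] at h
    have i := inv_cayley hw.1 hw.2 hw'.1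
    have h' := congrArg (fun A => (1 - Z) * w' * A) h
    simp only [← mul_assoc ((1 - Z) * w') ((1 + Z) * w)] at h'
    rw [i, one_mul, one_mul] at h'
    exact h'.symm
  simp only [hJ] at div
  rw [div2, divergence_cayley c Q hw.1 hw.2 hw'.1 hw'.2] at div
  have := h2 _ div
  -- The units around the field equation in `divergence_cayley` are removed.
  calc fieldEq c Q Z w w' = (1 + Z) * w' * fieldEq c Q Z w w' * (w * (1 - Z)) := by
        rw [hw'.2, hw.1, one_mul, mul_one]
    _ = (1 + Z) * (w' * fieldEq c Q Z w w' * w) * (1 - Z) := by noncomm_ring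
    _ = 0 := by rw [this]; simp

end Product

/-! ### Convolutions and sums over divisions of a word -/

section Words

variable {X S : Type*} [CommRing S]

/-- The convolution `∑ f(l₁) h(l₂)` over the splittings `l = l₁ l₂`. -/
def conv (f h : List X → S) : List X → S
  | [] => f [] * h []
  | x :: l => f [] * h (x :: l) + conv (fun w => f (x :: w)) h l

theorem conv_eq_sum (f h : List X → S) (l : List X) :
    conv f h l = ((List.range (l.length + 1)).map fun k => f (l.take k) * h (l.drop k)).sum := by
  induction l generalizing f with
  | nil => simp [conv]
  | cons x l ih =>
    rw [conv, ih, List.length_cons, List.range_succ_eq_map (n := l.length + 1)]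
    simp [Function.comp_def]

/-- The sum of `F` over all divisions of a word. -/
def divSum (F : List (List X) → S) (w : List X) : S := ((divisions w).map F).sum

theorem divSum_nil (F : List (List X) → S) : divSum F [] = F [] := by simp [divSum, divisions]

theorem divSum_cons (F : List (List X) → S) (x : X) (l : List X) :
    divSum F (x :: l) = ((List.range (l.length + 1)).map fun k =>
      divSum (fun d => F ((x :: l.take k) :: d)) (l.drop k)).sum := by
  simp [divSum, divisions, List.flatMap_def, List.sum_flatten, Function.comp_def]

theorem divSum_add (F G : List (List X) → S) (w : List X) :
    divSum (fun d => F d + G d) w = divSum F w + divSum G w := by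
  simp [divSum, List.sum_map_add]

theorem divSum_mul_left (r : S) (F : List (List X) → S) (w : List X) :
    divSum (fun d => r * F d) w = r * divSum F w := by
  simp [divSum, List.sum_map_mul_left]

theorem divSum_congr {F G : List (List X) → S} {w : List X}
    (h : ∀ d ∈ divisions w, F d = G d) : divSum F w = divSum G w := by
  rw [divSum, divSum, List.map_congr_left h]

theorem divSum_eq_zero {F : List (List X) → S} {w : List X}
    (h : ∀ d ∈ divisions w, F d = 0) : divSum F w = 0 := by
  rw [divSum_congr h]; simp [divSum]

/-- `f` of the first block times `G` of the remaining blocks. -/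
def peel (f : List X → S) (G : List (List X) → S) : List (List X) → S
  | [] => 0
  | b :: d => f b * G d

/-- Separating the first block turns a sum over divisions into a convolution. Blocks are nonempty,
so the splitting with empty first part must contribute nothing; hence `hf`. -/
theorem divSum_peel {f : List X → S} (hf : f [] = 0) (G : List (List X) → S) (w : List X) :
    divSum (peel f G) w = conv f (divSum G) w := by
  cases w with
  | nil => simp [divSum_nil, peel, conv, hf]
  | cons x l => simp [divSum_cons, conv, hf, peel, divSum_mul_left, conv_eq_sum]

/-- The unit of the convolution. -/
def unitWord (w : List X) : S := if w = [] then 1 else 0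

theorem divSum_unit (r : S) (w : List X) :
    divSum (fun d => if d = [] then r else 0) w = r * unitWord w := by
  cases w with
  | nil => simp [divSum_nil, unitWord]
  | cons x l => rw [divSum_cons]; simp [unitWord, divSum]

theorem divSum_length_one (F : List (List X) → S) {w : List X} (hw : w ≠ []) :
    divSum (fun d => if d.length = 1 then F d else 0) w = F [w] := by
  cases w with
  | nil => simp at hw
  | cons x l =>
    have h : ∀ k, divSum (fun d => if ((x :: l.take k) :: d).length = 1 then
        F ((x :: l.take k) :: d) else 0) (l.drop k) =
        F [x :: l.take k] * unitWord (l.drop k) := fun k => by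
      rw [← divSum_unit]
      refine divSum_congr fun d _ => ?_
      cases d <;> simp
    rw [divSum_cons]
    simp only [h, List.range_succ, List.map_append, List.sum_append]
    rw [List.map_congr_left (g := fun _ => (0 : S))]
    · simp [unitWord]
    · intro k hk
      have : l.drop k ≠ [] := by
        rw [Ne, List.drop_eq_nil_iff]; simpa using hk
      simp [unitWord, this]

end Words

/-! ### Words of legs acting on pairs of lists -/

section Shuffle

variable {V S : Type*} [CommRing S]

/-- The operator `∑ f(w) w`, the sum being over all words `w` of legs, where a letter removes the
first entry of the list it belongs to; removing `x` from the first list gives the weight `ω x b`,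
`b` being the second list. -/
def sh (ω : V → List V → S) (f : List (Leg V) → S) (m : List V → List V → S) :
    List V → List V → S
  | [], [] => f [] * m [] []
  | x :: a, [] => f [] * m (x :: a) [] + ω x [] * sh ω (fun w => f (Sum.inl x :: w)) m a []
  | [], y :: b => f [] * m [] (y :: b) + sh ω (fun w => f (Sum.inr y :: w)) m [] b
  | x :: a, y :: b => f [] * m (x :: a) (y :: b) +
      ω x (y :: b) * sh ω (fun w => f (Sum.inl x :: w)) m a (y :: b) +
      sh ω (fun w => f (Sum.inr y :: w)) m (x :: a) b
termination_by a b => a.length + b.length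

/-- Simultaneous induction on two lists by removing first entries. -/
theorem pair_induction {P : List V → List V → Prop} (h00 : P [] [])
    (h10 : ∀ x a, P a [] → P (x :: a) []) (h01 : ∀ y b, P [] b → P [] (y :: b))
    (h11 : ∀ x a y b, P a (y :: b) → P (x :: a) b → P (x :: a) (y :: b)) (a b : List V) :
    P a b := by
  induction a generalizing b with
  | nil => induction b with
    | nil => exact h00
    | cons y b ih => exact h01 y b ih
  | cons x a iha => induction b with
    | nil => exact h10 x a (iha [])
    | cons y b ih => exact h11 x a y b (iha _) ih

variable (ω : V → List V → S)

theorem sh_add_left (f g : List (Leg V) → S) (m : List V → List V → S) (a b : List V) :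
    sh ω (fun w => f w + g w) m a b = sh ω f m a b + sh ω g m a b := by
  induction a, b using pair_induction generalizing f g with
  | h00 => simp only [sh]; ring
  | h10 x a ih => simp only [sh, ih]; ring
  | h01 y b ih => simp only [sh, ih]; ring
  | h11 x a y b ih₁ ih₂ => simp only [sh, ih₁, ih₂]; ring

theorem sh_mul_left (r : S) (f : List (Leg V) → S) (m : List V → List V → S) (a b : List V) :
    sh ω (fun w => r * f w) m a b = r * sh ω f m a b := by
  induction a, b using pair_induction generalizing f with
  | h00 => simp only [sh]; ring
  | h10 x a ih => simp only [sh, ih]; ring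
  | h01 y b ih => simp only [sh, ih]; ring
  | h11 x a y b ih₁ ih₂ => simp only [sh, ih₁, ih₂]; ring

theorem sh_zero_left (m : List V → List V → S) (a b : List V) :
    sh ω (fun _ => 0) m a b = 0 := by
  simpa using sh_mul_left ω 0 (fun _ => 0) m a b

/-- Letters act one after another, so concatenation of words becomes composition of operators,
whatever the weights are. This makes `sh` a representation of the algebra of series in words. -/
theorem sh_conv (f h : List (Leg V) → S) (m : List V → List V → S) (a b : List V) :
    sh ω (conv f h) m a b = sh ω f (sh ω h m) a b := by
  induction a, b using pair_induction generalizing f with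
  | h00 => simp only [sh, conv]; ring
  | h10 x a ih => simp only [sh, conv, sh_add_left, sh_mul_left, ih]; ring
  | h01 y b ih => simp only [sh, conv, sh_add_left, sh_mul_left, ih]; ring
  | h11 x a y b ih₁ ih₂ => simp only [sh, conv, sh_add_left, sh_mul_left, ih₁, ih₂]; ring

theorem sh_unit (m : List V → List V → S) (a b : List V) : sh ω unitWord m a b = m a b := by
  have h : ∀ x : Leg V, (fun w : List (Leg V) => (unitWord (x :: w) : S)) = fun _ => 0 := by
    intro x; funext w; simp [unitWord]
  cases a <;> cases b <;> simp only [sh, h, sh_zero_left] <;> simp [unitWord]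

/-- Leibniz rule: the momentum of a word is the momentum present before it acts minus the momentum
left afterwards. -/
theorem sh_mom [AddCommGroup V] (ξ : V →+ S) (f : List (Leg V) → S) (m : List V → List V → S)
    (a b : List V) :
    sh ω (fun w => ξ (w.map mom).sum * f w) m a b = ξ (a.sum + b.sum) * sh ω f m a b -
      sh ω f (fun a b => ξ (a.sum + b.sum) * m a b) a b := by
  induction a, b using pair_induction generalizing f with
  | h00 => simp [sh]
  | h10 x a ih =>
    simp only [sh, List.map_cons, List.sum_cons, map_add, add_mul, sh_add_left, sh_mul_left, ih]
    simp [mom]; ring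
  | h01 y b ih =>
    simp only [sh, List.map_cons, List.sum_cons, map_add, add_mul, sh_add_left, sh_mul_left, ih]
    simp [mom]; ring
  | h11 x a y b ih₁ ih₂ =>
    simp only [sh, List.map_cons, List.sum_cons, map_add, add_mul, sh_add_left, sh_mul_left, ih₁,
      ih₂]
    simp [mom]; ring

theorem orderedPerms_nil_nil : orderedPerms ([] : List V) [] = [[]] := by
  simp [orderedPerms, shuffles]

theorem orderedPerms_cons_nil (x : V) (a : List V) :
    orderedPerms (x :: a) [] = (orderedPerms a []).map (Sum.inl x :: ·) := by
  cases a <;> simp [orderedPerms, shuffles]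

theorem orderedPerms_nil_cons (y : V) (b : List V) :
    orderedPerms [] (y :: b) = (orderedPerms [] b).map (Sum.inr y :: ·) := by
  cases b <;> simp [orderedPerms, shuffles]

theorem orderedPerms_cons_cons (x y : V) (a b : List V) :
    orderedPerms (x :: a) (y :: b) = (orderedPerms a (y :: b)).map (Sum.inl x :: ·) ++
      (orderedPerms (x :: a) b).map (Sum.inr y :: ·) := by
  simp [orderedPerms, shuffles]

/-- `w` is an initial segment of an ordered permutation of `a` and `b`. -/
def Occurs (a b : List V) (w : List (Leg V)) : Prop := ∃ σ ∈ orderedPerms a b, w <+: σ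

theorem occurs_nil (a b : List V) : Occurs a b [] := by
  have : orderedPerms a b ≠ [] := by
    induction a, b using pair_induction with
    | h00 => simp [orderedPerms_nil_nil]
    | h10 x a ih => simpa [orderedPerms_cons_nil] using ih
    | h01 y b ih => simpa [orderedPerms_nil_cons] using ih
    | h11 x a y b ih₁ ih₂ => simp [orderedPerms_cons_cons, ih₁]
  obtain ⟨σ, hσ⟩ := List.exists_mem_of_ne_nil _ this
  exact ⟨σ, hσ, List.nil_prefix⟩

theorem mem_orderedPerms_inl {x : V} {a b : List V} {σ : List (Leg V)}
    (h : σ ∈ orderedPerms a b) : Sum.inl x :: σ ∈ orderedPerms (x :: a) b := by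
  cases b with
  | nil => rw [orderedPerms_cons_nil]; exact List.mem_map_of_mem h
  | cons y b =>
    rw [orderedPerms_cons_cons]; exact List.mem_append_left _ (List.mem_map_of_mem h)

theorem mem_orderedPerms_inr {y : V} {a b : List V} {σ : List (Leg V)}
    (h : σ ∈ orderedPerms a b) : Sum.inr y :: σ ∈ orderedPerms a (y :: b) := by
  cases a with
  | nil => rw [orderedPerms_nil_cons]; exact List.mem_map_of_mem h
  | cons x a =>
    rw [orderedPerms_cons_cons]; exact List.mem_append_right _ (List.mem_map_of_mem h)

theorem Occurs.inl {x : V} {a b : List V} {w : List (Leg V)} (h : Occurs a b w) :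
    Occurs (x :: a) b (Sum.inl x :: w) := by
  obtain ⟨σ, hσ, hw⟩ := h
  exact ⟨_, mem_orderedPerms_inl hσ, List.cons_prefix_cons.2 ⟨rfl, hw⟩⟩

theorem Occurs.inr {y : V} {a b : List V} {w : List (Leg V)} (h : Occurs a b w) :
    Occurs a (y :: b) (Sum.inr y :: w) := by
  obtain ⟨σ, hσ, hw⟩ := h
  exact ⟨_, mem_orderedPerms_inr hσ, List.cons_prefix_cons.2 ⟨rfl, hw⟩⟩

theorem sh_congr_left {f g : List (Leg V) → S} (m : List V → List V → S) {a b : List V}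
    (h : ∀ w, Occurs a b w → f w = g w) : sh ω f m a b = sh ω g m a b := by
  induction a, b using pair_induction generalizing f g with
  | h00 => simp only [sh, h [] (occurs_nil _ _)]
  | h10 x a ih => simp only [sh, h [] (occurs_nil _ _), ih fun w hw => h _ hw.inl]
  | h01 y b ih => simp only [sh, h [] (occurs_nil _ _), ih fun w hw => h _ hw.inr]
  | h11 x a y b ih₁ ih₂ =>
    simp only [sh, h [] (occurs_nil _ _), ih₁ fun w hw => h _ hw.inl, ih₂ fun w hw => h _ hw.inr]

/-- The indicator function of the pairs of lists of lengths `i` and `j`. -/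
def lengthDelta (i j : ℕ) (a b : List V) : S := if a.length = i ∧ b.length = j then 1 else 0

/-- Each letter removes one leg, so only words of the right length connect two given levels. -/
theorem sh_lengthDelta (f : List (Leg V) → S) (i j : ℕ) (a b : List V) :
    sh ω f (lengthDelta i j) a b =
      sh ω (fun w => if w.length + (i + j) = a.length + b.length then f w else 0)
        (lengthDelta i j) a b := by
  have e : ∀ (f : List (Leg V) → S) (a b : List V), f [] * lengthDelta i j a b =
      (if ([] : List (Leg V)).length + (i + j) = a.length + b.length then f [] else 0) *
        lengthDelta i j a b := by
    intro f a b
    unfold lengthDelta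
    by_cases h : a.length = i ∧ b.length = j
    · simp [h]
    · simp [h]
  have s : ∀ p q : ℕ, (p + 1 + (i + j) = q + 1) = (p + (i + j) = q) := fun p q => by
    rw [eq_iff_iff]; omega
  induction a, b using pair_induction generalizing f with
  | h00 => rw [sh, sh, e f]
  | h10 x a ih =>
    rw [sh, sh, e f, ih]
    simp only [List.length_cons, List.length_nil, add_zero, s]
  | h01 y b ih =>
    rw [sh, sh, e f, ih]
    simp only [List.length_cons, List.length_nil, zero_add, s]
  | h11 x a y b ih₁ ih₂ =>
    rw [sh, sh, e f, ih₁, ih₂]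
    have s₁ : ∀ p : ℕ, (p + 1 + (i + j) = a.length + 1 + (b.length + 1)) =
        (p + (i + j) = a.length + b.length + 1) := fun p => by rw [eq_iff_iff]; omega
    have s₂ : ∀ p : ℕ, (p + (i + j) = a.length + (b.length + 1)) =
        (p + (i + j) = a.length + b.length + 1) := fun p => by rw [eq_iff_iff]; omega
    have s₃ : ∀ p : ℕ, (p + (i + j) = a.length + 1 + b.length) =
        (p + (i + j) = a.length + b.length + 1) := fun p => by rw [eq_iff_iff]; omega
    simp only [List.length_cons, s₁, s₂, s₃]

theorem sh_lengthDelta_eq_zero (f : List (Leg V) → S) {i j : ℕ} {a b : List V}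
    (h : a.length < i ∨ b.length < j) : sh ω f (lengthDelta i j) a b = 0 := by
  have e : ∀ a b : List V, a.length < i ∨ b.length < j → (lengthDelta i j a b : S) = 0 :=
    fun a b h => if_neg (by omega)
  induction a, b using pair_induction generalizing f with
  | h00 => rw [sh, e _ _ h, mul_zero]
  | h10 x a ih =>
    rw [sh, e _ _ h, ih _ (by simp only [List.length_cons] at h; omega)]; ring
  | h01 y b ih =>
    rw [sh, e _ _ h, ih _ (by simp only [List.length_cons] at h; omega)]; ring
  | h11 x a y b ih₁ ih₂ =>
    simp only [List.length_cons] at h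
    rw [sh, e _ _ (by simpa using h), ih₁ _ (by simp; omega), ih₂ _ (by simp; omega)]; ring

/-- The `β`-legs of a word. -/
def betaMomenta (w : List (Leg V)) : List V := w.filterMap Sum.getRight?

theorem betaMomenta_of_mem {a b : List V} {σ : List (Leg V)} (h : σ ∈ orderedPerms a b) :
    betaMomenta σ = b := by
  induction a, b using pair_induction generalizing σ with
  | h00 => simp [orderedPerms_nil_nil] at h; simp [h, betaMomenta]
  | h10 x a ih =>
    rw [orderedPerms_cons_nil, List.mem_map] at h
    obtain ⟨σ, h, rfl⟩ := h
    simpa [betaMomenta] using ih h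
  | h01 y b ih =>
    rw [orderedPerms_nil_cons, List.mem_map] at h
    obtain ⟨σ, h, rfl⟩ := h
    simpa [betaMomenta] using ih h
  | h11 x a y b ih₁ ih₂ =>
    rw [orderedPerms_cons_cons, List.mem_append, List.mem_map, List.mem_map] at h
    obtain ⟨σ, h, rfl⟩ | ⟨σ, h, rfl⟩ := h
    · have := ih₁ h
      exact this
    · simpa [betaMomenta] using ih₂ h

theorem alphaMomenta_of_mem {a b : List V} {σ : List (Leg V)} (h : σ ∈ orderedPerms a b) :
    alphaMomenta σ = a := by
  induction a, b using pair_induction generalizing σ with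
  | h00 => simp [orderedPerms_nil_nil] at h; simp [h, alphaMomenta]
  | h10 x a ih =>
    rw [orderedPerms_cons_nil, List.mem_map] at h
    obtain ⟨σ, h, rfl⟩ := h
    simpa [alphaMomenta] using ih h
  | h01 y b ih =>
    rw [orderedPerms_nil_cons, List.mem_map] at h
    obtain ⟨σ, h, rfl⟩ := h
    simpa [alphaMomenta] using ih h
  | h11 x a y b ih₁ ih₂ =>
    rw [orderedPerms_cons_cons, List.mem_append, List.mem_map, List.mem_map] at h
    obtain ⟨σ, h, rfl⟩ | ⟨σ, h, rfl⟩ := h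
    · simpa [alphaMomenta] using ih₁ h
    · have := ih₂ h
      exact this

/-- The weight of a word: the product of the weights of its letters. -/
def wordWeight : List (Leg V) → S
  | [] => 1
  | Sum.inl x :: w => ω x (betaMomenta w) * wordWeight w
  | Sum.inr _ :: w => wordWeight w

/-- The words that exhaust both lists are the ordered permutations. -/
theorem sh_lengthDelta_zero (f : List (Leg V) → S) (a b : List V) :
    sh ω f (lengthDelta 0 0) a b =
      ((orderedPerms a b).map fun σ => wordWeight ω σ * f σ).sum := by
  have hl : ∀ (x : V) (a b : List V) (f : List (Leg V) → S),
      ((orderedPerms a b).map fun σ => wordWeight ω (Sum.inl x :: σ) * f (Sum.inl x :: σ)).sum =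
      ω x b * ((orderedPerms a b).map fun σ => wordWeight ω σ * f (Sum.inl x :: σ)).sum := by
    intro x a b f
    rw [← List.sum_map_mul_left]
    congr 1
    refine List.map_congr_left fun σ hσ => ?_
    rw [wordWeight, betaMomenta_of_mem hσ, mul_assoc]
  induction a, b using pair_induction generalizing f with
  | h00 => simp [sh, orderedPerms_nil_nil, wordWeight, lengthDelta]
  | h10 x a ih =>
    rw [sh, ih, orderedPerms_cons_nil, List.map_map, Function.comp_def, hl]
    simp [lengthDelta]
  | h01 y b ih =>
    rw [sh, ih, orderedPerms_nil_cons, List.map_map, Function.comp_def]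
    simp [lengthDelta, wordWeight]
  | h11 x a y b ih₁ ih₂ =>
    rw [sh, ih₁, ih₂, orderedPerms_cons_cons, List.map_append, List.sum_append, List.map_map,
      List.map_map, Function.comp_def, Function.comp_def, hl]
    simp [lengthDelta, wordWeight]

/-- A function of words of momenta, as a function of the words of `α`-legs. -/
def onAlpha (g : List V → S) : List (Leg V) → S
  | [] => g []
  | Sum.inl x :: w => onAlpha (fun l => g (x :: l)) w
  | Sum.inr _ :: _ => 0

/-- A function of words of momenta, as a function of the words of `β`-legs. -/
def onBeta (g : List V → S) : List (Leg V) → S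
  | [] => g []
  | Sum.inl _ :: _ => 0
  | Sum.inr y :: w => onBeta (fun l => g (y :: l)) w

/-- No β-leg is removed by such a word, so all its letters are weighted with the same list `b`. -/
theorem sh_onAlpha (g : List V → S) (m : List V → List V → S) (a b : List V) :
    sh ω (onAlpha g) m a b =
      conv (fun l => g l * (l.map fun x => ω x b).prod) (fun a' => m a' b) a := by
  have e : ∀ (r : S) (g h : List V → S) (a : List V),
      conv (fun l => r * g l) h a = r * conv g h a := fun r g h a => by
    simp only [conv_eq_sum, mul_assoc, List.sum_map_mul_left]
  induction a, b using pair_induction generalizing g with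
  | h00 => simp [sh, conv, onAlpha]
  | h10 x a ih =>
    simp only [sh, onAlpha, conv, List.map_nil, List.prod_nil, List.map_cons, List.prod_cons]
    rw [ih, ← e, mul_one]
    congr 3; funext l; ring
  | h01 y b ih => simp [sh, onAlpha, conv, sh_zero_left]
  | h11 x a y b ih₁ ih₂ =>
    simp only [sh, onAlpha, conv, sh_zero_left, List.map_nil, List.prod_nil, List.map_cons,
      List.prod_cons]
    rw [ih₁, ← e, mul_one, add_zero]
    congr 3; funext l; ring

theorem sh_onBeta (g : List V → S) (m : List V → List V → S) (a b : List V) :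
    sh ω (onBeta g) m a b = conv g (fun b' => m a b') b := by
  induction a, b using pair_induction generalizing g with
  | h00 => simp [sh, conv, onBeta]
  | h10 x a ih => simp [sh, onBeta, conv, sh_zero_left]
  | h01 y b ih => simp only [sh, onBeta, conv, ih]
  | h11 x a y b ih₁ ih₂ => simp only [sh, onBeta, conv, sh_zero_left, ih₂]; ring

end Shuffle

/-! ### The operators as finite matrices -/

section Matrices

variable {V S : Type*} [CommRing S]

/-- The pairs of suffixes of two lists, given by their lengths. -/
abbrev Pos (α β : List V) := Fin (α.length + 1) × Fin (β.length + 1)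

/-- The suffix of length `n`. -/
def sfx (l : List V) (n : ℕ) : List V := l.drop (l.length - n)

theorem sfx_suffix (l : List V) (n : ℕ) : sfx l n <:+ l := List.drop_suffix _ _

theorem length_sfx (l : List V) (n : Fin (l.length + 1)) : (sfx l n).length = n := by
  have := n.2
  simp only [sfx, List.length_drop]; omega

theorem sfx_length_of_suffix {a l : List V} (h : a <:+ l) : sfx l a.length = a := by
  rw [sfx]; exact (List.suffix_iff_eq_drop.1 h).symm

theorem sfx_length (l : List V) : sfx l l.length = l := sfx_length_of_suffix (List.suffix_refl _)

theorem sfx_zero (l : List V) : sfx l 0 = [] := by simp [sfx]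

theorem lengthDelta_expand {α β a b : List V} (ha : a <:+ α) (hb : b <:+ β)
    (m : List V → List V → S) :
    ∑ q : Pos α β, lengthDelta q.1 q.2 a b * m (sfx α q.1) (sfx β q.2) = m a b := by
  rw [Finset.sum_eq_single
    (⟨⟨a.length, Nat.lt_succ_of_le ha.length_le⟩, ⟨b.length, Nat.lt_succ_of_le hb.length_le⟩⟩ :
      Pos α β)]
  · simp [lengthDelta, sfx_length_of_suffix ha, sfx_length_of_suffix hb]
  · rintro ⟨q₁, q₂⟩ _ hq
    have : ¬ (a.length = q₁ ∧ b.length = q₂) := fun h => hq (by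
      ext <;> simp [h.1, h.2])
    simp [lengthDelta, this]
  · simp

variable (ω : V → List V → S)

/-- Only suffixes of α and β are reached, and a suffix is determined by its length. By linearity in
`m` the operator is therefore given by its values on the indicator functions, which become its
matrix entries. -/
theorem sh_expand {α β a b : List V} (ha : a <:+ α) (hb : b <:+ β) (f : List (Leg V) → S)
    (m : List V → List V → S) :
    sh ω f m a b =
      ∑ q : Pos α β, sh ω f (lengthDelta q.1 q.2) a b * m (sfx α q.1) (sfx β q.2) := by
  have t : ∀ {x : V} {l l' : List V}, x :: l <:+ l' → l <:+ l' := fun {x l l'} h =>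
    (List.suffix_cons x l).trans h
  induction a, b using pair_induction generalizing f with
  | h00 =>
    simp only [sh, mul_assoc, ← Finset.mul_sum, lengthDelta_expand ha hb]
  | h10 x a ih =>
    simp only [sh, mul_assoc, add_mul, Finset.sum_add_distrib, ← Finset.mul_sum,
      lengthDelta_expand ha hb, ← ih (t ha) hb]
  | h01 y b ih =>
    simp only [sh, mul_assoc, add_mul, Finset.sum_add_distrib, ← Finset.mul_sum,
      lengthDelta_expand ha hb, ← ih ha (t hb)]
  | h11 x a y b ih₁ ih₂ =>
    simp only [sh, mul_assoc, add_mul, Finset.sum_add_distrib, ← Finset.mul_sum,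
      lengthDelta_expand ha hb, ← ih₁ (t ha) hb, ← ih₂ ha (t hb)]

variable (α β : List V)

/-- The operator `sh` as a matrix. -/
def shMat : (List (Leg V) → S) →ₗ[S] Matrix (Pos α β) (Pos α β) S where
  toFun f := fun p q => sh ω f (lengthDelta q.1 q.2) (sfx α p.1) (sfx β p.2)
  map_add' f g := by
    funext p q; exact sh_add_left ω f g _ _ _
  map_smul' r f := by
    funext p q; exact sh_mul_left ω r f _ _ _

theorem shMat_apply (f : List (Leg V) → S) (p q : Pos α β) :
    shMat ω α β f p q = sh ω f (lengthDelta q.1 q.2) (sfx α p.1) (sfx β p.2) := rfl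

theorem shMat_mulVec (f : List (Leg V) → S) (m : List V → List V → S) (p : Pos α β) :
    (shMat ω α β f).mulVec (fun q => m (sfx α q.1) (sfx β q.2)) p =
      sh ω f m (sfx α p.1) (sfx β p.2) := by
  rw [sh_expand ω (sfx_suffix α _) (sfx_suffix β _)]
  rfl

theorem shMat_conv (f h : List (Leg V) → S) :
    shMat ω α β (conv f h) = shMat ω α β f * shMat ω α β h := by
  ext p q
  rw [shMat_apply, sh_conv, sh_expand ω (sfx_suffix α _) (sfx_suffix β _), Matrix.mul_apply]
  rfl

theorem lengthDelta_sfx (p q : Pos α β) :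
    (lengthDelta q.1 q.2 (sfx α p.1) (sfx β p.2) : S) = if p = q then 1 else 0 := by
  simp [lengthDelta, length_sfx, Prod.ext_iff, Fin.ext_iff]

theorem shMat_unit : shMat ω α β unitWord = 1 := by
  ext p q
  rw [shMat_apply, sh_unit, lengthDelta_sfx, Matrix.one_apply]

/-- The operator of a component of the remaining momentum. -/
def momMat [AddCommGroup V] (ξ : V →+ S) : Matrix (Pos α β) (Pos α β) S :=
  Matrix.diagonal fun p => ξ ((sfx α p.1).sum + (sfx β p.2).sum)

theorem der_momMat_apply [AddCommGroup V] (ξ : V →+ S) (T : Matrix (Pos α β) (Pos α β) S)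
    (p q : Pos α β) : der (momMat α β ξ) T p q =
      (ξ ((sfx α p.1).sum + (sfx β p.2).sum) - ξ ((sfx α q.1).sum + (sfx β q.2).sum)) * T p q := by
  simp only [der, momMat, Matrix.sub_apply, Matrix.diagonal_mul, Matrix.mul_diagonal]
  ring

/-- The commutator with the remaining momentum multiplies each word by its own momentum, so it plays
the role of a partial derivative. -/
theorem der_shMat [AddCommGroup V] (ξ : V →+ S) (f : List (Leg V) → S) :
    der (momMat α β ξ) (shMat ω α β f) = shMat ω α β fun w => ξ (w.map mom).sum * f w := by
  ext p q
  rw [der_momMat_apply, shMat_apply, shMat_apply, sh_mom, sub_mul,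
    sh_expand ω (sfx_suffix α _) (sfx_suffix β _) f
      fun a b => ξ (a.sum + b.sum) * lengthDelta q.1 q.2 a b]
  congr 1
  rw [Finset.sum_eq_single q]
  · rw [lengthDelta_sfx]; simp; ring
  · intro r _ hr
    rw [lengthDelta_sfx, if_neg hr]; simp
  · simp

theorem commute_momMat [AddCommGroup V] (ξ ξ' : V →+ S) :
    Commute (momMat α β ξ) (momMat α β ξ') := by
  simp [Commute, SemiconjBy, momMat, Matrix.diagonal_mul_diagonal, mul_comm]

theorem shMat_peel {f : List (Leg V) → S} (hf : f [] = 0) (G : List (List (Leg V)) → S) :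
    shMat ω α β (divSum (peel f G)) = shMat ω α β f * shMat ω α β (divSum G) := by
  rw [← shMat_conv]
  congr 1
  funext w
  exact divSum_peel hf G w

end Matrices

/-! ### The field equation as a sum over vertices -/

section FieldEquation

variable {V S ι : Type*} [CommRing S] [AddCommGroup V] [Fintype ι]

theorem oddEntries_cons {X : Type*} (x : X) (l : List X) :
    oddEntries (x :: l) = x :: oddEntries l.tail := by
  cases l <;> simp [oddEntries]

/-- The total momentum of the blocks at the positions `1, 3, …`. -/
def oddMom (d : List (List (Leg V))) : V := (oddEntries (d.map fun b => (b.map mom).sum)).sum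

theorem oddMom_cons (b : List (Leg V)) (d : List (List (Leg V))) :
    oddMom (b :: d) = (b.map mom).sum + oddMom d.tail := by
  simp [oddMom, oddEntries_cons]

variable (c : ι → S) (ξ : ι → V →+ S)

/-- The square of a momentum, in components. -/
def sqComp (v : V) : S := ∑ μ, c μ * (ξ μ v * ξ μ v)

/-- The sum over the divisions of a word into an odd number of blocks, of the product of `f` over
the blocks times the square of the momentum of the blocks at odd positions. -/
def vertexSum (f : List (Leg V) → S) : List (Leg V) → S :=
  divSum fun d => if Odd d.length then sqComp c ξ (oddMom d) * (d.map f).prod else 0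

theorem divSum_sum {X κ : Type*} (s : Finset κ) (F : κ → List (List X) → S) (w : List X) :
    divSum (fun d => ∑ i ∈ s, F i d) w = ∑ i ∈ s, divSum (F i) w := by
  classical
  induction s using Finset.induction_on with
  | empty => simp [divSum]
  | insert i s hi ih => simp [Finset.sum_insert hi, divSum_add, ih]

variable (ω : V → List V → S) (α β : List V)

/-- Sums over divisions, refined by the parity of the number of blocks and by powers of the momentum
at alternate positions, satisfy linear recursions obtained by removing the first block. Solving them
expresses the vertex sum through X, ∂X, □X and (1 - X²)⁻¹, and this solution is the field equation
between two factors 1 - X². -/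
theorem fieldEq_shMat {f : List (Leg V) → S} (hf : f [] = 0)
    {u v : Matrix (Pos α β) (Pos α β) S}
    (hu : u * (1 - shMat ω α β f) = 1) (hu' : (1 - shMat ω α β f) * u = 1)
    (hv : v * (1 + shMat ω α β f) = 1) (hv' : (1 + shMat ω α β f) * v = 1) :
    fieldEq c (fun μ => momMat α β (ξ μ)) (shMat ω α β f) u v =
      (1 - shMat ω α β f * shMat ω α β f) * shMat ω α β (vertexSum c ξ f) *
        (1 - shMat ω α β f * shMat ω α β f) := by
  set X := shMat ω α β f with hX
  -- The letters e and o stand for an even and an odd number of blocks, the index for the degree in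
  -- the momentum. For an even number it is the momentum at the even positions, which become the odd
  -- positions once the first block is removed.
  let e₀ : List (List (Leg V)) → S := fun d => if Odd d.length then 0 else (d.map f).prod
  let o₀ : List (List (Leg V)) → S := fun d => if Odd d.length then (d.map f).prod else 0
  let o₁ : ι → List (List (Leg V)) → S := fun μ d =>
    if Odd d.length then ξ μ (oddMom d) * (d.map f).prod else 0
  let e₁ : ι → List (List (Leg V)) → S := fun μ d =>
    if Odd d.length then 0 else ξ μ (oddMom d.tail) * (d.map f).prod
  let e₂ : List (List (Leg V)) → S := fun d =>
    if Odd d.length then 0 else sqComp c ξ (oddMom d.tail) * (d.map f).prod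
  let o₂ : List (List (Leg V)) → S := fun d =>
    if Odd d.length then sqComp c ξ (oddMom d) * (d.map f).prod else 0
  let M : (List (List (Leg V)) → S) → Matrix (Pos α β) (Pos α β) S := fun F =>
    shMat ω α β (divSum F)
  have Madd : ∀ F G : List (List (Leg V)) → S, M (fun d => F d + G d) = M F + M G := fun F G => by
    simp only [M, ← map_add]
    congr 1; funext w; exact divSum_add F G w
  have Mmul : ∀ (r : S) (F : List (List (Leg V)) → S), M (fun d => r * F d) = r • M F :=
    fun r F => by
      simp only [M, ← map_smul]
      congr 1; funext w; exact divSum_mul_left r F w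
  have Msum : ∀ F : ι → List (List (Leg V)) → S, M (fun d => ∑ μ, F μ d) = ∑ μ, M (F μ) :=
    fun F => by
      simp only [M, ← map_sum]
      congr 1; funext w; rw [divSum_sum, Finset.sum_apply]
  have Munit : M (fun d => if d = [] then 1 else 0) = 1 := by
    rw [← shMat_unit ω α β]
    simp only [M]
    congr 1; funext w; rw [divSum_unit, one_mul]
  have Mpeel : ∀ {g : List (Leg V) → S}, g [] = 0 → ∀ G : List (List (Leg V)) → S,
      M (peel g G) = shMat ω α β g * M G := fun {g} hg G => shMat_peel ω α β hg G
  have tail_odd : ∀ (b : List (Leg V)) (d : List (List (Leg V))),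
      Odd (b :: d).length ↔ ¬ Odd d.length := fun b d => by
    rw [List.length_cons, Nat.odd_add_one]
  let D : ι → Matrix (Pos α β) (Pos α β) S := fun μ => der (momMat α β (ξ μ)) X
  have hD : ∀ μ, shMat ω α β (fun w => ξ μ (w.map mom).sum * f w) = D μ := fun μ =>
    (der_shMat ω α β (ξ μ) f).symm
  have hDD : shMat ω α β (fun w => sqComp c ξ (w.map mom).sum * f w) =
      ∑ μ, c μ • der (momMat α β (ξ μ)) (D μ) := by
    simp only [← hD, der_shMat, ← map_smul, ← map_sum]
    congr 1; funext w
    simp only [sqComp, Finset.sum_apply, Pi.smul_apply, smul_eq_mul, Finset.sum_mul]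
    exact Finset.sum_congr rfl fun μ _ => by ring
  have he₀ : M e₀ = 1 + X * M o₀ := by
    rw [← Mpeel hf, ← Munit, ← Madd]
    congr 1; funext d
    cases d with
    | nil => simp [e₀, peel]
    | cons b d => by_cases h : Odd d.length <;> simp [e₀, o₀, peel, tail_odd, h, -List.length_cons]
  have ho₀ : M o₀ = X * M e₀ := by
    rw [← Mpeel hf]
    congr 1; funext d
    cases d with
    | nil => simp [o₀, peel]
    | cons b d => by_cases h : Odd d.length <;> simp [e₀, o₀, peel, tail_odd, h, -List.length_cons]
  have he₁ : ∀ μ, M (e₁ μ) = X * M (o₁ μ) := fun μ => by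
    rw [← Mpeel hf]
    congr 1; funext d
    cases d with
    | nil => simp [e₁, peel, oddMom, oddEntries]
    | cons b d =>
      by_cases h : Odd d.length <;> simp [e₁, o₁, peel, tail_odd, h, -List.length_cons]; ring
  have ho₁ : ∀ μ, M (o₁ μ) = D μ * M e₀ + X * M (e₁ μ) := fun μ => by
    rw [← hD, ← Mpeel (by simp [hf]), ← Mpeel hf, ← Madd]
    congr 1; funext d
    cases d with
    | nil => simp [o₁, peel]
    | cons b d =>
      by_cases h : Odd d.length <;>
        simp [e₀, e₁, o₁, peel, tail_odd, h, oddMom_cons, -List.length_cons]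
      ring
  have he₂ : M e₂ = X * M o₂ := by
    rw [← Mpeel hf]
    congr 1; funext d
    cases d with
    | nil => simp [e₂, peel, oddMom, oddEntries, sqComp]
    | cons b d =>
      by_cases h : Odd d.length <;> simp [e₂, o₂, peel, tail_odd, h, -List.length_cons]; ring
  -- The three terms come from (p + P)² = p² + 2 p·P + P², where p is the momentum of the first
  -- block and P that of the later blocks at odd positions.
  have ho₂ : M o₂ = (∑ μ, c μ • der (momMat α β (ξ μ)) (D μ)) * M e₀ +
      ∑ μ, (2 * c μ) • (D μ * M (e₁ μ)) + X * M e₂ := by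
    rw [← hDD]
    simp only [← hD]
    rw [← Mpeel (by simp [hf]), ← Mpeel hf]
    simp only [← Mpeel (g := fun w => ξ _ (w.map mom).sum * f w) (by simp [hf]), ← Mmul, ← Msum,
      ← Madd]
    congr 1; funext d
    cases d with
    | nil => simp [o₂, peel]
    | cons b d =>
      by_cases h : Odd d.length
      · simp [e₀, e₁, e₂, o₂, peel, tail_odd, h, -List.length_cons]
      · simp only [o₂, e₀, e₁, e₂, peel, tail_odd, h, oddMom_cons, sqComp, map_add, not_false_eq_true,
          if_true, if_false, List.map_cons, List.prod_cons, Finset.sum_mul, Finset.mul_sum,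
          ← Finset.sum_add_distrib]
        exact Finset.sum_congr rfl fun μ _ => by ring
  -- The recursion makes `M e₀` a right inverse of 1 - X²; the left inverse `v * u` shows that it is
  -- two-sided.
  have hXX : M e₀ * (1 - X * X) = 1 := by
    have h1 : (1 - X * X) * M e₀ = 1 := by
      have := he₀
      rw [ho₀] at this
      rw [sub_mul, one_mul, mul_assoc]
      nth_rewrite 1 [this]; noncomm_ring
    have h2 : (v * u) * (1 - X * X) = 1 := by
      have : v * u * (1 - X * X) = v * (u * (1 - X)) * (1 + X) := by noncomm_ring
      rw [this, hu, mul_one, hv]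
    rw [← left_inv_eq_right_inv h2 h1, h2]
  have hW₁ : ∀ μ, (1 - X * X) * M (o₁ μ) = D μ * M e₀ := fun μ => by
    have := ho₁ μ
    rw [he₁] at this
    rw [sub_mul, one_mul]
    nth_rewrite 1 [this]; noncomm_ring
  have hW₁' : ∀ μ, M (o₁ μ) = M e₀ * (D μ * M e₀) := fun μ => by
    rw [← hW₁, ← mul_assoc, hXX, one_mul]
  have huv : (2 : S) • (X * M e₀) = u - v := by
    have h1 : u - v = (2 : S) • (X * (v * u)) := by
      have e : X * v = v * X := by
        have : v * (1 + X) = (1 + X) * v := by rw [hv, hv']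
        have e2 : X * v = (1 + X) * v - v := by noncomm_ring
        rw [e2, ← this]; noncomm_ring
      have : u - v = v * ((1 + X) - (1 - X)) * u := by
        calc u - v = v * (1 + X) * u - v * ((1 - X) * u) := by rw [hv, hu']; simp
          _ = _ := by noncomm_ring
      rw [this, ← mul_assoc, e, two_smul]; noncomm_ring
    have h2 : (v * u) * (1 - X * X) = 1 := by
      have : v * u * (1 - X * X) = v * (u * (1 - X)) * (1 + X) := by noncomm_ring
      rw [this, hu, mul_one, hv]
    have h3 : (1 - X * X) * (v * u) = 1 := by
      have : (1 - X * X) * (v * u) = (1 - X) * ((1 + X) * v) * u := by noncomm_ring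
      rw [this, hv', mul_one, hu']
    rw [h1, left_inv_eq_right_inv hXX h3]
  have hW₂ : (1 - X * X) * M o₂ = (∑ μ, c μ • der (momMat α β (ξ μ)) (D μ)) * M e₀ +
      ∑ μ, (2 * c μ) • (D μ * M (e₁ μ)) := by
    have := ho₂
    rw [he₂] at this
    rw [sub_mul, one_mul]
    nth_rewrite 1 [this]; noncomm_ring
  change _ = (1 - X * X) * M o₂ * (1 - X * X)
  rw [hW₂, add_mul, mul_assoc, hXX, mul_one, Finset.sum_mul, fieldEq]
  congr 1
  refine Finset.sum_congr rfl fun μ _ => ?_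
  have e1 : (2 * c μ) • (D μ * M (e₁ μ)) * (1 - X * X) =
      c μ • (D μ * ((2 : S) • (X * M e₀)) * (D μ * (M e₀ * (1 - X * X)))) := by
    rw [he₁, hW₁', mul_comm 2 (c μ), mul_smul, smul_mul_assoc, smul_mul_assoc, mul_smul_comm,
      smul_mul_assoc]
    simp only [mul_assoc]
  rw [e1, huv, hXX, mul_one]

end FieldEquation

/-! ### Filtration and parity by the number of removed legs -/

section Filtration

variable {V S : Type*} [CommRing S] {α β : List V}

/-- The total number of remaining legs. -/
def lvl (p : Pos α β) : ℕ := p.1 + p.2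

theorem lvl_le (p : Pos α β) : lvl p ≤ α.length + β.length := by
  have h₁ := p.1.2
  have h₂ := p.2.2
  simp only [lvl]; omega

/-- The matrices that remove at least `n` legs. -/
def filt (S : Type*) [CommRing S] (α β : List V) (n : ℕ) :
    Submodule S (Matrix (Pos α β) (Pos α β) S) where
  carrier := {T | ∀ p q, ¬ (q ≤ p ∧ lvl q + n ≤ lvl p) → T p q = 0}
  add_mem' {A B} hA hB p q h := by rw [Matrix.add_apply, hA p q h, hB p q h, add_zero]
  zero_mem' _ _ _ := rfl
  smul_mem' s A hA p q h := by rw [Matrix.smul_apply, hA p q h, smul_zero]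

theorem filt_mul {m n : ℕ} {A B : Matrix (Pos α β) (Pos α β) S} (hA : A ∈ filt S α β m)
    (hB : B ∈ filt S α β n) : A * B ∈ filt S α β (m + n) := by
  intro p q h
  rw [Matrix.mul_apply]
  refine Finset.sum_eq_zero fun r _ => ?_
  by_cases h₁ : r ≤ p ∧ lvl r + m ≤ lvl p
  · by_cases h₂ : q ≤ r ∧ lvl q + n ≤ lvl r
    · exact absurd ⟨h₂.1.trans h₁.1, by omega⟩ h
    · rw [hB r q h₂, mul_zero]
  · rw [hA p r h₁, zero_mul]

theorem filt_mono {m n : ℕ} (h : m ≤ n) : filt S α β n ≤ filt S α β m :=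
  fun _ hT p q hpq => hT p q fun h' => hpq ⟨h'.1, by omega⟩

theorem one_mem_filt : (1 : Matrix (Pos α β) (Pos α β) S) ∈ filt S α β 0 := by
  intro p q h
  rw [Matrix.one_apply_ne]
  rintro rfl
  exact h ⟨le_rfl, le_rfl⟩

theorem pow_mem_filt {T : Matrix (Pos α β) (Pos α β) S} (h : T ∈ filt S α β 1) (k : ℕ) :
    T ^ k ∈ filt S α β k := by
  induction k with
  | zero => simpa using one_mem_filt
  | succ k ih => rw [pow_succ]; exact filt_mul ih h

theorem eq_zero_of_mem_filt {n : ℕ} (hn : α.length + β.length < n)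
    {T : Matrix (Pos α β) (Pos α β) S} (h : T ∈ filt S α β n) : T = 0 := by
  ext p q
  exact h p q fun h' => by have := lvl_le p; omega

theorem der_mem_filt [AddCommGroup V] {n : ℕ} (ξ : V →+ S) {T : Matrix (Pos α β) (Pos α β) S}
    (h : T ∈ filt S α β n) : der (momMat α β ξ) T ∈ filt S α β n := by
  intro p q hpq
  rw [der_momMat_apply, h p q hpq, mul_zero]

/-- The inverse `1 + T + T² + ⋯` of `1 - T` for a nilpotent `T`. -/
def geomInv (T : Matrix (Pos α β) (Pos α β) S) : Matrix (Pos α β) (Pos α β) S :=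
  ∑ k ∈ Finset.range (α.length + β.length + 1), T ^ k

theorem geomInv_mul {T : Matrix (Pos α β) (Pos α β) S} (h : T ∈ filt S α β 1) :
    geomInv T * (1 - T) = 1 := by
  rw [geomInv, geom_sum_mul_neg,
    eq_zero_of_mem_filt (Nat.lt_succ_self _) (pow_mem_filt h _), sub_zero]

theorem mul_geomInv {T : Matrix (Pos α β) (Pos α β) S} (h : T ∈ filt S α β 1) :
    (1 - T) * geomInv T = 1 := by
  rw [geomInv, mul_neg_geom_sum,
    eq_zero_of_mem_filt (Nat.lt_succ_self _) (pow_mem_filt h _), sub_zero]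

theorem geomInv_mem_filt {T : Matrix (Pos α β) (Pos α β) S} (h : T ∈ filt S α β 1) :
    geomInv T ∈ filt S α β 0 :=
  Submodule.sum_mem _ fun k _ => filt_mono (Nat.zero_le k) (pow_mem_filt h k)

/-- The resolvent identity. -/
theorem geomInv_sub_mem {n : ℕ} {T T' : Matrix (Pos α β) (Pos α β) S} (hT : T ∈ filt S α β 1)
    (hT' : T' ∈ filt S α β 1) (h : T - T' ∈ filt S α β n) :
    geomInv T - geomInv T' ∈ filt S α β n := by
  have : geomInv T - geomInv T' = geomInv T * (T - T') * geomInv T' := by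
    calc geomInv T - geomInv T'
        = geomInv T * ((1 - T') * geomInv T') - geomInv T * (1 - T) * geomInv T' := by
          rw [geomInv_mul hT, mul_geomInv hT', mul_one, one_mul]
      _ = _ := by noncomm_ring
  rw [this]
  simpa using filt_mul (filt_mul (geomInv_mem_filt hT) h) (geomInv_mem_filt hT')

/-- The matrices that remove a number of legs of the parity of `b`. -/
def parity (S : Type*) [CommRing S] (α β : List V) (b : ℕ) :
    Submodule S (Matrix (Pos α β) (Pos α β) S) where
  carrier := {T | ∀ p q, ¬ Even (lvl p + lvl q + b) → T p q = 0}
  add_mem' {A B} hA hB p q h := by rw [Matrix.add_apply, hA p q h, hB p q h, add_zero]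
  zero_mem' _ _ _ := rfl
  smul_mem' s A hA p q h := by rw [Matrix.smul_apply, hA p q h, smul_zero]

theorem parity_mul {m n : ℕ} {A B : Matrix (Pos α β) (Pos α β) S} (hA : A ∈ parity S α β m)
    (hB : B ∈ parity S α β n) : A * B ∈ parity S α β (m + n) := by
  intro p q h
  rw [Matrix.mul_apply]
  refine Finset.sum_eq_zero fun r _ => ?_
  by_cases h₁ : Even (lvl p + lvl r + m)
  · by_cases h₂ : Even (lvl r + lvl q + n)
    · exact absurd (by rw [Nat.even_iff] at *; omega) h
    · rw [hB r q h₂, mul_zero]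
  · rw [hA p r h₁, zero_mul]

theorem parity_congr {m n : ℕ} (h : Even (m + n)) : parity S α β m ≤ parity S α β n :=
  fun _ hT p q hpq => hT p q fun h' => hpq (by rw [Nat.even_iff] at *; omega)

theorem geomInv_mem_parity {T : Matrix (Pos α β) (Pos α β) S} (h : T ∈ parity S α β 0) :
    geomInv T ∈ parity S α β 0 := by
  have hk : ∀ k, T ^ k ∈ parity S α β 0 := fun k => by
    induction k with
    | zero =>
      intro p q hpq
      rw [pow_zero, Matrix.one_apply_ne]
      rintro rfl
      exact hpq (by simp)
    | succ k ih => rw [pow_succ]; exact parity_mul ih h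
  exact Submodule.sum_mem _ fun k _ => hk k

variable (ω : V → List V → S)

/-- Vanishing is required only on words that occur in ordered permutations, because only for these
does the regularity hypothesis give information. With `n` larger than the total number of legs the
matrix is zero. -/
theorem shMat_mem_filt {n : ℕ} {f : List (Leg V) → S}
    (h : ∀ a b, a <:+ α → b <:+ β → ∀ w, Occurs a b w → w.length < n → f w = 0) :
    shMat ω α β f ∈ filt S α β n := by
  intro p q hpq
  rw [shMat_apply]
  by_cases hle : q ≤ p
  · rw [sh_lengthDelta]
    refine (sh_congr_left ω (g := fun _ => 0) _ fun w hw => ?_).trans (sh_zero_left ω _ _ _)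
    split_ifs with hl
    · refine h _ _ (sfx_suffix _ _) (sfx_suffix _ _) w hw ?_
      rw [length_sfx, length_sfx] at hl
      have : ¬ lvl q + n ≤ lvl p := fun h' => hpq ⟨hle, h'⟩
      simp only [lvl] at this
      omega
    · rfl
  · refine sh_lengthDelta_eq_zero ω f ?_
    rw [length_sfx, length_sfx]
    by_contra! h'
    exact hle ⟨h'.1, h'.2⟩

theorem shMat_mem_parity {f : List (Leg V) → S} (h : ∀ w, Even w.length → f w = 0) :
    shMat ω α β f ∈ parity S α β 1 := by
  intro p q hpq
  rw [shMat_apply, sh_lengthDelta]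
  refine (sh_congr_left ω (g := fun _ => 0) _ fun w _ => ?_).trans (sh_zero_left ω _ _ _)
  split_ifs with hl
  · refine h w ?_
    rw [length_sfx, length_sfx] at hl
    simp only [lvl] at hpq
    rw [Nat.even_iff] at *
    omega
  · rfl

end Filtration

/-! ### The subalgebra of the β-operators -/

section BetaSubalgebra

variable {V S : Type*} [CommRing S] (α β : List V)

/-- The operators that remove `β`-legs only. -/
def betaAlg (S : Type*) [CommRing S] (α β : List V) :
    Subalgebra S (Matrix (Pos α β) (Pos α β) S) where
  carrier := {T | ∃ χ : Matrix (Fin (β.length + 1)) (Fin (β.length + 1)) S, ∀ p q,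
    T p q = if p.1 = q.1 then χ p.2 q.2 else 0}
  mul_mem' := by
    rintro A B ⟨χ, hA⟩ ⟨χ', hB⟩
    refine ⟨χ * χ', fun p q => ?_⟩
    simp only [Matrix.mul_apply, hA, hB, Fintype.sum_prod_type]
    rw [Finset.sum_eq_single p.1]
    · simp only [if_true]; split_ifs <;> simp
    · intro k _ hk; simp [Ne.symm hk]
    · simp
  add_mem' := by
    rintro A B ⟨χ, hA⟩ ⟨χ', hB⟩
    refine ⟨χ + χ', fun p q => ?_⟩
    simp only [Matrix.add_apply, hA, hB]
    split_ifs <;> simp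
  algebraMap_mem' s := by
    refine ⟨s • 1, fun p q => ?_⟩
    rw [Matrix.algebraMap_matrix_apply]
    by_cases h : p = q
    · subst h; simp
    · by_cases h₁ : p.1 = q.1
      · have h₂ : p.2 ≠ q.2 := fun h₂ => h (Prod.ext h₁ h₂)
        simp [h, h₁, Matrix.one_apply_ne h₂]
      · simp [h, h₁]

theorem mul_apply_alpha_beta {A B : Matrix (Pos α β) (Pos α β) S}
    (hA : ∀ p q : Pos α β, p.2 ≠ q.2 → A p q = 0) (hB : ∀ p q : Pos α β, p.1 ≠ q.1 → B p q = 0)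
    (p q : Pos α β) : (A * B) p q = A p (q.1, p.2) * B (q.1, p.2) q := by
  rw [Matrix.mul_apply, Finset.sum_eq_single (q.1, p.2)]
  · rintro ⟨i, k⟩ _ h
    by_cases hk : p.2 = k
    · rw [hB (i, k) q (fun hi => h (Prod.ext hi hk.symm)), mul_zero]
    · rw [hA p (i, k) hk, zero_mul]
  · simp

theorem mul_apply_beta_alpha {A B : Matrix (Pos α β) (Pos α β) S}
    (hA : ∀ p q : Pos α β, p.2 ≠ q.2 → A p q = 0) (hB : ∀ p q : Pos α β, p.1 ≠ q.1 → B p q = 0)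
    (p q : Pos α β) : (B * A) p q = B p (p.1, q.2) * A (p.1, q.2) q := by
  rw [Matrix.mul_apply, Finset.sum_eq_single (p.1, q.2)]
  · rintro ⟨i, k⟩ _ h
    by_cases hk : p.1 = i
    · rw [hA (i, k) q (fun hi => h (Prod.ext hk.symm hi)), mul_zero]
    · rw [hB p (i, k) hk, zero_mul]
  · simp

theorem shMat_onBeta_mem (ω : V → List V → S) (g : List V → S) :
    shMat ω α β (onBeta g) ∈ betaAlg S α β := by
  refine ⟨fun i j => conv g (fun a => if a.length = j then 1 else 0) (sfx β i), fun p q => ?_⟩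
  simp only [shMat_apply, sh_onBeta, conv_eq_sum]
  split_ifs with h
  · simp only [lengthDelta, length_sfx, h, true_and]
  · have : ¬ ((p.1 : ℕ) = q.1) := fun h' => h (Fin.ext h')
    simp [lengthDelta, length_sfx, this]

theorem geomInv_mem {T : Matrix (Pos α β) (Pos α β) S}
    {𝔠 : Subalgebra S (Matrix (Pos α β) (Pos α β) S)} (h : T ∈ 𝔠) : geomInv T ∈ 𝔠 :=
  sum_mem fun _ _ => pow_mem h _

end BetaSubalgebra

/-! ### The subalgebra of the α-operators and the first-order commutator -/

section Subalgebras

variable {V S S₀ ι : Type*} [CommRing S] [CommRing S₀] [AddCommGroup V] [Fintype ι]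

/-- The scalar product of two momenta, in components. -/
def dotComp (c : ι → S) (ξ : ι → V →+ S) (v w : V) : S := ∑ μ, c μ * (ξ μ v * ξ μ w)

theorem dotComp_add_left (c : ι → S) (ξ : ι → V →+ S) (v v' w : V) :
    dotComp c ξ (v + v') w = dotComp c ξ v w + dotComp c ξ v' w := by
  simp only [dotComp, map_add, ← Finset.sum_add_distrib]
  exact Finset.sum_congr rfl fun μ _ => by ring

theorem dotComp_zero_left (c : ι → S) (ξ : ι → V →+ S) (w : V) : dotComp c ξ 0 w = 0 := by
  simp [dotComp]

/-- The first-order weight `1 + 2 t x · b`. -/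
def legWeight (c : ι → S) (ξ : ι → V →+ S) (t : S) (x : V) (b : List V) : S :=
  1 + 2 * t * dotComp c ξ x b.sum

variable (c : ι → S) (ξ : ι → V →+ S) (α β : List V)

theorem one_add_mul_one_add {t : S} (ht : t * t = 0) (r s : S) :
    (1 + 2 * t * r) * (1 + 2 * t * s) = 1 + 2 * t * (r + s) := by
  linear_combination (4 * r * s) * ht

theorem prod_legWeight {t : S} (ht : t * t = 0) (l b : List V) :
    (l.map fun x => legWeight c ξ t x b).prod = 1 + 2 * t * dotComp c ξ l.sum b.sum := by
  induction l with
  | nil => simp [dotComp_zero_left]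
  | cons x l ih =>
    rw [List.map_cons, List.prod_cons, ih, legWeight, one_add_mul_one_add ht, List.sum_cons,
      dotComp_add_left]

/-- The weight of a matrix entry of an operator that removes `α`-legs. -/
def entryWeight (t : S) (i j : Fin (α.length + 1)) (k : Fin (β.length + 1)) : S :=
  1 + 2 * t * dotComp c ξ ((sfx α i).sum - (sfx α j).sum) (sfx β k).sum

/-- The exponent-like first-order weights telescope since t² = 0. This closes the α-operators under
multiplication. -/
theorem entryWeight_mul {t : S} (ht : t * t = 0) (i j l : Fin (α.length + 1))
    (k : Fin (β.length + 1)) :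
    entryWeight c ξ α β t i j k * entryWeight c ξ α β t j l k = entryWeight c ξ α β t i l k := by
  rw [entryWeight, entryWeight, one_add_mul_one_add ht, ← dotComp_add_left, sub_add_sub_cancel]
  rfl

/-- The operators that remove `α`-legs only. -/
def alphaAlg {t : S} (ht : t * t = 0) : Subalgebra S (Matrix (Pos α β) (Pos α β) S) where
  carrier := {T | ∃ χ : Matrix (Fin (α.length + 1)) (Fin (α.length + 1)) S, ∀ p q,
    T p q = if p.2 = q.2 then χ p.1 q.1 * entryWeight c ξ α β t p.1 q.1 p.2 else 0}
  mul_mem' := by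
    rintro A B ⟨χ, hA⟩ ⟨χ', hB⟩
    refine ⟨χ * χ', fun p q => ?_⟩
    simp only [Matrix.mul_apply, hA, hB, Fintype.sum_prod_type]
    split_ifs with h
    · rw [Finset.sum_mul]
      refine Finset.sum_congr rfl fun i _ => ?_
      rw [Finset.sum_eq_single p.2]
      · rw [if_pos rfl, if_pos h, ← entryWeight_mul c ξ α β ht p.1 i q.1]; ring
      · intro k _ hk; rw [if_neg (Ne.symm hk), zero_mul]
      · simp
    · refine Finset.sum_eq_zero fun i _ => Finset.sum_eq_zero fun k _ => ?_
      by_cases hk : p.2 = k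
      · rw [if_neg (c := k = q.2) (by rw [← hk]; exact h), mul_zero]
      · rw [if_neg hk, zero_mul]
  add_mem' := by
    rintro A B ⟨χ, hA⟩ ⟨χ', hB⟩
    refine ⟨χ + χ', fun p q => ?_⟩
    simp only [Matrix.add_apply, hA, hB]
    split_ifs
    · ring
    · simp
  algebraMap_mem' s := by
    refine ⟨s • 1, fun p q => ?_⟩
    rw [Matrix.algebraMap_matrix_apply]
    by_cases h : p = q
    · subst h; simp [entryWeight, dotComp_zero_left]
    · by_cases h₂ : p.2 = q.2
      · have h₁ : p.1 ≠ q.1 := fun h₁ => h (Prod.ext h₁ h₂)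
        simp [h, h₂, Matrix.one_apply_ne h₁]
      · simp [h, h₂]

/-- An α-operator that acts before a β-operator is weighted with the longer β-list. The two orders
of action differ by 2t times the scalar product of the removed α-momentum with the removed
β-momentum, which is 2t ∂A·∂B. -/
theorem firstOrderCommuting_matrix {t : S} (ht : t * t = 0) (ρ : S →+* S₀) (hρt : ρ t = 0)
    (hρ : ∀ r s, ρ r = ρ s → t * r = t * s) :
    FirstOrderCommuting c (fun μ => momMat α β (ξ μ)) t ρ.mapMatrix
      (alphaAlg c ξ α β ht) (betaAlg S α β) := by
  have comm : ∀ A ∈ alphaAlg c ξ α β ht, ∀ B ∈ betaAlg S α β,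
      A * B = B * A + (2 * t) • ∑ μ, c μ • (der (momMat α β (ξ μ)) A *
        der (momMat α β (ξ μ)) B) := by
    rintro A ⟨χ, hA⟩ B ⟨χ', hB⟩
    have hA' : ∀ p q : Pos α β, p.2 ≠ q.2 → A p q = 0 := fun p q h => by rw [hA, if_neg h]
    have hB' : ∀ p q : Pos α β, p.1 ≠ q.1 → B p q = 0 := fun p q h => by rw [hB, if_neg h]
    have dA : ∀ μ, ∀ p q : Pos α β, p.2 ≠ q.2 → der (momMat α β (ξ μ)) A p q = 0 :=
      fun μ p q h => by rw [der_momMat_apply, hA' p q h, mul_zero]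
    have dB : ∀ μ, ∀ p q : Pos α β, p.1 ≠ q.1 → der (momMat α β (ξ μ)) B p q = 0 :=
      fun μ p q h => by rw [der_momMat_apply, hB' p q h, mul_zero]
    ext p q
    simp only [Matrix.add_apply, Matrix.smul_apply, Matrix.sum_apply, smul_eq_mul,
      mul_apply_alpha_beta α β hA' hB', mul_apply_beta_alpha α β hA' hB',
      mul_apply_alpha_beta α β (dA _) (dB _), der_momMat_apply, hA, hB, if_true]
    have e : ∑ μ, c μ * ((ξ μ ((sfx α p.1).sum + (sfx β p.2).sum) -
        ξ μ ((sfx α q.1).sum + (sfx β p.2).sum)) *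
          (χ p.1 q.1 * entryWeight c ξ α β t p.1 q.1 p.2) *
        ((ξ μ ((sfx α q.1).sum + (sfx β p.2).sum) -
          ξ μ ((sfx α q.1).sum + (sfx β q.2).sum)) * χ' p.2 q.2)) =
        χ p.1 q.1 * χ' p.2 q.2 * entryWeight c ξ α β t p.1 q.1 p.2 *
          (dotComp c ξ ((sfx α p.1).sum - (sfx α q.1).sum) (sfx β p.2).sum -
            dotComp c ξ ((sfx α p.1).sum - (sfx α q.1).sum) (sfx β q.2).sum) := by
      simp only [dotComp, ← Finset.sum_sub_distrib, Finset.mul_sum, map_add, map_sub]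
      exact Finset.sum_congr rfl fun μ _ => by ring
    rw [e]
    simp only [entryWeight]
    -- The remainder comes from the weight already contained in the derivative of `A`; it is of
    -- order t².
    linear_combination (-4 * χ p.1 q.1 * χ' p.2 q.2 *
      dotComp c ξ ((sfx α p.1).sum - (sfx α q.1).sum) (sfx β p.2).sum *
      (dotComp c ξ ((sfx α p.1).sum - (sfx α q.1).sum) (sfx β p.2).sum -
        dotComp c ξ ((sfx α p.1).sum - (sfx α q.1).sum) (sfx β q.2).sum)) * ht
  refine ⟨fun μ ν => commute_momMat α β _ _, ht, ?_, ?_, ?_, ?_, comm⟩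
  · intro A B h
    ext p q
    exact hρ _ _ (congrFun (congrFun h p) q)
  · rintro μ A ⟨χ, hA⟩
    refine ⟨fun i j => (ξ μ (sfx α i).sum - ξ μ (sfx α j).sum) * χ i j, fun p q => ?_⟩
    rw [der_momMat_apply, hA]
    split_ifs with h
    · rw [map_add, map_add, h]; ring
    · simp
  · rintro μ B ⟨χ, hB⟩
    refine ⟨fun i j => (ξ μ (sfx β i).sum - ξ μ (sfx β j).sum) * χ i j, fun p q => ?_⟩
    rw [der_momMat_apply, hB]
    split_ifs with h
    · rw [map_add, map_add, h]; ring
    · simp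
  · intro A hA B hB
    rw [← map_mul, ← map_mul, comm A hA B hB, map_add]
    have : ∀ M : Matrix (Pos α β) (Pos α β) S, ρ.mapMatrix ((2 * t) • M) = 0 := fun M => by
      ext p q; simp [hρt]
    rw [this, add_zero]

theorem shMat_onAlpha_mem {t : S} (ht : t * t = 0) (g : List V → S) :
    shMat (legWeight c ξ t) α β (onAlpha g) ∈ alphaAlg c ξ α β ht := by
  refine ⟨fun i j => conv g (fun a => if a.length = j then 1 else 0) (sfx α i), fun p q => ?_⟩
  simp only [shMat_apply, sh_onAlpha, conv_eq_sum]
  split_ifs with h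
  · rw [← List.sum_map_mul_right]
    congr 1
    refine List.map_congr_left fun k _ => ?_
    rw [prod_legWeight c ξ ht, lengthDelta, length_sfx, h]
    by_cases hk : ((sfx α p.1).drop k).length = q.1
    · have hs : (sfx α q.1) = (sfx α p.1).drop k := by
        rw [← hk]
        exact sfx_length_of_suffix ((List.drop_suffix _ _).trans (sfx_suffix _ _))
      have hsum : ((sfx α p.1).take k).sum = (sfx α p.1).sum - (sfx α q.1).sum := by
        rw [hs, eq_sub_iff_add_eq, ← List.sum_append, List.take_append_drop]
      simp [hk, entryWeight, hsum]
    · rw [if_neg hk, if_neg fun h' => hk h'.1]; ring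
  · have : ¬ ((p.2 : ℕ) = q.2) := fun h' => h (Fin.ext h')
    simp [lengthDelta, length_sfx, this]

end Subalgebras

/-! ### The Berends–Giele recursion as a field equation -/

section Currents

variable {X Y : Type*}

theorem divisions_map (g : X → Y) (l : List X) :
    divisions (l.map g) = (divisions l).map (List.map (List.map g)) := by
  induction h : l.length using Nat.strong_induction_on generalizing l with
  | _ n ih =>
    cases l with
    | nil => simp [divisions]
    | cons x l =>
      rw [List.map_cons, divisions, divisions, List.map_flatMap, List.length_map]
      congr 1
      funext k
      rw [← List.map_drop, ih (l.drop k).length (by subst h; simp) _ rfl]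
      simp [Function.comp_def, List.map_take]

theorem infix_of_mem_divisions {l b : List X} {d : List (List X)} (hd : d ∈ divisions l)
    (hb : b ∈ d) : b <:+: l := by
  rw [← ((mem_divisions l d).1 hd).1]
  obtain ⟨s, t, rfl⟩ := List.append_of_mem hb
  exact ⟨s.flatten, t.flatten, by simp⟩

variable {K V : Type*} [Field K] [AddCommGroup V] [Module K V]
  (η : LinearMap.BilinForm K V) (F : K)

theorem current_of_length_ne_one {l : List V} (h : l.length ≠ 1) :
    current η F l = -(1 / sq η l.sum) *
      (((divisions l).filter fun d => 3 ≤ d.length).map fun d =>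
        vertex η F (-l.sum :: d.map List.sum) * (d.map (current η F)).prod).sum := by
  rw [current, if_neg h]
  congr 2
  have e : ∀ (L : List (List (List V))) (f : List (List V) → K),
      (L.attach.map fun d => f d.1) = L.map f := fun L f => by simp
  rw [e _ fun d => vertex η F (-l.sum :: d.map List.sum) *
    (d.attach.map fun b => current η F b.1).prod]
  simp only [List.attach_map_val]

theorem exists_even_block {d : List (List X)} (hodd : Odd d.length) (h : Even d.flatten.length) :
    ∃ b ∈ d, Even b.length := by
  by_contra! hb
  have : ∀ d : List (List X), (∀ b ∈ d, ¬ Even b.length) →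
      (Even d.flatten.length ↔ Even d.length) := by
    intro d
    induction d with
    | nil => simp
    | cons b d ih =>
      intro hd
      have h₁ := hd b (by simp)
      have h₂ := ih fun b hb => hd b (by simp [hb])
      rw [List.flatten_cons, List.length_append, List.length_cons, Nat.even_add, h₂,
        Nat.even_add_one]
      tauto
  exact Nat.not_even_iff_odd.2 hodd ((this d hb).1 h)

/-- An even number of blocks meets a vertex with an odd number of legs, which vanishes. An odd
number of blocks with even total length includes a block of even length, whose current vanishes by
`ih`. -/
theorem vertex_mul_prod_eq_zero {l : List V} (hl : Even l.length) {d : List (List V)}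
    (hd : d ∈ divisions l)
    (ih : ∀ b ∈ d, Even b.length → current η F b = 0) :
    vertex η F (-l.sum :: d.map List.sum) * (d.map (current η F)).prod = 0 := by
  by_cases hodd : Odd d.length
  · obtain ⟨b, hb, hbe⟩ := exists_even_block hodd (by rw [((mem_divisions l d).1 hd).1]; exact hl)
    rw [List.prod_eq_zero, mul_zero]
    exact List.mem_map.2 ⟨b, hb, ih b hb hbe⟩
  · rw [vertex, if_neg, zero_mul]
    rw [List.length_cons, List.length_map, Nat.even_add_one]
    simpa using hodd

theorem current_even {l : List V} (hl : Even l.length) : current η F l = 0 := by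
  induction h : l.length using Nat.strong_induction_on generalizing l with
  | _ n ih =>
    rw [current_of_length_ne_one η F (by rintro h; rw [h] at hl; simp at hl)]
    refine mul_eq_zero_of_right _ (List.sum_eq_zero fun x hx => ?_)
    obtain ⟨d, hd, rfl⟩ := List.mem_map.1 hx
    rw [List.mem_filter, decide_eq_true_eq] at hd
    refine vertex_mul_prod_eq_zero η F hl hd.1 fun b hb hbe => ?_
    exact ih b.length (by rw [← h]; exact length_lt_of_mem_divisions hd.1 (by omega) hb) hbe rfl

theorem amplitude_even {l : List V} (hl : Even l.length) : amplitude η F l = 0 := by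
  rw [amplitude, if_neg (by rintro h; rw [h] at hl; simp at hl), List.sum_eq_zero, neg_zero]
  intro x hx
  obtain ⟨d, hd, rfl⟩ := List.mem_map.1 hx
  rw [List.mem_filter, decide_eq_true_eq] at hd
  exact vertex_mul_prod_eq_zero η F hl hd.1 fun b _ hbe => current_even η F hbe

/-- The amplitude is the current times the inverse propagator also for an even number of legs and
for a single leg. -/
theorem amplitude_eq_of_regular {l : List V}
    (h : 3 ≤ l.length → Odd l.length → sq η l.sum ≠ 0) :
    amplitude η F l = sq η l.sum * current η F l := by
  rcases Nat.even_or_odd l.length with he | ho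
  · rw [amplitude_even η F he, current_even η F he, mul_zero]
  · by_cases h1 : l.length = 1
    · rw [amplitude, current, if_pos h1, if_pos h1, mul_one]
    · refine amplitude_eq η F l (h ?_ ho)
      obtain ⟨k, hk⟩ := ho
      omega

variable {S ι : Type*} [CommRing S] [Fintype ι]

theorem oddMom_add_tail (d : List (List (Leg V))) :
    oddMom d + oddMom d.tail = (d.map fun b => (b.map mom).sum).sum := by
  induction d with
  | nil => simp [oddMom, oddEntries]
  | cons b d ih =>
    rw [oddMom_cons, List.tail_cons, List.map_cons, List.sum_cons, ← ih]; abel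

theorem oddMom_mem (W : Submodule K V) {d : List (List (Leg V))}
    (h : ∀ b ∈ d, ∀ x ∈ b, mom x ∈ W) : oddMom d ∈ W := by
  have hs : ∀ v ∈ d.map fun b => (b.map mom).sum, v ∈ W := by
    intro v hv
    obtain ⟨b, hb, rfl⟩ := List.mem_map.1 hv
    refine list_sum_mem fun y hy => ?_
    obtain ⟨x, hx, rfl⟩ := List.mem_map.1 hy
    exact h b hb x hx
  have ho : ∀ l : List V, ∀ v ∈ oddEntries l, v ∈ l := by
    intro l
    induction l using oddEntries.induct with
    | case1 => simp [oddEntries]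
    | case2 x => simp [oddEntries]
    | case3 x y l ih =>
      intro v hv
      rw [oddEntries, List.mem_cons] at hv
      rcases hv with rfl | hv
      · simp
      · simp [ih v hv]
  exact list_sum_mem fun v hv => hs v (ho _ v hv)

theorem sum_map_sum (d : List (List (Leg V))) :
    (d.map fun b => (b.map mom).sum).sum = (d.flatten.map mom).sum := by
  induction d with
  | nil => simp
  | cons b d ih => simp [ih]

/-- The field equation of the currents, with the amplitude as its source term. -/
theorem vertexSum_current (φ : K →+* S) {lam : S} (hlam : lam * lam = φ (-(1 / (2 * F ^ 2))))
    {c : ι → S} {ξ : ι → V →+ S} {W : Submodule K V}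
    (hsq : ∀ v ∈ W, sqComp c ξ v = φ (sq η v)) {f : List (Leg V) → S} {w : List (Leg V)}
    (hW : ∀ x ∈ w, mom x ∈ W) (hw1 : w.length = 1 → sq η (w.map mom).sum = 0)
    (hf : ∀ b, b <:+: w → b.length < w.length → f b = lam * φ (current η F (b.map mom))) :
    vertexSum c ξ f w = φ (sq η (w.map mom).sum) * f w - lam * φ (amplitude η F (w.map mom)) := by
  have hWsum : (w.map mom).sum ∈ W := list_sum_mem fun y hy => by
    obtain ⟨x, hx, rfl⟩ := List.mem_map.1 hy
    exact hW x hx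
  by_cases hw : w = []
  · subst hw
    simp [vertexSum, divSum_nil, sq, amplitude, divisions]
  let G : List (List (Leg V)) → S := fun d =>
    if Odd d.length then sqComp c ξ (oddMom d) * (d.map f).prod else 0
  -- The one-block division is the kinetic term; divisions with at least three blocks are the
  -- interaction vertices.
  have h₁ : vertexSum c ξ f w = divSum (fun d => if d.length = 1 then G d else 0) w +
      divSum (fun d => if 3 ≤ d.length then G d else 0) w := by
    rw [← divSum_add, vertexSum]
    refine divSum_congr fun d _ => ?_
    by_cases ho : Odd d.length
    · obtain ⟨k, hk⟩ := ho
      rcases Nat.eq_zero_or_pos k with rfl | hk0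
      · simp [G, hk]
      · rw [if_neg (c := d.length = 1) (by omega), if_pos (c := 3 ≤ d.length) (by omega), zero_add]
    · simp [G, ho]
  have h₂ : G [w] = φ (sq η (w.map mom).sum) * f w := by
    have : oddMom [w] = (w.map mom).sum := by simp [oddMom, oddEntries]
    simp [G, this, hsq _ hWsum]
  have h₃ : divSum (fun d => if 3 ≤ d.length then G d else 0) w =
      lam * φ (((divisions (w.map mom)).filter fun d => 3 ≤ d.length).map fun d =>
        vertex η F (-(w.map mom).sum :: d.map List.sum) * (d.map (current η F)).prod).sum := by
    rw [divisions_map, List.filter_map, List.map_map, map_list_sum, List.map_map,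
      ← List.sum_map_mul_left]
    have e : ∀ (L : List (List (List (Leg V)))) (H : List (List (Leg V)) → S),
        (L.map fun d => if 3 ≤ d.length then H d else 0).sum =
          ((L.filter fun d => 3 ≤ d.length).map H).sum := by
      intro L H
      induction L with
      | nil => simp
      | cons d L ih => by_cases h : 3 ≤ d.length <;> simp [h, ih]
    rw [divSum, e]
    congr 1
    have e' : ((fun d : List (List V) => decide (3 ≤ d.length)) ∘ List.map (List.map mom)) =
        fun d : List (List (Leg V)) => decide (3 ≤ d.length) := by funext d; simp
    rw [e']
    refine List.map_congr_left fun d hd => ?_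
    rw [List.mem_filter, decide_eq_true_eq] at hd
    obtain ⟨hd, hd3⟩ := hd
    have hprod : (d.map f).prod =
        lam ^ d.length * φ ((d.map (List.map mom)).map (current η F)).prod := by
      have hb : ∀ b ∈ d, f b = lam * φ (current η F (b.map mom)) := fun b hb =>
        hf b (infix_of_mem_divisions hd hb) (length_lt_of_mem_divisions hd (by omega) hb)
      rw [List.map_congr_left hb, List.prod_map_mul, List.map_map, map_list_prod, List.map_map]
      simp [Function.comp_def]
    simp only [Function.comp_apply, G]
    by_cases ho : Odd d.length
    · have hmom : (oddEntries (-(w.map mom).sum :: (d.map (List.map mom)).map List.sum)).sum =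
          -oddMom d := by
        have h := oddMom_add_tail d
        rw [sum_map_sum, ((mem_divisions w d).1 hd).1] at h
        rw [oddEntries_cons, List.sum_cons, ← h, List.map_map]
        have : (oddEntries (d.map (List.sum ∘ List.map mom)).tail).sum = oddMom d.tail := by
          rw [oddMom, List.map_tail]; rfl
        rw [this]; abel
      have hd : oddMom d ∈ W := oddMom_mem W fun b hb x hx =>
        hW x ((infix_of_mem_divisions hd hb).subset hx)
      obtain ⟨k, hk⟩ := ho
      rw [if_pos ⟨k, hk⟩, vertex, if_pos, hmom, hprod, hsq _ hd]
      · have hl : (-(w.map mom).sum :: (d.map (List.map mom)).map List.sum).length / 2 - 1 = k := by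
          simp only [List.length_cons, List.length_map]; omega
        have hneg : sq η (-oddMom d) = sq η (oddMom d) := by simp [sq]
        rw [hl, hneg, hk, map_mul, map_mul, map_pow, ← hlam]
        ring
      · simp only [List.length_cons, List.length_map, hk]
        exact ⟨k + 1, by ring⟩
    · rw [if_neg ho, vertex, if_neg, zero_mul, map_zero, mul_zero]
      simp only [List.length_cons, List.length_map, Nat.even_add_one]
      simpa using ho
  rw [h₁, divSum_length_one G hw, h₂, h₃, amplitude]
  split_ifs with h
  -- For a single leg there is no vertex, and the amplitude is the square of an on-shell momentum.
  · rw [List.length_map] at h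
    have : ((divisions (w.map mom)).filter fun d => 3 ≤ d.length) = [] := by
      rw [List.filter_eq_nil_iff]
      intro d hd h3
      rw [decide_eq_true_eq] at h3
      obtain ⟨b, hb⟩ := List.exists_mem_of_length_pos (by omega : 0 < d.length)
      have h4 := length_lt_of_mem_divisions hd (by omega) hb
      rw [List.length_map, h, Nat.lt_one_iff, List.length_eq_zero_iff] at h4
      exact ((mem_divisions _ _).1 hd).2 (h4 ▸ hb)
    simp [this, hw1 h]
  · rw [map_neg]; ring

end Currents

/-! ### Ordered permutations and their segments -/

section OrderedPerms

variable {V S : Type*} [CommRing S]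

theorem perm_of_mem_orderedPerms {a b : List V} {σ : List (Leg V)} (h : σ ∈ orderedPerms a b) :
    (σ.map mom).Perm (a ++ b) := by
  induction a, b using pair_induction generalizing σ with
  | h00 => simp [orderedPerms_nil_nil] at h; simp [h]
  | h10 x a ih =>
    rw [orderedPerms_cons_nil, List.mem_map] at h
    obtain ⟨σ, h, rfl⟩ := h
    exact (ih h).cons x
  | h01 y b ih =>
    rw [orderedPerms_nil_cons, List.mem_map] at h
    obtain ⟨σ, h, rfl⟩ := h
    exact (ih h).cons y
  | h11 x a y b ih₁ ih₂ =>
    rw [orderedPerms_cons_cons, List.mem_append, List.mem_map, List.mem_map] at h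
    obtain ⟨σ, h, rfl⟩ | ⟨σ, h, rfl⟩ := h
    · exact (ih₁ h).cons x
    · exact ((ih₂ h).cons y).trans List.perm_middle.symm

theorem append_mem_orderedPerms {a b a' b' : List V} {σ σ' : List (Leg V)}
    (h : σ ∈ orderedPerms a b) (h' : σ' ∈ orderedPerms a' b') :
    σ ++ σ' ∈ orderedPerms (a ++ a') (b ++ b') := by
  induction a, b using pair_induction generalizing σ with
  | h00 => simp [orderedPerms_nil_nil] at h; simpa [h] using h'
  | h10 x a ih =>
    rw [orderedPerms_cons_nil, List.mem_map] at h
    obtain ⟨σ, h, rfl⟩ := h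
    exact mem_orderedPerms_inl (ih h)
  | h01 y b ih =>
    rw [orderedPerms_nil_cons, List.mem_map] at h
    obtain ⟨σ, h, rfl⟩ := h
    exact mem_orderedPerms_inr (ih h)
  | h11 x a y b ih₁ ih₂ =>
    rw [orderedPerms_cons_cons, List.mem_append, List.mem_map, List.mem_map] at h
    obtain ⟨σ, h, rfl⟩ | ⟨σ, h, rfl⟩ := h
    · exact mem_orderedPerms_inl (ih₁ h)
    · exact mem_orderedPerms_inr (ih₂ h)

theorem exists_mem_orderedPerms (a b : List V) : ∃ σ, σ ∈ orderedPerms a b := by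
  obtain ⟨σ, hσ, _⟩ := occurs_nil a b
  exact ⟨σ, hσ⟩

/-- Prepending an ordered permutation of the legs already removed gives one of all legs. The words
met by the operators are thus those of the regularity hypothesis. -/
theorem Occurs.infix {α β a b : List V} (ha : a <:+ α) (hb : b <:+ β) {w : List (Leg V)}
    (h : Occurs a b w) : ∃ σ ∈ orderedPerms α β, w <:+: σ := by
  obtain ⟨a', rfl⟩ := ha
  obtain ⟨b', rfl⟩ := hb
  obtain ⟨σ, hσ, hw⟩ := h
  obtain ⟨σ', hσ'⟩ := exists_mem_orderedPerms a' b'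
  exact ⟨σ' ++ σ, append_mem_orderedPerms hσ' hσ, hw.isInfix.trans (List.suffix_append _ _).isInfix⟩

theorem onAlpha_map_inl (g : List V → S) (l : List V) : onAlpha g (l.map Sum.inl) = g l := by
  induction l generalizing g with
  | nil => rfl
  | cons x l ih => exact ih _

theorem onAlpha_eq_zero (g : List V → S) {w : List (Leg V)} {y : V} (h : Sum.inr y ∈ w) :
    onAlpha g w = 0 := by
  induction w generalizing g with
  | nil => simp at h
  | cons x w ih =>
    cases x with
    | inl x => exact ih _ (by simpa using h)
    | inr x => rfl

theorem onBeta_map_inr (g : List V → S) (l : List V) : onBeta g (l.map Sum.inr) = g l := by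
  induction l generalizing g with
  | nil => rfl
  | cons x l ih => exact ih _

theorem onBeta_eq_zero (g : List V → S) {w : List (Leg V)} {y : V} (h : Sum.inl y ∈ w) :
    onBeta g w = 0 := by
  induction w generalizing g with
  | nil => simp at h
  | cons x w ih =>
    cases x with
    | inr x => exact ih _ (by simpa using h)
    | inl x => rfl

theorem eq_map_inl_or (w : List (Leg V)) :
    w = (alphaMomenta w).map Sum.inl ∨ ∃ y, Sum.inr y ∈ w := by
  induction w with
  | nil => simp [alphaMomenta]
  | cons x w ih =>
    cases x with
    | inl x =>
      rcases ih with h | ⟨y, h⟩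
      · left
        simpa [alphaMomenta] using h
      · exact Or.inr ⟨y, by simp [h]⟩
    | inr x => exact Or.inr ⟨x, by simp⟩

theorem eq_map_inr_or (w : List (Leg V)) :
    w = (betaMomenta w).map Sum.inr ∨ ∃ y, Sum.inl y ∈ w := by
  induction w with
  | nil => simp [betaMomenta]
  | cons x w ih =>
    cases x with
    | inr x =>
      rcases ih with h | ⟨y, h⟩
      · left
        simpa [betaMomenta] using h
      · exact Or.inr ⟨y, by simp [h]⟩
    | inl x => exact Or.inr ⟨x, by simp⟩

theorem map_mom_inl (l : List V) : (l.map Sum.inl).map mom = l := by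
  simp [mom, Function.comp_def]

theorem map_mom_inr (l : List V) : (l.map Sum.inr).map mom = l := by
  simp [mom, Function.comp_def]

theorem exists_mem_division {X : Type*} {w : List X} {d : List (List X)} (hd : d ∈ divisions w)
    {x : X} (hx : x ∈ w) : ∃ b ∈ d, x ∈ b := by
  rw [← ((mem_divisions w d).1 hd).1, List.mem_flatten] at hx
  exact hx

theorem onAlpha_even {g : List V → S} (hg : ∀ l, Even l.length → g l = 0) {w : List (Leg V)}
    (hw : Even w.length) : onAlpha g w = 0 := by
  rcases eq_map_inl_or w with h | ⟨y, h⟩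
  · rw [h] at hw ⊢
    rw [onAlpha_map_inl]
    exact hg _ (by simpa using hw)
  · exact onAlpha_eq_zero g h

theorem onBeta_even {g : List V → S} (hg : ∀ l, Even l.length → g l = 0) {w : List (Leg V)}
    (hw : Even w.length) : onBeta g w = 0 := by
  rcases eq_map_inr_or w with h | ⟨y, h⟩
  · rw [h] at hw ⊢
    rw [onBeta_map_inr]
    exact hg _ (by simpa using hw)
  · exact onBeta_eq_zero g h

end OrderedPerms

/-! ### Linearization of the field equation -/

section Uniqueness

variable {V S ι : Type*} [CommRing S] [AddCommGroup V] [Fintype ι] {α β : List V}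

variable (c : ι → S) (ξ : ι → V →+ S)

/-- The nonlinear term has two factors ∂T, each removing at least one leg. Replacing `T` by `T'` in
any one place therefore changes it only at order n + 1 or higher, and □ alone survives at order n.
-/
theorem fieldEq_sub_mem {n : ℕ} {T T' : Matrix (Pos α β) (Pos α β) S} (hT : T ∈ filt S α β 1)
    (hT' : T' ∈ filt S α β 1) (h : T - T' ∈ filt S α β n) :
    fieldEq c (fun μ => momMat α β (ξ μ)) T (geomInv T) (geomInv (-T)) -
      fieldEq c (fun μ => momMat α β (ξ μ)) T' (geomInv T') (geomInv (-T')) -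
      ∑ μ, c μ • der (momMat α β (ξ μ)) (der (momMat α β (ξ μ)) (T - T')) ∈
        filt S α β (n + 1) := by
  set k := geomInv T - geomInv (-T) with hk
  set k' := geomInv T' - geomInv (-T') with hk'
  have nT := Submodule.neg_mem _ hT
  have nT' := Submodule.neg_mem _ hT'
  have hk0 : k ∈ filt S α β 0 :=
    Submodule.sub_mem _ (geomInv_mem_filt hT) (geomInv_mem_filt nT)
  have hk0' : k' ∈ filt S α β 0 :=
    Submodule.sub_mem _ (geomInv_mem_filt hT') (geomInv_mem_filt nT')
  have hkk : k - k' ∈ filt S α β n := by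
    have e : k - k' = (geomInv T - geomInv T') - (geomInv (-T) - geomInv (-T')) := by
      rw [hk, hk']; abel
    rw [e]
    refine Submodule.sub_mem _ (geomInv_sub_mem hT hT' h) (geomInv_sub_mem nT nT' ?_)
    have : -T - -T' = -(T - T') := by abel
    rw [this]
    exact Submodule.neg_mem _ h
  have e : fieldEq c (fun μ => momMat α β (ξ μ)) T (geomInv T) (geomInv (-T)) -
      fieldEq c (fun μ => momMat α β (ξ μ)) T' (geomInv T') (geomInv (-T')) -
      ∑ μ, c μ • der (momMat α β (ξ μ)) (der (momMat α β (ξ μ)) (T - T')) =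
      ∑ μ, c μ • (der (momMat α β (ξ μ)) (T - T') * k * der (momMat α β (ξ μ)) T +
        der (momMat α β (ξ μ)) T' * (k - k') * der (momMat α β (ξ μ)) T +
        der (momMat α β (ξ μ)) T' * k' * der (momMat α β (ξ μ)) (T - T')) := by
    have e' : ∀ μ, der (momMat α β (ξ μ)) (T - T') * k * der (momMat α β (ξ μ)) T +
        der (momMat α β (ξ μ)) T' * (k - k') * der (momMat α β (ξ μ)) T +
        der (momMat α β (ξ μ)) T' * k' * der (momMat α β (ξ μ)) (T - T') =
        der (momMat α β (ξ μ)) T * k * der (momMat α β (ξ μ)) T -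
        der (momMat α β (ξ μ)) T' * k' * der (momMat α β (ξ μ)) T' := fun μ => by
      rw [der_sub]; noncomm_ring
    simp only [e']
    simp only [fieldEq, ← hk, ← hk', der_sub, smul_sub, Finset.sum_sub_distrib]
    abel
  rw [e]
  refine Submodule.sum_mem _ fun μ _ => Submodule.smul_mem _ _ ?_
  refine Submodule.add_mem _ (Submodule.add_mem _ ?_ ?_) ?_
  · simpa using filt_mul (filt_mul (der_mem_filt (ξ μ) h) hk0) (der_mem_filt (ξ μ) hT)
  · exact filt_mono (by omega)
      (filt_mul (filt_mul (der_mem_filt (ξ μ) hT') hkk) (der_mem_filt (ξ μ) hT))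
  · exact filt_mono (by omega)
      (filt_mul (filt_mul (der_mem_filt (ξ μ) hT') hk0') (der_mem_filt (ξ μ) h))

theorem box_apply (T : Matrix (Pos α β) (Pos α β) S) (p q : Pos α β) :
    (∑ μ, c μ • der (momMat α β (ξ μ)) (der (momMat α β (ξ μ)) T)) p q =
      sqComp c ξ ((sfx α p.1).sum + (sfx β p.2).sum - ((sfx α q.1).sum + (sfx β q.2).sum)) *
        T p q := by
  simp only [Matrix.sum_apply, Matrix.smul_apply, der_momMat_apply, smul_eq_mul, sqComp, map_sub,
    Finset.sum_mul]
  exact Finset.sum_congr rfl fun μ _ => by ring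

end Uniqueness

/-! ### The Cayley variable of the product as a matrix -/

section Alternating

variable {V S : Type*} [CommRing S] {α β : List V}

theorem mom_mem_of_infix {σ w : List (Leg V)} (hσ : σ ∈ orderedPerms α β) (hw : w <:+: σ)
    {x : Leg V} (hx : x ∈ w) : mom x ∈ α ∨ mom x ∈ β := by
  rw [← List.mem_append]
  exact (perm_of_mem_orderedPerms hσ).subset (List.mem_map_of_mem (hw.subset hx))

/-- The matrix of the alternating products `A₁ B₁ A₂ ⋯` and `B₁ A₁ B₂ ⋯` with an odd number of
factors. -/
def alternatingMat (x y : Matrix (Pos α β) (Pos α β) S) : Matrix (Pos α β) (Pos α β) S :=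
  x * geomInv (-(y * x)) + geomInv (-(y * x)) * y

theorem alternatingMat_mem_filt {x y : Matrix (Pos α β) (Pos α β) S} (hx : x ∈ filt S α β 1)
    (hy : y ∈ filt S α β 1) : alternatingMat x y ∈ filt S α β 1 := by
  have hD := geomInv_mem_filt (Submodule.neg_mem _ (filt_mono (by omega) (filt_mul hy hx)))
  exact Submodule.add_mem _ (filt_mul hx hD) (filt_mono (by omega) (filt_mul hD hy))

theorem alternatingMat_sub_mem_filt {x y : Matrix (Pos α β) (Pos α β) S} (hx : x ∈ filt S α β 1)
    (hy : y ∈ filt S α β 1) : alternatingMat x y - (x + y) ∈ filt S α β 2 := by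
  have hyx : -(y * x) ∈ filt S α β 1 := Submodule.neg_mem _ (filt_mono (by omega) (filt_mul hy hx))
  have hD := geomInv_mem_filt hyx
  have e : geomInv (-(y * x)) - 1 = -(y * x) * geomInv (-(y * x)) := by
    conv_lhs => rw [← mul_geomInv hyx]
    noncomm_ring
  have hD1 : geomInv (-(y * x)) - 1 ∈ filt S α β 2 := by
    rw [e]
    exact filt_mul (Submodule.neg_mem _ (filt_mul hy hx)) hD
  have : alternatingMat x y - (x + y) =
      x * (geomInv (-(y * x)) - 1) + (geomInv (-(y * x)) - 1) * y := by
    rw [alternatingMat]; noncomm_ring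
  rw [this]
  exact Submodule.add_mem _ (filt_mono (by omega) (filt_mul hx hD1))
    (filt_mono (by omega) (filt_mul hD1 hy))

theorem alternatingMat_mem_parity {x y : Matrix (Pos α β) (Pos α β) S} (hx : x ∈ parity S α β 1)
    (hy : y ∈ parity S α β 1) : alternatingMat x y ∈ parity S α β 1 := by
  have hD := geomInv_mem_parity
    (Submodule.neg_mem _ (parity_congr (by decide) (parity_mul hy hx)))
  exact Submodule.add_mem _ (parity_mul hx hD)
    (parity_congr (by decide) (parity_mul hD hy))

end Alternating

/-! ### The currents as solutions of the field equation -/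

section Solution

variable {K V S ι : Type*} [Field K] [AddCommGroup V] [Module K V] [CommRing S] [Fintype ι]
  {η : LinearMap.BilinForm K V} {F : K} {α β : List V} (φ : K →+* S) {lam : S}
  {c : ι → S} {ξ : ι → V →+ S} {W : Submodule K V}

/-- The rescaled current. -/
def scaledCurrent (η : LinearMap.BilinForm K V) (F : K) (φ : K →+* S) (lam : S) (l : List V) : S :=
  lam * φ (current η F l)

theorem scaledCurrent_even (η : LinearMap.BilinForm K V) (F : K) (lam : S) (l : List V)
    (h : Even l.length) : scaledCurrent η F φ lam l = 0 := by
  rw [scaledCurrent, current_even η F h, map_zero, mul_zero]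

/-- Since 𝒜 = P² J, the kinetic term and the vertices cancel wherever the propagator is regular;
even words and single on-shell legs need no such condition. -/
theorem vertexSum_eq_zero (hlam : lam * lam = φ (-(1 / (2 * F ^ 2))))
    (hsq : ∀ v ∈ W, sqComp c ξ v = φ (sq η v)) {f : List (Leg V) → S} {w : List (Leg V)}
    (hf : ∀ b, b <:+: w → f b = scaledCurrent η F φ lam (b.map mom))
    (hW : ∀ x ∈ w, mom x ∈ W) (hw : ∀ x ∈ w, sq η (mom x) = 0)
    (hr : 3 ≤ w.length → Odd w.length → sq η (w.map mom).sum ≠ 0) : vertexSum c ξ f w = 0 := by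
  rw [vertexSum_current η F φ hlam hsq hW ?_ fun b hb _ => hf b hb, hf w (List.infix_refl w),
    scaledCurrent, amplitude_eq_of_regular η F (by simpa using hr), map_mul]
  · ring
  · intro h
    obtain ⟨x, rfl⟩ := List.length_eq_one_iff.1 h
    simpa using hw x (by simp)

/-- A word with a β-leg has in each division a block containing that leg, where the function
vanishes. All other words are consecutive legs of α. -/
theorem vertexSum_onAlpha (hlam : lam * lam = φ (-(1 / (2 * F ^ 2))))
    (hsq : ∀ v ∈ W, sqComp c ξ v = φ (sq η v)) (hαW : ∀ a ∈ α, a ∈ W) (hα : ∀ a ∈ α, sq η a = 0)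
    (hreg : RegularKinematics η α β) {a b : List V} (ha : a <:+ α)
    {w : List (Leg V)} (hw : Occurs a b w) :
    vertexSum c ξ (onAlpha (scaledCurrent η F φ lam)) w = 0 := by
  obtain ⟨σ, hσ, hwσ⟩ := hw
  rcases eq_map_inl_or w with h | ⟨y, h⟩
  · have hl : alphaMomenta w <:+: α := by
      have := hwσ.filterMap Sum.getLeft?
      change alphaMomenta w <+: alphaMomenta σ at this
      rw [alphaMomenta_of_mem hσ] at this
      exact this.isInfix.trans ha.isInfix
    have hm : w.map mom = alphaMomenta w := by
      conv_lhs => rw [h]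
      exact map_mom_inl _
    have hx : ∀ x ∈ w, mom x ∈ α := fun x hx => hl.subset (hm ▸ List.mem_map_of_mem hx)
    refine vertexSum_eq_zero φ hlam hsq (fun b hb => ?_) (fun x h => hαW _ (hx x h))
      (fun x h => hα _ (hx x h)) fun h3 ho => ?_
    · rcases eq_map_inl_or b with hb' | ⟨y, hy⟩
      · conv_lhs => rw [hb']
        rw [onAlpha_map_inl]
        conv_rhs => rw [hb']
        rw [map_mom_inl]
      · have := hb.subset hy
        rw [h] at this
        simp at this
    · have hlen : w.length = (alphaMomenta w).length := by rw [← hm, List.length_map]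
      rw [hm]
      exact hreg _ (hlen ▸ h3) (hlen ▸ ho) (Or.inl hl)
  · refine divSum_eq_zero fun d hd => ?_
    obtain ⟨b, hb, hy⟩ := exists_mem_division hd h
    rw [List.prod_eq_zero (List.mem_map.2 ⟨b, hb, onAlpha_eq_zero _ hy⟩), mul_zero, ite_self]

theorem vertexSum_onBeta (hlam : lam * lam = φ (-(1 / (2 * F ^ 2))))
    (hsq : ∀ v ∈ W, sqComp c ξ v = φ (sq η v)) (hβW : ∀ b ∈ β, b ∈ W) (hβ : ∀ b ∈ β, sq η b = 0)
    (hreg : RegularKinematics η α β) {a b : List V} (hb : b <:+ β)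
    {w : List (Leg V)} (hw : Occurs a b w) :
    vertexSum c ξ (onBeta (scaledCurrent η F φ lam)) w = 0 := by
  obtain ⟨σ, hσ, hwσ⟩ := hw
  rcases eq_map_inr_or w with h | ⟨y, h⟩
  · have hl : betaMomenta w <:+: β := by
      have := hwσ.filterMap Sum.getRight?
      change betaMomenta w <+: betaMomenta σ at this
      rw [betaMomenta_of_mem hσ] at this
      exact this.isInfix.trans hb.isInfix
    have hm : w.map mom = betaMomenta w := by
      conv_lhs => rw [h]
      exact map_mom_inr _
    have hx : ∀ x ∈ w, mom x ∈ β := fun x hx => hl.subset (hm ▸ List.mem_map_of_mem hx)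
    refine vertexSum_eq_zero φ hlam hsq (fun b hb => ?_) (fun x h => hβW _ (hx x h))
      (fun x h => hβ _ (hx x h)) fun h3 ho => ?_
    · rcases eq_map_inr_or b with hb' | ⟨y, hy⟩
      · conv_lhs => rw [hb']
        rw [onBeta_map_inr]
        conv_rhs => rw [hb']
        rw [map_mom_inr]
      · have := hb.subset hy
        rw [h] at this
        simp at this
    · have hlen : w.length = (betaMomenta w).length := by rw [← hm, List.length_map]
      rw [hm]
      exact hreg _ (hlen ▸ h3) (hlen ▸ ho) (Or.inr (Or.inl hl))
  · refine divSum_eq_zero fun d hd => ?_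
    obtain ⟨b, hb, hy⟩ := exists_mem_division hd h
    rw [List.prod_eq_zero (List.mem_map.2 ⟨b, hb, onBeta_eq_zero _ hy⟩), mul_zero, ite_self]

/-- The currents of the words with fewer than `n` legs. -/
def truncCurrent (η : LinearMap.BilinForm K V) (F : K) (φ : K →+* S) (lam : S) (n : ℕ)
    (w : List (Leg V)) : S :=
  if w.length < n then scaledCurrent η F φ lam (w.map mom) else 0

theorem vertexSum_truncCurrent_of_lt (hlam : lam * lam = φ (-(1 / (2 * F ^ 2))))
    (hsq : ∀ v ∈ W, sqComp c ξ v = φ (sq η v)) (hαW : ∀ a ∈ α, a ∈ W) (hβW : ∀ b ∈ β, b ∈ W)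
    (hα : ∀ a ∈ α, sq η a = 0) (hβ : ∀ b ∈ β, sq η b = 0) (hreg : RegularKinematics η α β)
    {σ w : List (Leg V)} (hσ : σ ∈ orderedPerms α β) (hw : w <:+: σ)
    (hlt : w.length < α.length + β.length) :
    vertexSum c ξ (truncCurrent η F φ lam (α.length + β.length)) w = 0 := by
  refine vertexSum_eq_zero φ hlam hsq (fun b hb => if_pos (hb.length_le.trans_lt hlt))
    (fun x hx => (mom_mem_of_infix hσ hw hx).elim (hαW _) (hβW _))
    (fun x hx => (mom_mem_of_infix hσ hw hx).elim (hα _) (hβ _)) fun h3 ho => ?_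
  exact hreg _ (by simpa using h3) (by simpa using ho)
    (Or.inr (Or.inr ⟨σ, hσ, hw.map mom, by simpa using hlt⟩))

/-- On a complete ordering the truncation removes the kinetic term, so the amplitude is left as a
source. No propagator of leg 1 is needed. -/
theorem vertexSum_truncCurrent (hlam : lam * lam = φ (-(1 / (2 * F ^ 2))))
    (hsq : ∀ v ∈ W, sqComp c ξ v = φ (sq η v)) (hαW : ∀ a ∈ α, a ∈ W) (hβW : ∀ b ∈ β, b ∈ W)
    (hα : ∀ a ∈ α, sq η a = 0) (hβ : ∀ b ∈ β, sq η b = 0)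
    {σ : List (Leg V)} (hσ : σ ∈ orderedPerms α β) :
    vertexSum c ξ (truncCurrent η F φ lam (α.length + β.length)) σ =
      -(lam * φ (amplitude η F (σ.map mom))) := by
  have hlen : σ.length = α.length + β.length := by
    have := (perm_of_mem_orderedPerms hσ).length_eq
    rwa [List.length_map, List.length_append] at this
  have hx := fun x (hx : x ∈ σ) => mom_mem_of_infix hσ (List.infix_refl σ) hx
  rw [vertexSum_current η F φ hlam hsq
    (f := truncCurrent η F φ lam (α.length + β.length)) (fun x h => (hx x h).elim (hαW _) (hβW _)) ?_
    fun b _ hlt => if_pos (hlen ▸ hlt), truncCurrent, if_neg (by omega)]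
  · ring
  · intro h
    obtain ⟨x, rfl⟩ := List.length_eq_one_iff.1 h
    simpa using (hx x (by simp)).elim (hα _) (hβ _)

end Solution

/-! ### Comparison of the summed currents with the product solution -/

section Shuffles

variable {K V S S₀ ι : Type*} [Field K] [AddCommGroup V] [Module K V] [CommRing S] [CommRing S₀]
  [Fintype ι] {η : LinearMap.BilinForm K V} {F : K} {α β : List V} (φ : K →+* S) {lam t : S}
  {c : ι → S} {ξ : ι → V →+ S} {W : Submodule K V}

/-- The legs removed between `p` and `q` can be ordered so as to be consecutive in an ordered
permutation of α and β. By regularity the square of their momentum is a unit. -/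
theorem sqComp_ne_zero_of_le (hsq : ∀ v ∈ W, sqComp c ξ v = φ (sq η v))
    (hαW : ∀ a ∈ α, a ∈ W) (hβW : ∀ b ∈ β, b ∈ W) (hreg : RegularKinematics η α β)
    {p q : Pos α β} (hqp : q ≤ p) (h3 : lvl q + 3 ≤ lvl p) (hodd : Odd (lvl p - lvl q))
    (hlt : lvl p < lvl q + (α.length + β.length)) {r : S}
    (h : sqComp c ξ ((sfx α p.1).sum + (sfx β p.2).sum - ((sfx α q.1).sum + (sfx β q.2).sum)) *
      r = 0) : r = 0 := by
  have split : ∀ {l : List V} {i j : Fin (l.length + 1)}, i ≤ j →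
      ∃ l', l' ++ sfx l i = sfx l j := by
    intro l i j hij
    have : sfx l i <:+ sfx l j := List.suffix_of_suffix_length_le (sfx_suffix _ _)
      (sfx_suffix _ _) (by rw [length_sfx, length_sfx]; exact hij)
    exact this
  obtain ⟨a, ha⟩ := split hqp.1
  obtain ⟨b, hb⟩ := split hqp.2
  obtain ⟨σ, hσ⟩ := exists_mem_orderedPerms a b
  obtain ⟨σ', hσ'⟩ := exists_mem_orderedPerms (sfx α q.1) (sfx β q.2)
  have hocc : Occurs (sfx α p.1) (sfx β p.2) σ :=
    ⟨σ ++ σ', ha ▸ hb ▸ append_mem_orderedPerms hσ hσ', List.prefix_append _ _⟩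
  obtain ⟨τ, hτ, hστ⟩ := hocc.infix (sfx_suffix _ _) (sfx_suffix _ _)
  have hperm := perm_of_mem_orderedPerms hσ
  have hlen : σ.length = lvl p - lvl q := by
    have h₁ := hperm.length_eq
    have h₂ := congrArg List.length ha
    have h₃ := congrArg List.length hb
    simp only [List.length_map, List.length_append, length_sfx] at h₁ h₂ h₃
    simp only [lvl]; omega
  have hsum : (sfx α p.1).sum + (sfx β p.2).sum - ((sfx α q.1).sum + (sfx β q.2).sum) =
      (σ.map mom).sum := by
    rw [hperm.sum_eq, ← ha, ← hb]; simp only [List.sum_append]; abel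
  have hmem : (σ.map mom).sum ∈ W := list_sum_mem fun y hy => by
    obtain ⟨x, hx, rfl⟩ := List.mem_map.1 hy
    exact (mom_mem_of_infix hτ hστ hx).elim (hαW _) (hβW _)
  have hne : sq η (σ.map mom).sum ≠ 0 := by
    refine hreg _ ?_ ?_ (Or.inr (Or.inr ⟨τ, hτ, hστ.map mom, ?_⟩))
    · rw [List.length_map]; omega
    · rw [List.length_map, hlen]; exact hodd
    · rw [List.length_map]; omega
  rw [hsum, hsq _ hmem] at h
  have hu : φ (sq η (σ.map mom).sum)⁻¹ * φ (sq η (σ.map mom).sum) = 1 := by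
    rw [← map_mul, inv_mul_cancel₀ hne, map_one]
  rw [← one_mul r, ← hu, mul_assoc, h, mul_zero]

/-- Below order N = |α| + |β| the truncated currents Φ and the product solution Z satisfy the same
equation with the same linear part, hence coincide. At order N the equation for Φ has the amplitudes
as source while Φ itself has no term, so □Z at that order equals the weighted sum of amplitudes. -/
theorem sum_orderedPerms_eq (hlam : lam * lam = φ (-(1 / (2 * F ^ 2))))
    (hsq : ∀ v ∈ W, sqComp c ξ v = φ (sq η v)) (ht : t * t = 0) (ρ : S →+* S₀) (hρt : ρ t = 0)
    (hρ : ∀ r s, ρ r = ρ s → t * r = t * s) (h2 : ∀ r : S, 2 * r = 0 → r = 0)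
    (hαW : ∀ a ∈ α, a ∈ W) (hβW : ∀ b ∈ β, b ∈ W)
    (hα : ∀ a ∈ α, sq η a = 0) (hβ : ∀ b ∈ β, sq η b = 0) (hreg : RegularKinematics η α β) :
    ((orderedPerms α β).map fun σ =>
      wordWeight (legWeight c ξ t) σ * (lam * φ (amplitude η F (σ.map mom)))).sum =
      φ (sq η (α.sum + β.sum)) *
        alternatingMat (shMat (legWeight c ξ t) α β (onAlpha (scaledCurrent η F φ lam)))
          (shMat (legWeight c ξ t) α β (onBeta (scaledCurrent η F φ lam)))
          (Fin.last _, Fin.last _) (0, 0) := by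
  set g := scaledCurrent η F φ lam with hg
  set ω := legWeight c ξ t with hω
  set N := α.length + β.length with hN
  set x := shMat ω α β (onAlpha g) with hx
  set y := shMat ω α β (onBeta g) with hy
  set Φ := shMat ω α β (truncCurrent η F φ lam N) with hΦ
  set Z := alternatingMat x y with hZ
  set Q : ι → Matrix (Pos α β) (Pos α β) S := fun μ => momMat α β (ξ μ) with hQ
  have g_even : ∀ l : List V, Even l.length → g l = 0 := scaledCurrent_even φ η F lam
  have g_nil : g [] = 0 := g_even [] (by simp)
  have trunc_nil : truncCurrent η F φ lam N ([] : List (Leg V)) = 0 := by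
    simp only [truncCurrent, List.map_nil]; rw [← hg, g_nil, ite_self]
  have filt1 : ∀ f : List (Leg V) → S, f [] = 0 → shMat ω α β f ∈ filt S α β 1 := fun f hf =>
    shMat_mem_filt ω fun a b _ _ w _ hw => by
      rw [Nat.lt_one_iff, List.length_eq_zero_iff] at hw
      rw [hw, hf]
  have hx1 : x ∈ filt S α β 1 := filt1 _ g_nil
  have hy1 : y ∈ filt S α β 1 := filt1 _ g_nil
  have hΦ1 : Φ ∈ filt S α β 1 := filt1 _ trunc_nil
  have hZ1 : Z ∈ filt S α β 1 := alternatingMat_mem_filt hx1 hy1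
  have inv : ∀ {T : Matrix (Pos α β) (Pos α β) S}, T ∈ filt S α β 1 →
      geomInv T * (1 - T) = 1 ∧ (1 - T) * geomInv T = 1 := fun h =>
    ⟨geomInv_mul h, mul_geomInv h⟩
  have inv' : ∀ {T : Matrix (Pos α β) (Pos α β) S}, T ∈ filt S α β 1 →
      geomInv (-T) * (1 + T) = 1 ∧ (1 + T) * geomInv (-T) = 1 := fun {T} h => by
    have := inv (Submodule.neg_mem _ h)
    rwa [sub_neg_eq_add] at this
  have eom : ∀ f : List (Leg V) → S, f [] = 0 →
      fieldEq c Q (shMat ω α β f) (geomInv (shMat ω α β f)) (geomInv (-shMat ω α β f)) =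
        (1 - shMat ω α β f * shMat ω α β f) * shMat ω α β (vertexSum c ξ f) *
          (1 - shMat ω α β f * shMat ω α β f) := fun f hf =>
    fieldEq_shMat c ξ ω α β hf (inv (filt1 f hf)).1 (inv (filt1 f hf)).2 (inv' (filt1 f hf)).1
      (inv' (filt1 f hf)).2
  have ex : fieldEq c Q x (geomInv x) (geomInv (-x)) = 0 := by
    rw [hx, eom _ g_nil, eq_zero_of_mem_filt (Nat.lt_succ_self _) (shMat_mem_filt ω
      fun a b ha _ w hw _ => vertexSum_onAlpha φ hlam hsq hαW hα hreg ha hw)]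
    simp
  have ey : fieldEq c Q y (geomInv y) (geomInv (-y)) = 0 := by
    rw [hy, eom _ g_nil, eq_zero_of_mem_filt (Nat.lt_succ_self _) (shMat_mem_filt ω
      fun a b _ hb w hw _ => vertexSum_onBeta φ hlam hsq hβW hβ hreg hb hw)]
    simp
  have eZ : fieldEq c Q Z (geomInv Z) (geomInv (-Z)) = 0 := by
    have hxa := shMat_onAlpha_mem c ξ α β ht g
    have hyb := shMat_onBeta_mem α β ω g
    have hyx : y * x ∈ filt S α β 1 := filt_mono (by omega) (filt_mul hy1 hx1)
    refine (firstOrderCommuting_matrix c ξ α β ht ρ hρt hρ).fieldEq_product ?_ hxa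
      (geomInv_mem α β hxa) (geomInv_mem α β (neg_mem hxa)) hyb (geomInv_mem α β hyb)
      (geomInv_mem α β (neg_mem hyb)) (inv hx1) (inv' hx1) (inv hy1) (inv' hy1) (inv' hyx)
      (inv hZ1) (inv' hZ1) ex ey
    intro A hA
    ext p q
    refine h2 _ ?_
    have := congrFun (congrFun hA p) q
    rw [two_mul, Matrix.add_apply] at this
    rw [two_mul, this]; rfl
  have hV : shMat ω α β (vertexSum c ξ (truncCurrent η F φ lam N)) ∈ filt S α β N :=
    shMat_mem_filt ω fun a b ha hb w hw hlt => by
      obtain ⟨σ, hσ, hwσ⟩ := hw.infix ha hb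
      exact vertexSum_truncCurrent_of_lt φ hlam hsq hαW hβW hα hβ hreg hσ hwσ hlt
  -- The source already has order N, so the factors 1 - Φ² around it count as 1.
  have eΦ : fieldEq c Q Φ (geomInv Φ) (geomInv (-Φ)) -
      shMat ω α β (vertexSum c ξ (truncCurrent η F φ lam N)) ∈ filt S α β (N + 1) := by
    rw [hΦ, eom _ trunc_nil, ← hΦ]
    set M := shMat ω α β (vertexSum c ξ (truncCurrent η F φ lam N))
    have e : (1 - Φ * Φ) * M * (1 - Φ * Φ) - M = Φ * (Φ * (M * (Φ * Φ))) - M * (Φ * Φ) -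
      Φ * Φ * M := by noncomm_ring
    have h₁ := filt_mul hV (filt_mul hΦ1 hΦ1)
    rw [e]
    exact Submodule.sub_mem _ (Submodule.sub_mem _
      (filt_mono (by omega) (filt_mul hΦ1 (filt_mul hΦ1 h₁))) (filt_mono (by omega) h₁))
      (filt_mono (by omega) (filt_mul (filt_mul hΦ1 hΦ1) hV))
  have eΦN : fieldEq c Q Φ (geomInv Φ) (geomInv (-Φ)) ∈ filt S α β N := by
    have := Submodule.add_mem _ (filt_mono (Nat.le_succ N) eΦ) hV
    rwa [sub_add_cancel] at this
  have par : Φ - Z ∈ parity S α β 1 := by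
    refine Submodule.sub_mem _ (shMat_mem_parity ω fun w hw => ?_) (alternatingMat_mem_parity
      (shMat_mem_parity ω fun w hw => onAlpha_even g_even hw)
      (shMat_mem_parity ω fun w hw => onBeta_even g_even hw))
    simp only [truncCurrent]
    rw [← hg, g_even _ (by simpa using hw), ite_self]
  -- Order by order: single letters are compared directly, even orders vanish by parity, and at odd
  -- orders from 3 to N - 1 the operator □ is invertible.
  have step : ∀ n, n ≤ N → Φ - Z ∈ filt S α β n := by
    intro n
    induction n with
    | zero => exact fun _ => filt_mono (Nat.zero_le 1) (Submodule.sub_mem _ hΦ1 hZ1)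
    | succ n ih =>
      intro hn
      have ihn := ih (by omega)
      rcases Nat.lt_or_ge n 2 with hn2 | hn2
      · rcases Nat.eq_zero_or_pos n with rfl | hpos
        · exact Submodule.sub_mem _ hΦ1 hZ1
        · obtain rfl : n = 1 := by omega
          have e : Φ - Z = (Φ - (x + y)) - (Z - (x + y)) := by abel
          rw [e]
          refine Submodule.sub_mem _ ?_ (alternatingMat_sub_mem_filt hx1 hy1)
          rw [hΦ, hx, hy, ← map_add, ← map_sub]
          refine shMat_mem_filt ω fun a b _ _ w _ hw => ?_
          match w, hw with
          | [], _ => simp [trunc_nil, onAlpha, onBeta, g_nil]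
          | [Sum.inl v], _ =>
            simp [truncCurrent, onAlpha, onBeta, mom, (by omega : 1 < N), hg]
          | [Sum.inr v], _ =>
            simp [truncCurrent, onAlpha, onBeta, mom, (by omega : 1 < N), hg]
          | _ :: _ :: _, hw => simp at hw
      · have hbox := Submodule.sub_mem _ (filt_mono (by omega : n + 1 ≤ N) eΦN)
          (fieldEq_sub_mem c ξ hΦ1 hZ1 ihn)
        rw [eZ, sub_zero, sub_sub_cancel] at hbox
        intro p q hpq
        by_cases hle : q ≤ p ∧ lvl q + n ≤ lvl p
        · have hlvl : lvl p = lvl q + n := by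
            by_contra hne
            exact hpq ⟨hle.1, by omega⟩
          rcases Nat.even_or_odd n with he | ho
          · refine par p q ?_
            rw [hlvl, Nat.even_iff]
            rw [Nat.even_iff] at he
            omega
          · have h0 := hbox p q hpq
            rw [box_apply] at h0
            refine sqComp_ne_zero_of_le φ hsq hαW hβW hreg hle.1 ?_ ?_ (by omega) h0
            · obtain ⟨k, hk⟩ := ho; omega
            · rw [hlvl, Nat.add_sub_cancel_left]; exact ho
        · exact ihn p q hle
  -- At order N the operator □ is not inverted: its eigenvalue P² stays as a factor and may vanish.
  have top := fieldEq_sub_mem c ξ hΦ1 hZ1 (step N le_rfl)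
  rw [eZ, sub_zero] at top
  have top' := congrFun (congrFun (eq_zero_of_mem_filt (Nat.lt_succ_self _)
    (Submodule.sub_mem _ top eΦ)) (Fin.last _, Fin.last _)) (0, 0)
  rw [sub_sub_sub_cancel_left, Matrix.sub_apply, box_apply] at top'
  have hΦtop : ∀ f : List (Leg V) → S, shMat ω α β f (Fin.last _, Fin.last _) (0, 0) =
      ((orderedPerms α β).map fun σ => wordWeight ω σ * f σ).sum := fun f => by
    rw [shMat_apply, ← sh_lengthDelta_zero]
    simp [sfx_length]
  have hlen : ∀ σ ∈ orderedPerms α β, σ.length = N := fun σ hσ => by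
    have := (perm_of_mem_orderedPerms hσ).length_eq
    rwa [List.length_map, List.length_append] at this
  have hΦ0 : Φ (Fin.last _, Fin.last _) (0, 0) = 0 := by
    rw [hΦ, hΦtop]
    refine List.sum_eq_zero fun r hr => ?_
    obtain ⟨σ, hσ, rfl⟩ := List.mem_map.1 hr
    rw [truncCurrent, if_neg (by rw [hlen σ hσ]; exact lt_irrefl N), mul_zero]
  have hVtop : shMat ω α β (vertexSum c ξ (truncCurrent η F φ lam N)) (Fin.last _, Fin.last _)
      (0, 0) = -((orderedPerms α β).map fun σ =>
        wordWeight ω σ * (lam * φ (amplitude η F (σ.map mom)))).sum := by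
    rw [hΦtop, ← neg_one_mul, ← List.sum_map_mul_left]
    congr 1
    refine List.map_congr_left fun σ hσ => ?_
    rw [vertexSum_truncCurrent φ hlam hsq hαW hβW hα hβ hσ]; ring
  have hmem : α.sum + β.sum ∈ W := add_mem (list_sum_mem hαW) (list_sum_mem hβW)
  have hP : sqComp c ξ ((sfx α (Fin.last α.length : Fin (α.length + 1))).sum +
      (sfx β (Fin.last β.length : Fin (β.length + 1))).sum -
      ((sfx α (0 : Fin (α.length + 1))).sum + (sfx β (0 : Fin (β.length + 1))).sum)) =
      φ (sq η (α.sum + β.sum)) := by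
    rw [← hsq _ hmem]
    simp [sfx_length, sfx_zero]
  rw [hP, hVtop, Matrix.sub_apply, hΦ0] at top'
  have : (0 : Matrix (Pos α β) (Pos α β) S) (Fin.last _, Fin.last _) (0, 0) = 0 := rfl
  rw [this] at top'
  linear_combination -top'

end Shuffles

/-! ### Alternating products as sums over divisions -/

section AlternatingSums

variable {V S : Type*} [CommRing S]

theorem divSum_comm {X Y : Type*} (H : List (List X) → List (List Y) → S) (v : List X)
    (w : List Y) :
    divSum (fun d => divSum (H d) w) v = divSum (fun e => divSum (fun d => H d e) v) w := by
  simp only [divSum]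
  induction divisions v with
  | nil => simp
  | cons d L ih => simp [List.sum_map_add, ih]

/-- The blocks as blocks of `α`-legs. -/
abbrev alphaBlocks (A : List (List V)) : List (List (Leg V)) := A.map (List.map Sum.inl)

/-- The blocks as blocks of `β`-legs. -/
abbrev betaBlocks (B : List (List V)) : List (List (Leg V)) := B.map (List.map Sum.inr)

theorem alphaBlocks_cons (u : List V) (A : List (List V)) :
    alphaBlocks (u :: A) = u.map Sum.inl :: alphaBlocks A := rfl

theorem betaBlocks_cons (u : List V) (B : List (List V)) :
    betaBlocks (u :: B) = u.map Sum.inr :: betaBlocks B := rfl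

theorem alternate_nil {X : Type*} (ws : List (List X)) : alternate [] ws = [] := by
  simp [alternate]

theorem alternate_cons {X : Type*} (u : List X) (us ws : List (List X)) :
    alternate (u :: us) ws = u ++ alternate ws us := by
  rw [alternate]

/-- The two orders are treated together because removing a block interchanges the roles of the
lists. -/
theorem filterMap_alternate {X Y : Type*} (g : X → Option Y) (us ws : List (List X))
    (hg : ∀ w ∈ ws, w.filterMap g = []) :
    (ws.length ≤ us.length → us.length ≤ ws.length + 1 →
      (alternate us ws).filterMap g = us.flatten.filterMap g) ∧
    (us.length ≤ ws.length → ws.length ≤ us.length + 1 →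
      (alternate ws us).filterMap g = us.flatten.filterMap g) := by
  induction us generalizing ws with
  | nil =>
    refine ⟨fun _ _ => by simp [alternate_nil], fun _ h => ?_⟩
    match ws, h with
    | [], _ => simp [alternate_nil]
    | [w], _ => simpa [alternate_cons, alternate_nil] using hg
    | _ :: _ :: _, h => simp at h
  | cons u us ih =>
    have first : ∀ ws : List (List X), (∀ w ∈ ws, w.filterMap g = []) →
        ws.length ≤ us.length + 1 → us.length + 1 ≤ ws.length + 1 →
        (alternate (u :: us) ws).filterMap g = (u :: us).flatten.filterMap g := by
      intro ws hg h₁ h₂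
      rw [alternate_cons, List.filterMap_append, (ih ws hg).2 (by omega) (by omega),
        List.flatten_cons, List.filterMap_append]
    refine ⟨fun h₁ h₂ => first ws hg (by simpa using h₁) (by simpa using h₂), fun h₁ h₂ => ?_⟩
    cases ws with
    | nil => simp at h₁
    | cons w ws =>
      rw [alternate_cons, List.filterMap_append, hg w (by simp), List.nil_append]
      simp only [List.length_cons] at h₁ h₂
      exact first ws (fun w hw => hg w (by simp [hw])) (by omega) (by omega)

theorem alphaMomenta_map_inl (l : List V) : alphaMomenta (l.map Sum.inl) = l := by
  induction l with
  | nil => rfl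
  | cons x l ih => exact congrArg (x :: ·) ih

theorem betaMomenta_map_inr (l : List V) : betaMomenta (l.map Sum.inr) = l := by
  induction l with
  | nil => rfl
  | cons x l ih => exact congrArg (x :: ·) ih

theorem alphaMomenta_map_inr (l : List V) : alphaMomenta (l.map Sum.inr) = [] := by
  induction l with
  | nil => rfl
  | cons x l ih => exact ih

theorem betaMomenta_map_inl (l : List V) : betaMomenta (l.map Sum.inl) = [] := by
  induction l with
  | nil => rfl
  | cons x l ih => exact ih

theorem filterMap_alphaBlocks (A : List (List V)) :
    (alphaBlocks A).flatten.filterMap Sum.getLeft? = A.flatten := by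
  rw [← List.map_flatten]; exact alphaMomenta_map_inl _

theorem filterMap_betaBlocks (B : List (List V)) :
    (betaBlocks B).flatten.filterMap Sum.getRight? = B.flatten := by
  rw [← List.map_flatten]; exact betaMomenta_map_inr _

theorem alphaMomenta_alternate {A B : List (List V)} (h₁ : B.length ≤ A.length)
    (h₂ : A.length ≤ B.length + 1) :
    alphaMomenta (alternate (alphaBlocks A) (betaBlocks B)) = A.flatten := by
  rw [← filterMap_alphaBlocks]
  refine (filterMap_alternate _ _ _ ?_).1 (by simpa using h₁) (by simpa using h₂)
  intro w hw
  obtain ⟨b, _, rfl⟩ := List.mem_map.1 hw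
  exact alphaMomenta_map_inr b

theorem alphaMomenta_alternate' {A B : List (List V)} (h₁ : A.length ≤ B.length)
    (h₂ : B.length ≤ A.length + 1) :
    alphaMomenta (alternate (betaBlocks B) (alphaBlocks A)) = A.flatten := by
  rw [← filterMap_alphaBlocks]
  refine (filterMap_alternate _ _ _ ?_).2 (by simpa using h₁) (by simpa using h₂)
  intro w hw
  obtain ⟨b, _, rfl⟩ := List.mem_map.1 hw
  exact alphaMomenta_map_inr b

theorem betaMomenta_alternate {A B : List (List V)} (h₁ : B.length ≤ A.length)
    (h₂ : A.length ≤ B.length + 1) :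
    betaMomenta (alternate (alphaBlocks A) (betaBlocks B)) = B.flatten := by
  rw [← filterMap_betaBlocks]
  refine (filterMap_alternate _ _ _ ?_).2 (by simpa using h₁) (by simpa using h₂)
  intro w hw
  obtain ⟨b, _, rfl⟩ := List.mem_map.1 hw
  exact betaMomenta_map_inl b

theorem betaMomenta_alternate' {A B : List (List V)} (h₁ : A.length ≤ B.length)
    (h₂ : B.length ≤ A.length + 1) :
    betaMomenta (alternate (betaBlocks B) (alphaBlocks A)) = B.flatten := by
  rw [← filterMap_betaBlocks]
  refine (filterMap_alternate _ _ _ ?_).1 (by simpa using h₁) (by simpa using h₂)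
  intro w hw
  obtain ⟨b, _, rfl⟩ := List.mem_map.1 hw
  exact betaMomenta_map_inl b

theorem betaMomenta_append_inl (l : List V) (w : List (Leg V)) :
    betaMomenta (l.map Sum.inl ++ w) = betaMomenta w := by
  rw [betaMomenta, List.filterMap_append]
  change betaMomenta _ ++ betaMomenta w = _
  rw [betaMomenta_map_inl, List.nil_append]

variable (ω : V → List V → S)

theorem wordWeight_append_inl (l : List V) (w : List (Leg V)) :
    wordWeight ω (l.map Sum.inl ++ w) =
      (l.map fun x => ω x (betaMomenta w)).prod * wordWeight ω w := by
  induction l with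
  | nil => simp
  | cons x l ih =>
    rw [List.map_cons, List.cons_append, wordWeight, ih, betaMomenta_append_inl, List.map_cons,
      List.prod_cons, mul_assoc]

theorem wordWeight_append_inr (l : List V) (w : List (Leg V)) :
    wordWeight ω (l.map Sum.inr ++ w) = wordWeight ω w := by
  induction l with
  | nil => simp
  | cons x l ih => exact ih

/-- The sum over the divisions with `|A| = |B| + k` of the words `A₁ B₁ A₂ ⋯`. -/
def altA (g : List V → S) (k : ℕ) (a b : List V) : S :=
  divSum (fun A => divSum (fun B => if A.length = B.length + k then
    (-1) ^ B.length * (A.map g).prod * (B.map g).prod *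
      wordWeight ω (alternate (alphaBlocks A) (betaBlocks B)) else 0) b) a

/-- The sum over the divisions with `|B| = |A| + k` of the words `B₁ A₁ B₂ ⋯`. -/
def altB (g : List V → S) (k : ℕ) (a b : List V) : S :=
  divSum (fun B => divSum (fun A => if B.length = A.length + k then
    (-1) ^ A.length * (A.map g).prod * (B.map g).prod *
      wordWeight ω (alternate (betaBlocks B) (alphaBlocks A)) else 0) a) b

theorem divSum_length_zero {X : Type*} (H : List (List X) → S) (w : List X) :
    divSum (fun d => if 0 = d.length then H d else 0) w = H [] * unitWord w := by
  rw [← divSum_unit]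
  refine divSum_congr fun d _ => ?_
  cases d <;> simp

theorem lengthDelta_zero (a b : List V) :
    (lengthDelta 0 0 a b : S) = unitWord a * unitWord b := by
  cases a <;> cases b <;> simp [lengthDelta, unitWord]

theorem divSum_eq_peel {X : Type*} {H : List (List X) → S} {f : List X → S}
    {H' : List (List X) → S} (hf : f [] = 0) (h : ∀ b d, H (b :: d) = f b * H' d) (w : List X) :
    divSum H w = H [] * unitWord w + conv f (divSum H') w := by
  rw [← divSum_peel hf, ← divSum_unit, ← divSum_add]
  refine divSum_congr fun d _ => ?_
  cases d with
  | nil => simp [peel]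
  | cons b d => simp [peel, h]

theorem altA_one {g : List V → S} (hg : g [] = 0) (a b : List V) :
    altA ω g 1 a b = sh ω (onAlpha g) (altB ω g 0) a b := by
  rw [sh_onAlpha, altA]
  refine (divSum_eq_peel (f := fun l => g l * (l.map fun x => ω x b).prod)
    (H' := fun A => divSum (fun B => if B.length = A.length + 0 then
      (-1) ^ A.length * (A.map g).prod * (B.map g).prod *
        wordWeight ω (alternate (betaBlocks B) (alphaBlocks A)) else 0) b)
    (by simp [hg]) ?_ a).trans ?_
  · intro u A
    rw [← divSum_mul_left]
    refine divSum_congr fun B hB => ?_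
    by_cases h : B.length = A.length
    · rw [if_pos (by simp [h]), if_pos (by simp [h]), alphaBlocks_cons, alternate_cons,
        wordWeight_append_inl, betaMomenta_alternate' h.ge (by omega),
        ((mem_divisions b B).1 hB).1, h, List.map_cons, List.prod_cons]
      ring
    · rw [if_neg (by simpa using Ne.symm h), if_neg (by simpa using h), mul_zero]
  · rw [divSum_eq_zero (w := b) (by simp), zero_mul, zero_add]
    congr 1
    funext a'
    rw [altB, divSum_comm]

/-- Removing the first α-block leaves one β-block more than α-blocks, with one sign fewer; the empty
division gives the unit. Together with the three companion identities this is the recursion of the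
expansion of (1 + yx)⁻¹ and (1 + xy)⁻¹. -/
theorem altA_zero {g : List V → S} (hg : g [] = 0) (a b : List V) :
    altA ω g 0 a b = lengthDelta 0 0 a b - sh ω (onAlpha g) (altB ω g 1) a b := by
  rw [sh_onAlpha, altA]
  refine (divSum_eq_peel (f := fun l => g l * (l.map fun x => ω x b).prod)
    (H' := fun A => -1 * divSum (fun B => if B.length = A.length + 1 then
      (-1) ^ A.length * (A.map g).prod * (B.map g).prod *
        wordWeight ω (alternate (betaBlocks B) (alphaBlocks A)) else 0) b)
    (by simp [hg]) ?_ a).trans ?_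
  · intro u A
    rw [← divSum_mul_left, ← divSum_mul_left]
    refine divSum_congr fun B hB => ?_
    by_cases h : B.length = A.length + 1
    · rw [if_pos (by simp [h]), if_pos h, alphaBlocks_cons, alternate_cons,
        wordWeight_append_inl, betaMomenta_alternate' (by omega) h.le,
        ((mem_divisions b B).1 hB).1, h, List.map_cons, List.prod_cons]
      ring
    · rw [if_neg (by simpa using Ne.symm h), if_neg h, mul_zero, mul_zero]
  · rw [sub_eq_add_neg, lengthDelta_zero]
    congr 1
    · simp only [List.length_nil, add_zero]
      rw [divSum_length_zero]
      simp [alternate_nil, wordWeight, mul_comm]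
    · simp only [conv_eq_sum]
      refine Eq.trans ?_ (neg_one_mul _)
      rw [← List.sum_map_mul_left]
      congr 1
      refine List.map_congr_left fun k _ => ?_
      rw [divSum_mul_left, altB, divSum_comm]
      ring

theorem altB_one {g : List V → S} (hg : g [] = 0) (a b : List V) :
    altB ω g 1 a b = sh ω (onBeta g) (altA ω g 0) a b := by
  rw [sh_onBeta, altB]
  refine (divSum_eq_peel (f := g)
    (H' := fun B => divSum (fun A => if A.length = B.length + 0 then
      (-1) ^ B.length * (A.map g).prod * (B.map g).prod *
        wordWeight ω (alternate (alphaBlocks A) (betaBlocks B)) else 0) a) hg ?_ b).trans ?_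
  · intro u B
    rw [← divSum_mul_left]
    refine divSum_congr fun A _ => ?_
    by_cases h : A.length = B.length
    · rw [if_pos (by simp [h]), if_pos (by simp [h]), betaBlocks_cons, alternate_cons,
        wordWeight_append_inr, h, List.map_cons, List.prod_cons]
      ring
    · rw [if_neg (by simpa using Ne.symm h), if_neg (by simpa using h), mul_zero]
  · rw [divSum_eq_zero (w := a) (by simp), zero_mul, zero_add]
    congr 1
    funext b'
    rw [altA, divSum_comm]

theorem altB_zero {g : List V → S} (hg : g [] = 0) (a b : List V) :
    altB ω g 0 a b = lengthDelta 0 0 a b - sh ω (onBeta g) (altA ω g 1) a b := by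
  rw [sh_onBeta, altB]
  refine (divSum_eq_peel (f := g)
    (H' := fun B => -1 * divSum (fun A => if A.length = B.length + 1 then
      (-1) ^ B.length * (A.map g).prod * (B.map g).prod *
        wordWeight ω (alternate (alphaBlocks A) (betaBlocks B)) else 0) a) hg ?_ b).trans ?_
  · intro u B
    rw [← divSum_mul_left, ← divSum_mul_left]
    refine divSum_congr fun A _ => ?_
    by_cases h : A.length = B.length + 1
    · rw [if_pos (by simp [h]), if_pos h, betaBlocks_cons, alternate_cons,
        wordWeight_append_inr, h, List.map_cons, List.prod_cons]
      ring
    · rw [if_neg (by simpa using Ne.symm h), if_neg h, mul_zero, mul_zero]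
  · rw [sub_eq_add_neg, lengthDelta_zero]
    congr 1
    · simp only [List.length_nil, add_zero]
      rw [divSum_length_zero]
      simp [alternate_nil, wordWeight]
    · simp only [conv_eq_sum]
      refine Eq.trans ?_ (neg_one_mul _)
      rw [← List.sum_map_mul_left]
      congr 1
      refine List.map_congr_left fun k _ => ?_
      rw [divSum_mul_left, altA, divSum_comm]
      ring

/-- The column at (0, 0) is found by applying the matrices to its indicator vector. Inverses are
avoided: the sums with equally many blocks solve the linear equations that define them. -/
theorem alternatingMat_top {g : List V → S} (hg : g [] = 0) (α β : List V) :
    alternatingMat (shMat ω α β (onAlpha g)) (shMat ω α β (onBeta g))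
      (Fin.last _, Fin.last _) (0, 0) = altA ω g 1 α β + altB ω g 1 α β := by
  set x := shMat ω α β (onAlpha g) with hx
  set y := shMat ω α β (onBeta g) with hy
  have filt1 : ∀ f : List (Leg V) → S, f [] = 0 → shMat ω α β f ∈ filt S α β 1 := fun f hf =>
    shMat_mem_filt ω fun a b _ _ w _ hw => by
      rw [Nat.lt_one_iff, List.length_eq_zero_iff] at hw
      rw [hw, hf]
  have hx1 : x ∈ filt S α β 1 := filt1 _ hg
  have hy1 : y ∈ filt S α β 1 := filt1 _ hg
  let vec : (List V → List V → S) → Pos α β → S := fun m p => m (sfx α p.1) (sfx β p.2)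
  let e : Pos α β → S := vec (lengthDelta 0 0)
  have hxv : ∀ m, x.mulVec (vec m) = vec (sh ω (onAlpha g) m) := fun m => by
    funext p; exact shMat_mulVec ω α β _ m p
  have hyv : ∀ m, y.mulVec (vec m) = vec (sh ω (onBeta g) m) := fun m => by
    funext p; exact shMat_mulVec ω α β _ m p
  have hA1 : sh ω (onAlpha g) (altB ω g 0) = altA ω g 1 := by
    funext a b; rw [altA_one ω hg]
  have hB1 : sh ω (onBeta g) (altA ω g 0) = altB ω g 1 := by
    funext a b; rw [altB_one ω hg]
  have solve : ∀ (T : Matrix (Pos α β) (Pos α β) S) (v : Pos α β → S), T ∈ filt S α β 1 →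
      v + T.mulVec v = e → (geomInv (-T)).mulVec e = v := fun T v hT h => by
    have h1 : (1 + T).mulVec v = e := by rw [Matrix.add_mulVec, Matrix.one_mulVec, h]
    have h2 := geomInv_mul (Submodule.neg_mem _ hT)
    rw [sub_neg_eq_add] at h2
    rw [← h1, Matrix.mulVec_mulVec, h2, Matrix.one_mulVec]
  have hyx : y * x ∈ filt S α β 1 := filt_mono (by omega) (filt_mul hy1 hx1)
  have hxy : x * y ∈ filt S α β 1 := filt_mono (by omega) (filt_mul hx1 hy1)
  have hD : (geomInv (-(y * x))).mulVec e = vec (altB ω g 0) := by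
    refine solve _ _ hyx ?_
    rw [← Matrix.mulVec_mulVec, hxv, hA1, hyv]
    funext p
    simp only [Pi.add_apply, vec, e]
    rw [altB_zero ω hg]; ring
  have hD' : (geomInv (-(x * y))).mulVec e = vec (altA ω g 0) := by
    refine solve _ _ hxy ?_
    rw [← Matrix.mulVec_mulVec, hyv, hB1, hxv]
    funext p
    simp only [Pi.add_apply, vec, e]
    rw [altA_zero ω hg]; ring
  -- The identity (1 + yx)⁻¹ y = y (1 + xy)⁻¹ puts the β-block in front.
  have hDy : geomInv (-(y * x)) * y = y * geomInv (-(x * y)) := by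
    have h1 := geomInv_mul (Submodule.neg_mem _ hyx)
    have h2 := mul_geomInv (Submodule.neg_mem _ hxy)
    calc geomInv (-(y * x)) * y
        = geomInv (-(y * x)) * y * ((1 - -(x * y)) * geomInv (-(x * y))) := by rw [h2, mul_one]
      _ = geomInv (-(y * x)) * (1 - -(y * x)) * (y * geomInv (-(x * y))) := by noncomm_ring
      _ = y * geomInv (-(x * y)) := by rw [h1, one_mul]
  have entry : ∀ (T : Matrix (Pos α β) (Pos α β) S) (p : Pos α β), T.mulVec e p = T p (0, 0) := by
    intro T p
    have : e = Pi.single (0, 0) 1 := by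
      funext q
      simp only [e, vec]
      have := lengthDelta_sfx (S := S) α β q (0, 0)
      simp only [Fin.val_zero] at this
      rw [this, Pi.single_apply]
    rw [this, Matrix.mulVec_single_one]
    rfl
  refine (entry (alternatingMat x y) _).symm.trans ?_
  rw [alternatingMat, hDy, Matrix.add_mulVec, ← Matrix.mulVec_mulVec,
    ← Matrix.mulVec_mulVec, hD, hD', hxv, hyv, hA1, hB1, Pi.add_apply]
  simp [vec, sfx_length]

end AlternatingSums

/-! ### The legs of a diagram -/

section Divisions

variable {V : Type*}

theorem diagramWord_eq (A B : List (List V)) : diagramWord A B =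
    if A.length = B.length + 1 then alternate (alphaBlocks A) (betaBlocks B)
    else alternate (betaBlocks B) (alphaBlocks A) := rfl

theorem mem_divPairs {α β : List V} {d : List (List V) × List (List V)} (h : d ∈ divPairs α β) :
    d.1 ∈ divisions α ∧ d.2 ∈ divisions β ∧
      (d.1.length = d.2.length + 1 ∨ d.2.length = d.1.length + 1) := by
  rw [divPairs, List.mem_filter, List.product, List.mem_flatMap] at h
  obtain ⟨⟨a, ha, hd⟩, h⟩ := h
  obtain ⟨b, hb, rfl⟩ := List.mem_map.1 hd
  exact ⟨ha, hb, by simpa using h⟩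

theorem momenta_diagramWord {α β : List V} {d : List (List V) × List (List V)}
    (h : d ∈ divPairs α β) : alphaMomenta (diagramWord d.1 d.2) = α ∧
      betaMomenta (diagramWord d.1 d.2) = β := by
  obtain ⟨h₁, h₂, h⟩ := mem_divPairs h
  have e₁ := ((mem_divisions _ _).1 h₁).1
  have e₂ := ((mem_divisions _ _).1 h₂).1
  rw [diagramWord_eq]
  split_ifs with hl
  · rw [alphaMomenta_alternate (by omega) hl.le, betaMomenta_alternate (by omega) hl.le]
    exact ⟨e₁, e₂⟩
  · have hl' : d.2.length = d.1.length + 1 := h.resolve_left hl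
    rw [alphaMomenta_alternate' (by omega) hl'.le, betaMomenta_alternate' (by omega) hl'.le]
    exact ⟨e₁, e₂⟩

end Divisions

/-! ### The coefficients as sums over crossings -/

section Coefficients

variable {K V : Type*} [Field K] [AddCommGroup V] [Module K V] (η : LinearMap.BilinForm K V)

/-- The sum of `s_{a b}` over the pairs of an `α`-leg `a` that stands before a `β`-leg `b`. -/
def crossCoeff : List (Leg V) → K
  | [] => 0
  | Sum.inl x :: w => 2 * η x (betaMomenta w).sum + crossCoeff w
  | Sum.inr _ :: w => crossCoeff w

theorem sum_map_mandelstam (l : List V) (v : V) :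
    (l.map fun a => mandelstam η a v).sum = 2 * η l.sum v := by
  induction l with
  | nil => simp
  | cons x l ih =>
    rw [List.map_cons, List.sum_cons, ih, List.sum_cons, map_add, LinearMap.add_apply, mul_add,
      mandelstam]

/-- Every pair of an α-leg and a β-leg is counted once, in one of the two sums according to its
order. The pairs of α-legs give P_α² because the legs are on shell. -/
theorem readCoeff_add_crossCoeff (hη : η.IsSymm) {w : List (Leg V)}
    (h : ∀ a ∈ alphaMomenta w, sq η a = 0) :
    readCoeff η w + crossCoeff η w = sq η (alphaMomenta w).sum +
      2 * η (alphaMomenta w).sum (betaMomenta w).sum := by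
  induction w with
  | nil => simp [readCoeff, crossCoeff, alphaMomenta, betaMomenta, sq]
  | cons x w ih =>
    cases x with
    | inl x =>
      have hα : alphaMomenta (Sum.inl x :: w) = x :: alphaMomenta w := rfl
      have hβ : betaMomenta (Sum.inl x :: w) = betaMomenta w := rfl
      rw [hα] at h
      have ih := ih fun a ha => h a (by simp [ha])
      have hx : η x x = 0 := h x (by simp)
      have hs : η x (alphaMomenta w).sum = η (alphaMomenta w).sum x := hη.eq _ _
      rw [readCoeff, crossCoeff, hα, hβ, sum_map_mandelstam]
      simp only [sq, mom, Sum.elim_inl, id_eq, List.sum_cons, map_add, LinearMap.add_apply] at ih ⊢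
      linear_combination ih - hx - hs
    | inr y =>
      have hα : alphaMomenta (Sum.inr y :: w) = alphaMomenta w := rfl
      have hβ : betaMomenta (Sum.inr y :: w) = y :: betaMomenta w := rfl
      rw [hα] at h
      have ih := ih h
      rw [readCoeff, crossCoeff, hα, hβ, sum_map_mandelstam]
      simp only [sq, mom, Sum.elim_inr, id_eq, List.sum_cons, map_add] at ih ⊢
      linear_combination ih

/-- Leg 1 contributes 2 P_α·p₁ = -2P_α² - 2 P_α·P_β, which cancels the order-independent part. This
holds for any word with the given α- and β-legs, so permutations and diagrams are covered alike. -/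
theorem bcjCoeff_eq (hη : η.IsSymm) {α β : List V} (hα : ∀ a ∈ α, sq η a = 0)
    {w : List (Leg V)} (h₁ : alphaMomenta w = α) (h₂ : betaMomenta w = β) :
    bcjCoeff η (offShell α β) w = -(sq η α.sum + crossCoeff η w) := by
  have h := readCoeff_add_crossCoeff η hη (w := w) (by rw [h₁]; exact hα)
  rw [bcjCoeff, readCoeff, sum_map_mandelstam, h₁]
  rw [h₁, h₂] at h
  simp only [offShell, mom, Sum.elim_inr, id_eq, map_neg, map_add, sq] at h ⊢
  linear_combination h

theorem crossCoeff_append_inl (l : List V) (w : List (Leg V)) :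
    crossCoeff η (l.map Sum.inl ++ w) = 2 * η l.sum (betaMomenta w).sum + crossCoeff η w := by
  induction l with
  | nil => simp
  | cons x l ih =>
    rw [List.map_cons, List.cons_append, crossCoeff, ih, betaMomenta_append_inl, List.sum_cons,
      map_add, LinearMap.add_apply]
    ring

theorem crossCoeff_append_inr (l : List V) (w : List (Leg V)) :
    crossCoeff η (l.map Sum.inr ++ w) = crossCoeff η w := by
  induction l with
  | nil => simp
  | cons x l ih => exact ih

theorem sum_mandelstam_get (v : V) (B : List (List V)) :
    ∑ J : Fin B.length, mandelstam η v (B.get J).sum = 2 * η v B.flatten.sum := by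
  induction B with
  | nil => simp
  | cons u B ih =>
    change ∑ J : Fin (B.length + 1), _ = _
    rw [Fin.sum_univ_succ]
    simp only [List.get_cons_zero, List.get_cons_succ', ih, List.flatten_cons, List.sum_append,
      map_add, mul_add]
    rfl

/-- The block A_I precedes B_J when I ≤ J if the word starts with A₁, and when I < J if it starts
with B₁. Removing a block passes from one case to the other. -/
theorem crossCoeff_alternate (A B : List (List V)) :
    (B.length ≤ A.length → A.length ≤ B.length + 1 →
      crossCoeff η (alternate (alphaBlocks A) (betaBlocks B)) =
        ∑ I : Fin A.length, ∑ J : Fin B.length, (if (I : ℕ) ≤ J then 1 else 0) *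
          mandelstam η (A.get I).sum (B.get J).sum) ∧
    (A.length ≤ B.length → B.length ≤ A.length + 1 →
      crossCoeff η (alternate (betaBlocks B) (alphaBlocks A)) =
        ∑ I : Fin A.length, ∑ J : Fin B.length, (if (I : ℕ) < J then 1 else 0) *
          mandelstam η (A.get I).sum (B.get J).sum) := by
  induction A generalizing B with
  | nil =>
    refine ⟨fun _ _ => by simp [alternate_nil, crossCoeff], fun _ h => ?_⟩
    match B, h with
    | [], _ => simp [alternate_nil, crossCoeff]
    | [u], _ =>
      rw [betaBlocks_cons, alternate_cons, crossCoeff_append_inr]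
      simp [alternate_nil, crossCoeff]
    | _ :: _ :: _, h => simp at h
  | cons u A ih =>
    have first : ∀ B : List (List V), B.length ≤ A.length + 1 → A.length + 1 ≤ B.length + 1 →
        crossCoeff η (alternate (alphaBlocks (u :: A)) (betaBlocks B)) =
          ∑ I : Fin (A.length + 1), ∑ J : Fin B.length, (if (I : ℕ) ≤ J then 1 else 0) *
            mandelstam η ((u :: A).get I).sum (B.get J).sum := by
      intro B h₁ h₂
      rw [alphaBlocks_cons, alternate_cons, crossCoeff_append_inl,
        betaMomenta_alternate' (by omega) h₁, (ih B).2 (by omega) h₁, Fin.sum_univ_succ]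
      simp only [List.get_cons_zero, List.get_cons_succ', Fin.val_zero, Nat.zero_le, if_true,
        one_mul, sum_mandelstam_get, Fin.val_succ, Nat.succ_le_iff]
    refine ⟨fun h₁ h₂ => first B (by simpa using h₁) (by simpa using h₂), fun h₁ h₂ => ?_⟩
    cases B with
    | nil => simp at h₁
    | cons v B =>
      simp only [List.length_cons] at h₁ h₂
      rw [betaBlocks_cons, alternate_cons, crossCoeff_append_inr, first B (by omega) (by omega)]
      refine Finset.sum_congr rfl fun I _ => ?_
      change _ = ∑ J : Fin (B.length + 1), _
      rw [Fin.sum_univ_succ]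
      simp only [List.get_cons_succ', Fin.val_zero, Nat.not_lt_zero, if_false, zero_mul, zero_add,
        Fin.val_succ, Nat.lt_succ_iff]

theorem crossCoeff_diagramWord {A B : List (List V)}
    (h : A.length = B.length + 1 ∨ B.length = A.length + 1) :
    crossCoeff η (diagramWord A B) =
      ∑ I : Fin A.length, ∑ J : Fin B.length,
        (coeffMatrix A.length B.length I J : K) * mandelstam η (A.get I).sum (B.get J).sum := by
  rw [diagramWord_eq]
  split_ifs with hl
  · rw [(crossCoeff_alternate η A B).1 (by omega) hl.le]
    have h' : B.length ≠ A.length + 1 := by omega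
    simp only [coeffMatrix, if_neg h', if_pos hl]
    push_cast
    rfl
  · have hl' := h.resolve_left hl
    rw [(crossCoeff_alternate η A B).2 (by omega) hl'.le]
    simp only [coeffMatrix, if_pos hl']
    push_cast
    rfl

variable {S ι : Type*} [CommRing S] [Fintype ι]

theorem wordWeight_legWeight (φ : K →+* S) {t : S} (ht : t * t = 0) {c : ι → S} {ξ : ι → V →+ S}
    {W : Submodule K V} (hdot : ∀ v ∈ W, ∀ w ∈ W, dotComp c ξ v w = φ (η v w))
    {w : List (Leg V)} (hα : ∀ a ∈ alphaMomenta w, a ∈ W) (hβ : ∀ b ∈ betaMomenta w, b ∈ W) :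
    wordWeight (legWeight c ξ t) w = 1 + t * φ (crossCoeff η w) := by
  induction w with
  | nil => simp [wordWeight, crossCoeff]
  | cons x w ih =>
    cases x with
    | inl x =>
      have eα : alphaMomenta (Sum.inl x :: w) = x :: alphaMomenta w := rfl
      have eβ : betaMomenta (Sum.inl x :: w) = betaMomenta w := rfl
      rw [eα] at hα
      rw [eβ] at hβ
      rw [wordWeight, crossCoeff, ih (fun a ha => hα a (by simp [ha])) hβ, legWeight,
        hdot x (hα x (by simp)) _ (list_sum_mem hβ), map_add, map_mul, map_ofNat]
      linear_combination (2 * φ (η x (betaMomenta w).sum) * φ (crossCoeff η w)) * ht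
    | inr y =>
      have eβ : betaMomenta (Sum.inr y :: w) = y :: betaMomenta w := rfl
      rw [eβ] at hβ
      exact ih hα fun b hb => hβ b (by simp [hb])

/-- An orthogonal basis of the finite-dimensional `W` diagonalizes the possibly degenerate form, and
its coordinate functions are extended to all of V. Components are needed because each one gives a
derivation. -/
theorem exists_coordinates [CharZero K] (hη : η.IsSymm) (W : Submodule K V)
    [FiniteDimensional K W] :
    ∃ (n : ℕ) (c : Fin n → K) (x : Fin n → V →ₗ[K] K),
      ∀ v ∈ W, ∀ w ∈ W, η v w = ∑ μ, c μ * (x μ v * x μ w) := by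
  have : Invertible (2 : K) := invertibleOfNonzero two_ne_zero
  obtain ⟨b, hb⟩ := LinearMap.BilinForm.exists_orthogonal_basis
    (B := LinearMap.BilinForm.restrict η W) ⟨fun x y => hη.eq x y⟩
  choose x hx using fun μ => LinearMap.exists_extend (p := W) (b.coord μ)
  refine ⟨_, fun μ => η (b μ) (b μ), x, fun v hv w hw => ?_⟩
  have hxv : ∀ μ, ∀ u : W, x μ u = b.repr u μ := fun μ u => LinearMap.congr_fun (hx μ) u
  have key : ∀ u u' : W, LinearMap.BilinForm.restrict η W u u' =
      ∑ μ, η (b μ) (b μ) * (b.repr u μ * b.repr u' μ) := by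
    intro u u'
    conv_lhs => rw [← b.sum_repr u, ← b.sum_repr u']
    simp only [map_sum, LinearMap.sum_apply, map_smul, LinearMap.smul_apply, smul_eq_mul]
    refine Finset.sum_congr rfl fun μ _ => ?_
    rw [Finset.sum_eq_single μ]
    · change _ * (_ * η (b μ) (b μ)) = _
      ring
    · intro ν _ hν
      have : LinearMap.BilinForm.restrict η W (b ν) (b μ) = 0 := hb hν
      rw [this, mul_zero]
    · simp
  have := key ⟨v, hv⟩ ⟨w, hw⟩
  simp only [← hxv] at this
  exact this

end Coefficients

/-! ### Sums over pairs of divisions -/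

section DivisionPairs

variable {V S : Type*} [CommRing S]

theorem sum_divPairs (α β : List V) (H : List (List V) × List (List V) → S) :
    ((divPairs α β).map H).sum =
      divSum (fun A => divSum (fun B => if A.length = B.length + 1 then H (A, B) else 0) β) α +
      divSum (fun B => divSum (fun A => if B.length = A.length + 1 then H (A, B) else 0) α) β := by
  rw [divSum_comm (fun B A => if B.length = A.length + 1 then H (A, B) else 0), ← divSum_add]
  have e : ∀ L : List (List (List V) × List (List V)),
      ((L.filter fun d => d.1.length = d.2.length + 1 ∨ d.2.length = d.1.length + 1).map H).sum =
      (L.map fun d => (if d.1.length = d.2.length + 1 then H d else 0) +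
        if d.2.length = d.1.length + 1 then H d else 0).sum := by
    intro L
    induction L with
    | nil => simp
    | cons d L ih =>
      by_cases h₁ : d.1.length = d.2.length + 1
      · have h₂ : d.2.length ≠ d.1.length + 1 := by omega
        rw [List.filter_cons_of_pos (by simp [h₁]), List.map_cons, List.sum_cons, ih,
          List.map_cons, List.sum_cons, if_pos h₁, if_neg h₂, add_zero]
      · by_cases h₂ : d.2.length = d.1.length + 1
        · rw [List.filter_cons_of_pos (by simp [h₂]), List.map_cons, List.sum_cons, ih,
            List.map_cons, List.sum_cons, if_neg h₁, if_pos h₂, zero_add]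
        · rw [List.filter_cons_of_neg (by simp [h₁, h₂]), ih, List.map_cons, List.sum_cons,
            if_neg h₁, if_neg h₂, add_zero, zero_add]
  rw [divPairs, e]
  simp only [← divSum_add]
  simp [divSum, List.product, List.flatMap_def, List.sum_flatten, Function.comp_def]

end DivisionPairs

/-! ### Powers of the coupling constant -/

section DivisionSum

variable {K V S : Type*} [Field K] [AddCommGroup V] [Module K V] [CommRing S]
  (η : LinearMap.BilinForm K V) (F : K)

theorem prod_scaledCurrent (φ : K →+* S) (lam : S) (A : List (List V)) :
    (A.map (scaledCurrent η F φ lam)).prod =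
      lam ^ A.length * φ (A.map (current η F)).prod := by
  induction A with
  | nil => simp
  | cons u A ih =>
    rw [List.map_cons, List.prod_cons, ih, List.map_cons, List.prod_cons, map_mul, scaledCurrent,
      List.length_cons, pow_succ]
    ring

/-- The weight of the diagram of a division, without the propagator and the coefficient. -/
def diagramWeight (d : List (List V) × List (List V)) : K :=
  (1 / (2 * F ^ 2)) ^ ((d.1.length + d.2.length - 1) / 2) *
    ((d.1.map (current η F)).prod * (d.2.map (current η F)).prod)

theorem altA_add_altB {φ : K →+* S} {lam : S} (hlam : lam * lam = φ (-(1 / (2 * F ^ 2))))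
    (ω : V → List V → S) (α β : List V) :
    altA ω (scaledCurrent η F φ lam) 1 α β + altB ω (scaledCurrent η F φ lam) 1 α β =
      ((divPairs α β).map fun d =>
        wordWeight ω (diagramWord d.1 d.2) * (lam * φ (diagramWeight η F d))).sum := by
  -- The sign from the expansion of (1 + yx)⁻¹ compensates lam² = -1/(2F²), so the coupling of a
  -- diagram is positive; one factor `lam` is left over.
  have hsign : ∀ n : ℕ, (-1) ^ n * (lam ^ (n + 1) * lam ^ n) =
      lam * φ (1 / (2 * F ^ 2)) ^ n := fun n => by
    have : φ (1 / (2 * F ^ 2)) = -1 * (lam * lam) := by rw [hlam, map_neg]; ring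
    rw [this, mul_pow, mul_pow]
    ring
  rw [sum_divPairs, altA, altB]
  congr 1
  · refine divSum_congr fun A _ => divSum_congr fun B _ => ?_
    split_ifs with h
    · have e : (A.length + B.length - 1) / 2 = B.length := by omega
      have hs := hsign B.length
      rw [diagramWeight, diagramWord_eq, if_pos h, prod_scaledCurrent, prod_scaledCurrent, e, h]
      simp only [map_mul, map_pow]
      linear_combination (φ (A.map (current η F)).prod * φ (B.map (current η F)).prod *
        wordWeight ω (alternate (alphaBlocks A) (betaBlocks B))) * hs
    · rfl
  · refine divSum_congr fun B _ => divSum_congr fun A _ => ?_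
    split_ifs with h
    · have e : (A.length + B.length - 1) / 2 = A.length := by omega
      have h' : A.length ≠ B.length + 1 := by omega
      have hs := hsign A.length
      rw [diagramWeight, diagramWord_eq, if_neg h', prod_scaledCurrent, prod_scaledCurrent, e, h]
      simp only [map_mul, map_pow]
      linear_combination (φ (A.map (current η F)).prod * φ (B.map (current η F)).prod *
        wordWeight ω (alternate (betaBlocks B) (alphaBlocks A))) * hs
    · rfl

end DivisionSum

/-! ### Dual numbers and the two permutation sums -/

section PermutationSum

open DualNumber

variable {K V : Type*} [Field K] [CharZero K] [AddCommGroup V] [Module K V]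

theorem sum_dual {K L X : Type*} [Field K] [Field L] (f : K →+* L) (z : L) (l : List X)
    (u v : X → K) :
    (l.map fun x => (1 + ε * TrivSqZeroExt.inlHom L L (f (u x))) *
      (TrivSqZeroExt.inlHom L L z * TrivSqZeroExt.inlHom L L (f (v x)))).sum =
    (TrivSqZeroExt.inl (z * f (l.map v).sum) +
      TrivSqZeroExt.inr (z * f (l.map fun x => u x * v x).sum) : L[ε]) := by
  induction l with
  | nil => simp
  | cons x l ih =>
    rw [List.map_cons, List.sum_cons, ih]
    ext <;> (simp [mul_add]; try ring)

/-- The sums over the ordered permutations of the amplitudes, and of the amplitudes weighted by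
`crossCoeff`, are sums over the diagrams of the divisions. -/
theorem sum_amplitude_and_sum_crossCoeff {η : LinearMap.BilinForm K V} (hη : η.IsSymm) {F : K}
    (hF : F ≠ 0) {α β : List V} (hα : ∀ a ∈ α, sq η a = 0) (hβ : ∀ b ∈ β, sq η b = 0)
    (hreg : RegularKinematics η α β) :
    ((orderedPerms α β).map fun σ => amplitude η F (σ.map mom)).sum =
        sq η (α.sum + β.sum) * ((divPairs α β).map (diagramWeight η F)).sum ∧
      ((orderedPerms α β).map fun σ => crossCoeff η σ * amplitude η F (σ.map mom)).sum =
        sq η (α.sum + β.sum) * ((divPairs α β).map fun d =>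
          crossCoeff η (diagramWord d.1 d.2) * diagramWeight η F d).sum := by
  -- The closure provides a square root of -1/(2F²), and the dual numbers over it provide t = ε. The
  -- root is cancelled at the end.
  let L := AlgebraicClosure K
  let f : K →+* L := algebraMap K L
  let i : L →+* L[ε] := TrivSqZeroExt.inlHom L L
  let φ : K →+* L[ε] := i.comp f
  obtain ⟨z, hz⟩ := IsAlgClosed.exists_pow_nat_eq (f (-(1 / (2 * F ^ 2)))) (n := 2) (by norm_num)
  have hz0 : z ≠ 0 := by
    rintro rfl
    have h0 : f (-(1 / (2 * F ^ 2))) = 0 := by rw [← hz]; simp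
    rw [map_eq_zero] at h0
    simp [hF] at h0
  have hlam : i z * i z = φ (-(1 / (2 * F ^ 2))) := by
    rw [← map_mul, ← pow_two, hz]; rfl
  let W : Submodule K V := Submodule.span K {v | v ∈ α ++ β}
  have : FiniteDimensional K W := FiniteDimensional.span_of_finite K (List.finite_toSet _)
  have hαW : ∀ a ∈ α, a ∈ W := fun a ha => Submodule.subset_span (List.mem_append_left _ ha)
  have hβW : ∀ b ∈ β, b ∈ W := fun b hb => Submodule.subset_span (List.mem_append_right _ hb)
  obtain ⟨n, c₀, x, hx⟩ := exists_coordinates η hη W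
  let c : Fin n → L[ε] := fun μ => φ (c₀ μ)
  let ξ : Fin n → V →+ L[ε] := fun μ => φ.toAddMonoidHom.comp (x μ).toAddMonoidHom
  have hdot : ∀ v ∈ W, ∀ w ∈ W, dotComp c ξ v w = φ (η v w) := fun v hv w hw => by
    rw [hx v hv w hw, map_sum]
    simp only [map_mul]
    rfl
  have ht : (ε : L[ε]) * ε = 0 := DualNumber.eps_mul_eps
  have key := sum_orderedPerms_eq (S₀ := L) (c := c) (ξ := ξ) (t := ε) φ hlam
    (fun v hv => hdot v hv v hv) ht (TrivSqZeroExt.fstHom L L L).toRingHom (by simp)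
    (fun r s h => by
      have h' : r.fst = s.fst := h
      ext <;> simp [h'])
    (fun r h => by
      rw [two_mul] at h
      ext
      · simpa using congrArg TrivSqZeroExt.fst h
      · simpa using congrArg TrivSqZeroExt.snd h) hαW hβW hα hβ hreg
  have hnil : scaledCurrent η F φ (i z) [] = 0 := scaledCurrent_even φ η F _ [] (by simp)
  have weight : ∀ w : List (Leg V), alphaMomenta w = α → betaMomenta w = β →
      wordWeight (legWeight c ξ ε) w = 1 + ε * φ (crossCoeff η w) := fun w h₁ h₂ =>
    wordWeight_legWeight η φ ht hdot (by rwa [h₁]) (by rwa [h₂])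
  rw [alternatingMat_top _ hnil, altA_add_altB η F hlam,
    List.map_congr_left (l := orderedPerms α β) (fun σ hσ => by
      rw [weight σ (alphaMomenta_of_mem hσ) (betaMomenta_of_mem hσ)]),
    List.map_congr_left (l := divPairs α β) (fun d hd => by
      rw [weight _ (momenta_diagramWord hd).1 (momenta_diagramWord hd).2])] at key
  -- One equation of dual numbers: its constant part is the plain sum of amplitudes, its ε-part the
  -- sum weighted by crossings.
  replace key := ((sum_dual f z (orderedPerms α β) _ _).symm.trans key).trans
    (congrArg (φ (sq η (α.sum + β.sum)) * ·) (sum_dual f z (divPairs α β) _ _))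
  have cancel : ∀ r s : K, z * f r = f (sq η (α.sum + β.sum)) * (z * f s) →
      r = sq η (α.sum + β.sum) * s := fun r s h => by
    refine f.injective (mul_left_cancel₀ hz0 ?_)
    rw [h, map_mul]
    ring
  refine ⟨cancel _ _ ?_, cancel _ _ ?_⟩
  · simpa [φ, i] using congrArg TrivSqZeroExt.fst key
  · simpa [φ, i] using congrArg TrivSqZeroExt.snd key

end PermutationSum

end NLSM

/-! ### The revised BCJ relation -/

theorem mainTheorem1 {K V : Type*} [Field K] [CharZero K] [AddCommGroup V] [Module K V]
    (η : LinearMap.BilinForm K V) (hη : η.IsSymm) (F : K) (hF : F ≠ 0)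
    (α β : List V) (hα : ∀ a ∈ α, NLSM.sq η a = 0) (hβ : ∀ b ∈ β, NLSM.sq η b = 0)
    (hreg : NLSM.RegularKinematics η α β) :
    NLSM.revisedBCJSum η F α β =
        ((NLSM.divPairs α β).map fun d =>
          (1 / (2 * F ^ 2)) ^ ((d.1.length + d.2.length - 1) / 2) *
            NLSM.sq η (NLSM.offShell α β) *
            NLSM.divCoeff η (NLSM.offShell α β) d.1 d.2 *
            (d.1.map (NLSM.current η F)).prod * (d.2.map (NLSM.current η F)).prod).sum ∧
      ∀ d ∈ NLSM.divPairs α β,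
        NLSM.divCoeff η (NLSM.offShell α β) d.1 d.2 =
          -(NLSM.sq η α.sum +
            ∑ I : Fin d.1.length, ∑ J : Fin d.2.length,
              (NLSM.coeffMatrix d.1.length d.2.length I J : K) *
                NLSM.mandelstam η (d.1.get I).sum (d.2.get J).sum) := by
  have hdiv : ∀ d ∈ NLSM.divPairs α β, NLSM.divCoeff η (NLSM.offShell α β) d.1 d.2 =
      -(NLSM.sq η α.sum + NLSM.crossCoeff η (NLSM.diagramWord d.1 d.2)) := fun d hd =>
    NLSM.bcjCoeff_eq η hη hα (NLSM.momenta_diagramWord hd).1 (NLSM.momenta_diagramWord hd).2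
  refine ⟨?_, fun d hd => by
    rw [hdiv d hd, NLSM.crossCoeff_diagramWord η (NLSM.mem_divPairs hd).2.2]⟩
  obtain ⟨h₁, h₂⟩ := NLSM.sum_amplitude_and_sum_crossCoeff hη hF hα hβ hreg
  have hp : NLSM.sq η (NLSM.offShell α β) = NLSM.sq η (α.sum + β.sum) := by
    simp only [NLSM.sq, NLSM.offShell, map_neg, LinearMap.neg_apply, neg_neg]
  -- Permutations and diagrams have coefficients of the same form -(P_α² + crossings), so the two
  -- identities combine with the same factors on both sides.
  have split : ∀ {X : Type _} (l : List X) (u v : X → K) (k : K),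
      (l.map fun x => k * (-(NLSM.sq η α.sum + u x) * v x)).sum =
        -k * (NLSM.sq η α.sum * (l.map v).sum + (l.map fun x => u x * v x).sum) := by
    intro X l u v k
    induction l with
    | nil => simp
    | cons x l ih => simp only [List.map_cons, List.sum_cons, ih]; ring
  have hl : NLSM.revisedBCJSum η F α β = ((NLSM.orderedPerms α β).map fun σ =>
      1 * (-(NLSM.sq η α.sum + NLSM.crossCoeff η σ) *
        NLSM.amplitude η F (σ.map NLSM.mom))).sum := by
    rw [NLSM.revisedBCJSum]
    refine congrArg List.sum (List.map_congr_left fun σ hσ => ?_)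
    rw [NLSM.bcjCoeff_eq η hη hα (NLSM.alphaMomenta_of_mem hσ) (NLSM.betaMomenta_of_mem hσ),
      one_mul]
  have hr : ((NLSM.divPairs α β).map fun d =>
      (1 / (2 * F ^ 2)) ^ ((d.1.length + d.2.length - 1) / 2) * NLSM.sq η (NLSM.offShell α β) *
        NLSM.divCoeff η (NLSM.offShell α β) d.1 d.2 *
        (d.1.map (NLSM.current η F)).prod * (d.2.map (NLSM.current η F)).prod).sum =
      ((NLSM.divPairs α β).map fun d => NLSM.sq η (α.sum + β.sum) *
        (-(NLSM.sq η α.sum + NLSM.crossCoeff η (NLSM.diagramWord d.1 d.2)) *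
          NLSM.diagramWeight η F d)).sum := by
    refine congrArg List.sum (List.map_congr_left fun d hd => ?_)
    rw [hp, hdiv d hd, NLSM.diagramWeight]
    ring
  rw [hl, hr, split, split, h₁, h₂]
  ring
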